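/- Let $(M,g)$ be a smooth Riemannian manifold of dimension $n$, let $\alpha=\xi\cdot dx$ be the canonical one-form of $T^*M$, $\omega=d\alpha$, and let $G^t$ be the geodesic flow on $T^*M$, with $\pi:T^*M\to M$ the projection. Let $z\in M$ be a blow-down point with first return time $T>0$: for every $\xi\in S^*_zM=\{\xi\in T_z^*M: |\xi|_g=1\}$ the geodesic $\pi G^t(z,\xi)$ is defined for all times and returns to $z$ for the first time at time $T$, i.e. $\pi G^T(z,\xi)=z$ and $\pi G^t(z,\xi)\neq z$ for $0<t<T$. Put $$\iota_z(\xi,t)=G^t(z,\xi)\qquad(\xi\in S^*_zM,\ t\in\mathbb R),\qquad \Lambda_z=\iota_z(S^*_zM\times[0,T])\subset T^*M .$$ The map $\iota_z$ factors through the mapping torus $\mathcal C_T=(S^*_zM\times[0,T])/((\xi,T)\sim(G^T(z,\xi),0))$, and $\Lambda_z\cong\mathcal C_T$ is the blow-down Lagrangian. For $\xi\in S_z^*M$, the Morse index of the loop $\pi G^t(z,\xi)$, $0<t\le T$, is the number of conjugate times $t\in(0,T]$ of $z$ along it, counted with multiplicity $\dim\ker d_{t\xi}\exp_z$, with the endpoint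 $T$ included. The Maslov class $m_\Lambda\in H^1(\Lambda,\mathbb Z)$ of a Lagrangian submanifold $\Lambda\subset T^*M$ is the pullback of the generator of $H^1(S^1,\mathbb Z)$ under the map $\det^2/|\det|^2$ on the tangent planes $T_p\Lambda\subset T_p(T^*M)\cong T^*_{\pi(p)}M\otimes\mathbb C$. Here the identification is given by $g$ and its Levi-Civita connection, $v\mapsto v^{\mathrm{vert}}+i\,g(d\pi\,v,\cdot)$, where $v^{\mathrm{vert}}$ is the vertical part of $v$, and $\det$ is taken in a basis of $T_p\Lambda$ and a basis of $T^*_{\pi(p)}M$. The orientation is such that the geodesic flow crosses the vertical positively. Then there is an integer $\beta\ge 0$ which is the common Morse index of all the geodesic loops at $z$ (all of them have finitely many conjugate times in $(0,T]$), and: 1. $\iota_z^*\alpha=dt$. 2. $\iota_z^*m_{\Lambda_z}=\frac{\beta}{T}[dt]$. That is, on every closed curve of $\mathcal C_T$, lifted to $s\mapsto(\xi(s),t(s))$, $0\le s\le 1$, in $S^*_zM\times\mathbb R$, the Maslov class of $\Lambda_z$ takes the value $\frac{\beta}{T}\int_0^1 t'(s)\,ds$. 3. For every $k\in\mathbb Z$,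 with $r_k=\frac{2\pi}{T}\left(k+\frac{\beta}{4}\right)$, $\Lambda_z$ satisfies the Bohr–Sommerfeld quantization condition $$\frac{r_k}{2\pi}\,[\alpha|_{\Lambda_z}]\equiv\frac{m_{\Lambda_z}}{4}\quad\text{mod } H^1(\Lambda_z,\mathbb Z),$$ i.e. $\frac{r_k}{2\pi}\int_\gamma\alpha-\frac14 m_{\Lambda_z}(\gamma)\in\mathbb Z$ for every closed curve $\gamma$ in $\Lambda_z$. -/

import Mathlib

open Bundle Set
open scoped Manifold ContDiff

noncomputable section

namespace BlowDown

/-- The model space `ℝⁿ`. -/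
abbrev Model (n : ℕ) : Type := EuclideanSpace ℝ (Fin n)

section Cotangent

variable {n : ℕ} {M : Type*} [TopologicalSpace M] [ChartedSpace (Model n) M]
  [IsManifold (𝓡 n) ∞ M]

variable (n M) in
/-- The cotangent bundle `T^*M`, with Mathlib's topology and smooth structure on the total space
of the bundle `Hom(TM, ℝ)`. -/
abbrev Cotangent : Type _ :=
  TotalSpace (Model n →L[ℝ] ℝ)
    (fun x : M => TangentSpace (𝓡 n) x →L[ℝ] Bundle.Trivial M ℝ x)

variable (n) in
/-- The model with corners of `T^*M`. -/
abbrev cotModel : ModelWithCorners ℝ (Model n × (Model n →L[ℝ] ℝ))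
    (ModelProd (Model n) (Model n →L[ℝ] ℝ)) :=
  (𝓡 n).prod 𝓘(ℝ, Model n →L[ℝ] ℝ)

/-- The covector `ξ` at `x`, as a point of `T^*M`. -/
def covector (x : M) (ξ : Model n →L[ℝ] ℝ) : Cotangent n M := ⟨x, ξ⟩

/-- A smooth Riemannian metric on `M`. -/
abbrev Metric (n : ℕ) (M : Type*) [TopologicalSpace M] [ChartedSpace (Model n) M]
    [IsManifold (𝓡 n) ∞ M] : Type _ :=
  ContMDiffRiemannianMetric (𝓡 n) ∞ (Model n) (fun x : M => TangentSpace (𝓡 n) x)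

/-- The canonical (action, Liouville) one-form `α = ξ · dx` of `T^*M`: `α_(x,ξ)(v) = ξ(dπ v)`,
where `π : T^*M → M` is the projection. -/
def actionForm (p : Cotangent n M) (v : TangentSpace (cotModel n) p) : ℝ :=
  p.2 (mfderiv (cotModel n) (𝓡 n) (TotalSpace.proj : Cotangent n M → M) p v)

/-- The two components `(δx, δξ)` of a tangent vector of `T^*M` at `p`. Mathlib represents a tangent
vector at `p` by its coordinates in the preferred chart at `p`; on `T^*M` this is the
chart `(x, ξ)` of canonical coordinates induced by the preferred chart of `M` at `π(p)`. -/
def comps (p : Cotangent n M) (v : TangentSpace (cotModel n) p) :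
    Model n × (Model n →L[ℝ] ℝ) := v

/-- The canonical symplectic form `dα = ∑ dξ_j ∧ dx_j` of `T^*M`, in canonical coordinates. -/
def symplecticForm (p : Cotangent n M) (v w : TangentSpace (cotModel n) p) : ℝ :=
  (comps p v).2 (comps p w).1 - (comps p w).2 (comps p v).1

/-- The vector `ξ^♯ ∈ T_x M` with `g(ξ^♯, ·) = ξ`. -/
def sharp (g : Metric n M) (p : Cotangent n M) : TangentSpace (𝓡 n) p.1 :=
  (g.inner p.1).inverse p.2

/-- The squared length `|ξ|_g^2 = ξ(ξ^♯)` of a covector. -/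
def normSq (g : Metric n M) (p : Cotangent n M) : ℝ := p.2 (sharp g p)

/-- `S^*_z M`, the unit sphere of `T^*_z M`. -/
def unitCosphere (g : Metric n M) (z : M) : Set (Model n →L[ℝ] ℝ) :=
  {ξ | normSq g (covector z ξ) = 1}

/-- The kinetic energy `|ξ|_g^2 / 2`; on the unit cosphere bundle it has the same Hamiltonian flow
as `|ξ|_g`. -/
def energy (g : Metric n M) (p : Cotangent n M) : ℝ := normSq g p / 2

/-- `c : ℝ → T^*M` is an orbit of the geodesic flow, i.e. an integral curve of the Hamiltonian
vector field of the energy. In canonical coordinates the velocity `(x', ξ')` satisfies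
`x' = ∂H/∂ξ`, `ξ' = -∂H/∂x`. -/
def IsGeodesicOrbit (g : Metric n M) (c : ℝ → Cotangent n M) : Prop :=
  ∀ t : ℝ, ∃ X : TangentSpace (cotModel n) (c t),
    HasMFDerivAt 𝓘(ℝ, ℝ) (cotModel n) c t ((1 : ℝ →L[ℝ] ℝ).smulRight X) ∧
    ∀ w : TangentSpace (cotModel n) (c t),
      mfderiv (cotModel n) 𝓘(ℝ, ℝ) (energy g) (c t) w = symplecticForm (c t) w X

open Classical in
/-- The geodesic flow `G^t` on `T^*M`: `G^t(p) = c(t)` for the orbit `c` with `c(0) = p`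
(and `p` itself if there is no orbit through `p` that is defined for all times). -/
def geodesicFlow (g : Metric n M) (t : ℝ) (p : Cotangent n M) : Cotangent n M :=
  if h : ∃ c : ℝ → Cotangent n M, IsGeodesicOrbit g c ∧ c 0 = p then h.choose t else p

/-- The map `ι_z(t, ξ) = G^t(z, ξ)`, on `ℝ × S^*_z M`. -/
def iota (g : Metric n M) (z : M) (t : ℝ) (ξ : Model n →L[ℝ] ℝ) : Cotangent n M :=
  geodesicFlow g t (covector z ξ)

/-- `z` is a blow-down point with return time `T`: the unit speed geodesics that issue from `z` are
defined for all times, and each of them returns to `z` for the first time at time `T`. -/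
structure IsBlowDownPoint (g : Metric n M) (z : M) (T : ℝ) : Prop where
  time_pos : 0 < T
  complete : ∀ ξ ∈ unitCosphere g z, ∃ c : ℝ → Cotangent n M,
    IsGeodesicOrbit g c ∧ c 0 = covector z ξ
  returns : ∀ ξ ∈ unitCosphere g z, (iota g z T ξ).proj = z
  first : ∀ ξ ∈ unitCosphere g z, ∀ t ∈ Ioo 0 T, (iota g z t ξ).proj ≠ z

/-- The blow-down Lagrangian `Λ_z`, the image of `[0, T] × S^*_z M` under `ι_z`. -/
def blowDownLagrangian (g : Metric n M) (z : M) (T : ℝ) : Set (Cotangent n M) :=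
  {p | ∃ t ∈ Icc 0 T, ∃ ξ ∈ unitCosphere g z, iota g z t ξ = p}

/-- The exponential map `exp_z`, on covectors: `exp_z ξ = π(G^1(z, ξ))`. -/
def expMap (g : Metric n M) (z : M) (ξ : Model n →L[ℝ] ℝ) : M := (iota g z 1 ξ).proj

/-- The multiplicity of `t` as a conjugate time of `z` along the geodesic with initial covector `ξ`:
the dimension of the kernel of the differential of `exp_z` at `t ξ`. -/
def conjMultiplicity (g : Metric n M) (z : M) (ξ : Model n →L[ℝ] ℝ) (t : ℝ) : ℕ :=
  Module.finrank ℝ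
    (LinearMap.ker (mfderiv 𝓘(ℝ, Model n →L[ℝ] ℝ) (𝓡 n) (expMap g z) (t • ξ)).toLinearMap)

/-- `β` is the Morse index of the geodesic loop `G^t(z, ξ)`, `0 < t ≤ T`: there are finitely many
conjugate times in `(0, T]`, and `β` is their number, counted with multiplicity. The
endpoint `T`, at which the loop closes, is included. -/
def HasMorseIndex (g : Metric n M) (z : M) (T : ℝ) (ξ : Model n →L[ℝ] ℝ) (β : ℕ) : Prop :=
  {t ∈ Ioc 0 T | conjMultiplicity g z ξ t ≠ 0}.Finite ∧
    ∑ᶠ t ∈ Ioc 0 T, conjMultiplicity g z ξ t = β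

/-- The velocity `c'(s)` of a curve in `T^*M`. -/
def velocity (c : ℝ → Cotangent n M) (s : ℝ) : TangentSpace (cotModel n) (c s) :=
  mfderiv 𝓘(ℝ, ℝ) (cotModel n) c s (1 : ℝ)

/-- The tangent space at `p` of a submanifold `Λ` of `T^*M`: the span of the velocities at `p`
of the `C^1` curves in `Λ`. -/
def tangentSpan (Λ : Set (Cotangent n M)) (p : Cotangent n M) :
    Submodule ℝ (TangentSpace (cotModel n) p) :=
  Submodule.span ℝ {v | ∃ c : ℝ → Cotangent n M, ContMDiff 𝓘(ℝ, ℝ) (cotModel n) 1 c ∧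
    (∀ s, c s ∈ Λ) ∧ c 0 = p ∧ comps (c 0) (velocity c 0) = comps p v}

/-- The coefficient `g_y(v, w)` of the metric in the preferred chart at `x`, at the
point `y` of the chart. -/
def metricCoord (g : Metric n M) (x : M) (y v w : Model n) : ℝ :=
  g.inner ((extChartAt (𝓡 n) x).symm y)
    (mfderiv 𝓘(ℝ, Model n) (𝓡 n) (extChartAt (𝓡 n) x).symm y v)
    (mfderiv 𝓘(ℝ, Model n) (𝓡 n) (extChartAt (𝓡 n) x).symm y w)

/-- The derivative of `g(v, w)` in the direction `u` at `x`, in the preferred chart at `x`. -/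
def metricDeriv (g : Metric n M) (x : M) (u v w : Model n) : ℝ :=
  fderiv ℝ (fun y => metricCoord g x y v w) (extChartAt (𝓡 n) x x) u

/-- The Christoffel symbol of the first kind `g(∇_u v, w)` of the Levi-Civita connection at `x`, for
vector fields `u`, `v`, `w` that are constant in the preferred chart at `x`. -/
def christoffel (g : Metric n M) (x : M) (u v w : Model n) : ℝ :=
  (metricDeriv g x u v w + metricDeriv g x v u w - metricDeriv g x w u v) / 2

/-- The vertical part, with respect to the Levi-Civita connection, of a tangent vector of `T^*M` at
`p = (x, ξ)`: the covector `w ↦ δξ(w) - ξ(∇_{δx} w)` at `x`. -/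
def verticalPart (g : Metric n M) (p : Cotangent n M) (v : TangentSpace (cotModel n) p)
    (w : Model n) : ℝ :=
  (comps p v).2 w - christoffel g p.1 (comps p v).1 w (sharp g p)

/-- The identification `T_p(T^*M) ≅ T^*_x M ⊗ ℂ` given by the metric:
`v ↦ vertical part + i g(dπ v, ·)`. Vertical vectors are the real ones. -/
def complexPart (g : Metric n M) (p : Cotangent n M) (v : TangentSpace (cotModel n) p)
    (w : Model n) : ℂ :=
  (verticalPart g p v w : ℂ) +
    Complex.I * (g.inner p.1
      (mfderiv (cotModel n) (𝓡 n) (TotalSpace.proj : Cotangent n M → M) p v) w : ℝ)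

/-- The complex `n × n` matrix of `n` tangent vectors of `T^*M` at `p`. -/
def frameMatrix (g : Metric n M) (p : Cotangent n M)
    (l : Fin n → TangentSpace (cotModel n) p) : Matrix (Fin n) (Fin n) ℂ :=
  Matrix.of fun a b => complexPart g p (l a) (EuclideanSpace.single b (1 : ℝ))

/-- `exp(i θ)` is the squared phase `det^2 / |det|^2` (with respect to the vertical) of the
tangent space of `Λ` at `p`, which is required to be a Lagrangian subspace; the matrix of
any basis of that space gives the same squared phase. -/
def IsSquaredPhase (g : Metric n M) (Λ : Set (Cotangent n M)) (p : Cotangent n M) (θ : ℝ) :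
    Prop :=
  ∃ l : Module.Basis (Fin n) ℝ (tangentSpan Λ p),
    (∀ a b, symplecticForm p (l a : TangentSpace (cotModel n) p) (l b) = 0) ∧
    (frameMatrix g p (fun a => l a)).det ^ 2 =
      (‖(frameMatrix g p (fun a => l a)).det‖ ^ 2 : ℝ) * Complex.exp (θ * Complex.I)

/-- A closed `C^1` curve in `Λ`, as a curve of period `1`. -/
structure IsClosedCurve (Λ : Set (Cotangent n M)) (γ : ℝ → Cotangent n M) : Prop where
  smooth : ContMDiff 𝓘(ℝ, ℝ) (cotModel n) 1 γ
  periodic : Function.Periodic γ 1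
  mem : ∀ s, γ s ∈ Λ

/-- `m` is the value on the closed curve `γ` of the Maslov class of `Λ`, the pullback of the
generator of `H^1(S^1, ℤ)` under the squared phase of the tangent spaces of `Λ`: along `γ` the
squared phase has winding number `m`. -/
def HasMaslovNumber (g : Metric n M) (Λ : Set (Cotangent n M)) (γ : ℝ → Cotangent n M)
    (m : ℤ) : Prop :=
  ∃ θ : ℝ → ℝ, Continuous θ ∧ (∀ s, IsSquaredPhase g Λ (γ s) (θ s)) ∧
    θ 1 - θ 0 = 2 * Real.pi * m

/-- The integral of the action form over the closed curve `γ`. -/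
def actionIntegral (γ : ℝ → Cotangent n M) : ℝ :=
  ∫ s in (0 : ℝ)..1, actionForm (γ s) (velocity γ s)

/-- The Bohr–Sommerfeld condition `(r / 2π) [α_Λ] ≡ m_Λ / 4 mod H^1(Λ, ℤ)`: the two classes are
given by their periods over the closed curves in `Λ`, and a real class is integral if and only if
all its periods are integers. -/
def SatisfiesBohrSommerfeld (g : Metric n M) (Λ : Set (Cotangent n M)) (r : ℝ) : Prop :=
  ∀ γ : ℝ → Cotangent n M, IsClosedCurve Λ γ →
    ∃ m : ℤ, HasMaslovNumber g Λ γ m ∧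
      ∃ j : ℤ, r / (2 * Real.pi) * actionIntegral γ - (m : ℝ) / 4 = j

end Cotangent

end BlowDown

end

/-! ### Canonical coordinates of the cotangent bundle and their transition maps -/

noncomputable section

namespace BlowDown

set_option synthInstance.maxHeartbeats 200000
set_option maxSynthPendingDepth 3
set_option linter.unusedSectionVars false

variable {n : ℕ} {M : Type*} [TopologicalSpace M] [ChartedSpace (Model n) M]
  [IsManifold (𝓡 n) ∞ M]

/-! Everything is pulled back along `ι(t, ξ) = G^t(z, ξ)`. Shifting time by `kT` along an orbit
replaces its initial covector by another unit covector at `z` (`exists_shift`). Since `T` is the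
first return time and orbits are unique, `ι(t, ξ) = ι(t', ξ')` forces `t - t' ∈ Tℤ`. At unit
covectors `ι` is an immersion, and a closed `C^1` curve in `Λ` lifts to `(t(s), ξ(s))` with `t(1) -
t(0) = jT` (`exists_contDiff_lift`). Both classes are then functions of `j`.

Action. The flow preserves `ω` and the energy, and it is homogeneous in the fibres. This yields the
Gauss lemma `action_jac`: `α` takes the value `t η(ξ^♯)` on the variation with initial covector `η`.
Variations inside the unit sphere are therefore killed by `α`, the flow direction has `α = 1`, and
the action of the curve is `jT`.

Maslov class. The frame `ell` of `TΛ` has a complex matrix `P + i X G`, with `X` the base components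
and `G` the metric. Since the plane is Lagrangian, the polynomial `p(x) = det (P + x X G)` is a real
constant times `∏ (1 + (x - x₀) s_j)`, so all its roots are real and `det = p(i)` has argument `∑
arg (i - r)` up to the sign of the constant. This branch fails to be continuous only when roots pass
through infinity, that is, when `X` loses rank, which happens exactly when `TΛ` meets the vertical.
A vertical vector `(0, μ)` is moved by the linearized flow with base velocity `μ^♯`. Because `G` is
positive definite, the crossing then has a definite sign: as many roots as the dimension of the
intersection leave through `+∞` and come back from `-∞`. Hence half the continuous phase minus the
branch is a step function whose jumps, in units of `π`, are the multiplicities (`indexFun_jump`,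
`orbit_jump`). For `t > 0` these are the multiplicities of the conjugate times
(`conjMultiplicity_eq`). At times `0` and `T` the polynomial is `X` up to a constant, so the
branches cancel, and the phase grows by exactly `2π` times the Morse index on `(0, T]`
(`finite_conj_and_sum`). Finiteness of the set of conjugate times comes out of the same argument.

Common index. The phase at time `T` is continuous in `ξ` and the Morse index is an integer, so it is
constant on the sphere when `n ≥ 2`. When `n ≤ 1` there are no conjugate times, because vertical
tangent vectors come from covectors orthogonal to `ξ` (`exists_index`). Finally, the squared phase
depends only on the point of `Λ`, so the angle gains `2πβ` at every return (`angle_period`). A curve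
with `t(1) - t(0) = jT` has Maslov number `βj`, and the quantization condition reads `(k + β/4) j -
βj/4 = kj`. -/

/-- The model space of `T^*M`, with points `(x, ξ)`. -/
abbrev Phase (n : ℕ) : Type := Model n × (Model n →L[ℝ] ℝ)

variable (n) in
/-- Canonical coordinates of `T^*M` induced by the preferred chart of `M` at `x`. -/
def cotChart (x : M) : PartialEquiv (Cotangent n M) (Phase n) :=
  extChartAt (cotModel n) (covector x 0)

lemma extChartAt_eq_cotChart (p : Cotangent n M) : extChartAt (cotModel n) p = cotChart n p.1 := by
  rw [cotChart, FiberBundle.extChartAt, FiberBundle.extChartAt]; rfl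

lemma mem_cotChart_source {x : M} {p : Cotangent n M} :
    p ∈ (cotChart n x).source ↔ p.1 ∈ (extChartAt (𝓡 n) x).source := by
  rw [cotChart, extChartAt_source, extChartAt_source, FiberBundle.chartedSpace_chartAt]
  simp only [mfld_simps, covector]
  refine ⟨fun h => h.1.1, fun h => ?_⟩
  have h' : p.proj ∈ (trivializationAt (Model n →L[ℝ] ℝ)
      (fun x : M => TangentSpace (𝓡 n) x →L[ℝ] Bundle.Trivial M ℝ x) x).baseSet := ⟨h, mem_univ _⟩
  refine ⟨h', ?_⟩
  rw [Trivialization.coe_fst' _ h']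
  exact h

lemma mem_cotChart_target {x : M} {q : Phase n} :
    q ∈ (cotChart n x).target ↔ q.1 ∈ (extChartAt (𝓡 n) x).target := by
  rw [cotChart, FiberBundle.extChartAt_target]
  simp only [mfld_simps, covector]
  refine ⟨fun h => h.1, fun h => ⟨h, ?_⟩⟩
  exact ⟨(chartAt (Model n) x).map_target h, mem_univ _⟩

/-- The derivative at `z` of the transition from the preferred chart at `x` to the one at `y`. -/
abbrev trans (x y z : M) : Model n →L[ℝ] Model n := tangentCoordChange (𝓡 n) x y z

lemma trans_trans {w x y z : M} (hw : z ∈ (extChartAt (𝓡 n) w).source)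
    (hx : z ∈ (extChartAt (𝓡 n) x).source) (hy : z ∈ (extChartAt (𝓡 n) y).source) (v : Model n) :
    trans x y z (trans w x z v) = trans w y z v :=
  tangentCoordChange_comp ⟨⟨hw, hx⟩, hy⟩

lemma trans_self {x z : M} (h : z ∈ (extChartAt (𝓡 n) x).source) (v : Model n) :
    trans x x z v = v :=
  tangentCoordChange_self h

lemma trans_cancel {x y z : M} (hx : z ∈ (extChartAt (𝓡 n) x).source)
    (hy : z ∈ (extChartAt (𝓡 n) y).source) (v : Model n) :
    trans x y z (trans y x z v) = v := by
  rw [trans_trans hy hx hy, trans_self hy]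

/-- The covector of a point of `T^*M`, in the preferred chart at its base point. -/
def covec (p : Cotangent n M) : Model n →L[ℝ] ℝ := p.2

lemma cotChart_apply {x : M} {p : Cotangent n M} (hp : p.1 ∈ (extChartAt (𝓡 n) x).source) :
    cotChart n x p = (extChartAt (𝓡 n) x p.1, (covec p).comp (trans x p.1 p.1)) := by
  rw [cotChart, FiberBundle.extChartAt]
  have hp' := hp
  rw [extChartAt_source] at hp
  simp only [PartialEquiv.coe_trans, Function.comp_apply, PartialEquiv.prod_coe,
    PartialEquiv.refl_coe, id]
  have h1 : (trivializationAt (Model n →L[ℝ] ℝ)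
      (fun x : M => TangentSpace (𝓡 n) x →L[ℝ] Bundle.Trivial M ℝ x) x) p =
      (p.1, (covec p).comp (trans x p.1 p.1)) := by
    rw [hom_trivializationAt_apply]
    congr 1
    ext v
    rw [ContinuousLinearMap.inCoordinates]
    rw [TangentBundle.symmL_trivializationAt_eq_core hp]
    simp only [ContinuousLinearMap.comp_apply]
    rw [Bundle.Trivialization.continuousLinearMapAt_apply,
      Bundle.Trivialization.linearMapAt_apply, if_pos (by exact mem_univ _)]
    rfl
  exact congrArg (fun r : M × (Model n →L[ℝ] ℝ) => (extChartAt (𝓡 n) x r.1, r.2)) h1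

lemma cotChart_symm_apply {x : M} {q : Phase n} (hq : q.1 ∈ (extChartAt (𝓡 n) x).target) :
    (cotChart n x).symm q = covector ((extChartAt (𝓡 n) x).symm q.1)
      (q.2.comp (trans ((extChartAt (𝓡 n) x).symm q.1) x ((extChartAt (𝓡 n) x).symm q.1))) := by
  set z := (extChartAt (𝓡 n) x).symm q.1 with hz
  have hzs : z ∈ (extChartAt (𝓡 n) x).source := (extChartAt (𝓡 n) x).map_target hq
  refine (cotChart n x).injOn ((cotChart n x).map_target (mem_cotChart_target.2 hq))
    (mem_cotChart_source.2 hzs) ?_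
  rw [(cotChart n x).right_inv (mem_cotChart_target.2 hq), cotChart_apply (by exact hzs)]
  refine Prod.ext ?_ ?_
  · exact ((extChartAt (𝓡 n) x).right_inv hq).symm
  · ext v
    change q.2 v = q.2 (trans z x z (trans x z z v))
    rw [trans_cancel (mem_extChartAt_source _) hzs]

/-- The transition map between two canonical coordinate systems of `T^*M`. -/
def cotTrans (x y : M) (q : Phase n) : Phase n := cotChart n y ((cotChart n x).symm q)

/-- The transition map between the preferred charts at `x` and at `y`. -/
def chartTrans (x y : M) (v : Model n) : Model n :=
  extChartAt (𝓡 n) y ((extChartAt (𝓡 n) x).symm v)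

/-- The overlap of the charts at `x` and `y` in the chart at `x`. -/
def overlap (x y : M) : Set (Model n) :=
  {v | v ∈ (extChartAt (𝓡 n) x).target ∧
    (extChartAt (𝓡 n) x).symm v ∈ (extChartAt (𝓡 n) y).source}

omit [IsManifold (𝓡 n) ∞ M] in
lemma isOpen_overlap (x y : M) : IsOpen (overlap (n := n) x y) :=
  (continuousOn_extChartAt_symm x).isOpen_inter_preimage (isOpen_extChartAt_target x)
    (isOpen_extChartAt_source y)

lemma contDiffOn_chartTrans (x y : M) : ContDiffOn ℝ ∞ (chartTrans (n := n) x y) (overlap x y) := by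
  refine (contDiffOn_ext_coord_change (I := 𝓡 n) (n := ∞) y x).mono ?_
  intro v hv
  simpa [PartialEquiv.trans_source, overlap] using hv

lemma hasFDerivAt_chartTrans {x y : M} {v : Model n} (hv : v ∈ overlap x y) :
    HasFDerivAt (chartTrans x y) (trans x y ((extChartAt (𝓡 n) x).symm v)) v := by
  have h := hasFDerivWithinAt_tangentCoordChange (I := 𝓡 n) (x := x) (y := y)
    (z := (extChartAt (𝓡 n) x).symm v) ⟨(extChartAt (𝓡 n) x).map_target hv.1, hv.2⟩
  rw [(extChartAt (𝓡 n) x).right_inv hv.1] at h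
  rw [ModelWithCorners.range_eq_univ, hasFDerivWithinAt_univ] at h
  exact h

lemma fderiv_chartTrans {x y : M} {v : Model n} (hv : v ∈ overlap x y) :
    fderiv ℝ (chartTrans x y) v = trans x y ((extChartAt (𝓡 n) x).symm v) :=
  (hasFDerivAt_chartTrans hv).fderiv

lemma cotTrans_fst {x y : M} {q : Phase n} (hq : q.1 ∈ overlap x y) :
    (cotTrans x y q).1 = chartTrans x y q.1 := by
  rw [cotTrans, cotChart_symm_apply hq.1, cotChart_apply (by exact hq.2)]; rfl

/-- The covector coordinates transform by the inverse transpose. -/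
lemma cotTrans_snd_comp {x y : M} {q : Phase n} (hq : q.1 ∈ overlap x y) (v : Model n) :
    (cotTrans x y q).2 (fderiv ℝ (chartTrans x y) q.1 v) = q.2 v := by
  have h1 : (extChartAt (𝓡 n) x).symm q.1 ∈ (extChartAt (𝓡 n) x).source :=
    (extChartAt (𝓡 n) x).map_target hq.1
  rw [cotTrans, cotChart_symm_apply hq.1, cotChart_apply (by exact hq.2), fderiv_chartTrans hq]
  change q.2 (trans _ _ _ (trans _ _ _ (trans _ _ _ v))) = q.2 v
  dsimp only [covector]
  rw [trans_trans h1 hq.2 (mem_extChartAt_source _), trans_cancel (mem_extChartAt_source _) h1]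

lemma contDiffOn_cotTrans (x y : M) :
    ContDiffOn ℝ ∞ (cotTrans (n := n) x y) {q | q.1 ∈ overlap x y} := by
  have h := contDiffOn_ext_coord_change (I := cotModel n) (n := ∞)
    (covector y 0 : Cotangent n M) (covector x 0)
  refine ContDiffOn.congr (h.mono ?_) (fun q hq => rfl)
  intro q hq
  change q ∈ ((cotChart n x).symm ≫ cotChart n y).source
  rw [PartialEquiv.trans_source, PartialEquiv.symm_source]
  refine ⟨mem_cotChart_target.2 hq.1, ?_⟩
  rw [mem_preimage, mem_cotChart_source, cotChart_symm_apply hq.1]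
  exact hq.2

/-- The derivative of the transition between canonical coordinate systems. -/
lemma fderiv_cotTrans {x y : M} {q : Phase n} (hq : q.1 ∈ overlap x y) (v : Phase n) :
    (fderiv ℝ (cotTrans x y) q v).1 = fderiv ℝ (chartTrans x y) q.1 v.1 ∧
    ∀ w, (fderiv ℝ (cotTrans x y) q v).2 (fderiv ℝ (chartTrans x y) q.1 w) +
      (cotTrans x y q).2 (fderiv ℝ (fderiv ℝ (chartTrans x y)) q.1 v.1 w) = v.2 w := by
  have hopen : IsOpen {q : Phase n | q.1 ∈ overlap x y} :=
    (isOpen_overlap x y).preimage continuous_fst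
  have hd : HasFDerivAt (cotTrans x y) (fderiv ℝ (cotTrans x y) q) q :=
    (((contDiffOn_cotTrans x y).contDiffAt (hopen.mem_nhds hq)).differentiableAt
      (by simp)).hasFDerivAt
  have hc := (contDiffOn_chartTrans x y).contDiffAt ((isOpen_overlap x y).mem_nhds hq)
  have hφ : HasFDerivAt (chartTrans x y) (fderiv ℝ (chartTrans x y) q.1) q.1 :=
    (hc.differentiableAt (by simp)).hasFDerivAt
  have hφ2 : HasFDerivAt (fderiv ℝ (chartTrans x y))
      (fderiv ℝ (fderiv ℝ (chartTrans x y)) q.1) q.1 :=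
    ((hc.fderiv_right (m := 1) (by norm_cast)).differentiableAt (by simp)).hasFDerivAt
  have hf1 : HasFDerivAt (fun q : Phase n => q.1) (ContinuousLinearMap.fst ℝ _ _) q :=
    hasFDerivAt_fst
  have hf2 : HasFDerivAt (fun q : Phase n => q.2) (ContinuousLinearMap.snd ℝ _ _) q :=
    hasFDerivAt_snd
  constructor
  · have h1 : HasFDerivAt (fun q => (cotTrans x y q).1) _ q := hd.fst
    have h2 := HasFDerivAt.comp (g := chartTrans x y) q hφ hf1
    have h3 := h2.congr_of_eventuallyEq (f₁ := fun q => (cotTrans x y q).1)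
      (Filter.eventually_of_mem (hopen.mem_nhds hq) (fun q hq => cotTrans_fst hq))
    exact DFunLike.congr_fun (h1.unique h3) v
  -- This is the derivative of `cotTrans_snd_comp`; the product rule produces the second derivative
  -- of the chart transition.
  · intro w
    have h1 : HasFDerivAt (fun q : Phase n => (cotTrans x y q).2
        (fderiv ℝ (chartTrans x y) q.1 w)) _ q :=
      hd.snd.clm_apply (HasFDerivAt.clm_apply (HasFDerivAt.comp q hφ2 hf1)
        (hasFDerivAt_const w q))
    have h2 : HasFDerivAt (fun q : Phase n => q.2 w) _ q :=
      hf2.clm_apply (hasFDerivAt_const w q)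
    have h3 := h2.congr_of_eventuallyEq (f₁ := fun q => (cotTrans x y q).2
        (fderiv ℝ (chartTrans x y) q.1 w))
      (Filter.eventually_of_mem (hopen.mem_nhds hq) (fun q hq => cotTrans_snd_comp hq w))
    have h4 := DFunLike.congr_fun (h1.unique h3) v
    simpa [add_comm] using h4

lemma fderiv_chartTrans_symm {x y : M} {v : Model n} (hv : v ∈ overlap x y) (u w : Model n) :
    fderiv ℝ (fderiv ℝ (chartTrans x y)) v u w = fderiv ℝ (fderiv ℝ (chartTrans x y)) v w u := by
  have hc := (contDiffOn_chartTrans x y).contDiffAt ((isOpen_overlap x y).mem_nhds hv)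
  exact (hc.isSymmSndFDerivAt (by simpa using WithTop.coe_le_coe.2 (le_top : (2 : ℕ∞) ≤ ⊤))).eq u w

/-- The symplectic form in canonical coordinates. -/
def omega (v w : Phase n) : ℝ := v.2 w.1 - w.2 v.1

/-- Each of the two terms acquires a contribution of the second derivative of the chart transition,
and the symmetry of that derivative cancels them. -/
lemma omega_cotTrans {x y : M} {q : Phase n} (hq : q.1 ∈ overlap x y) (v w : Phase n) :
    omega (fderiv ℝ (cotTrans x y) q v) (fderiv ℝ (cotTrans x y) q w) = omega v w := by
  obtain ⟨hv1, hv2⟩ := fderiv_cotTrans hq v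
  obtain ⟨hw1, hw2⟩ := fderiv_cotTrans hq w
  rw [omega, omega, hv1, hw1, ← hv2, ← hw2, fderiv_chartTrans_symm hq w.1 v.1]
  ring

end BlowDown

end

/-! ### The metric in charts -/

noncomputable section

namespace BlowDown

set_option synthInstance.maxHeartbeats 200000
set_option maxSynthPendingDepth 3
set_option linter.unusedSectionVars false

variable {n : ℕ} {M : Type*} [TopologicalSpace M] [ChartedSpace (Model n) M]
  [IsManifold (𝓡 n) ∞ M]

/-- The inner product of the tangent space at `z`, in the preferred chart at `z`. -/
def innerAt (g : Metric n M) (z : M) : Model n →L[ℝ] Model n →L[ℝ] ℝ := g.inner z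

lemma innerAt_symm (g : Metric n M) (z : M) (v w : Model n) : innerAt g z v w = innerAt g z w v :=
  g.symm z v w

lemma innerAt_pos (g : Metric n M) (z : M) {v : Model n} (hv : v ≠ 0) : 0 < innerAt g z v v :=
  g.pos z v hv

/-- The metric in the preferred chart at `x`, as a bilinear form depending on the point `y`. -/
def metricG (g : Metric n M) (x : M) (y : Model n) : Model n →L[ℝ] Model n →L[ℝ] ℝ :=
  (innerAt g ((extChartAt (𝓡 n) x).symm y)).bilinearComp
    (trans x ((extChartAt (𝓡 n) x).symm y) ((extChartAt (𝓡 n) x).symm y))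
    (trans x ((extChartAt (𝓡 n) x).symm y) ((extChartAt (𝓡 n) x).symm y))

lemma metricG_apply (g : Metric n M) (x : M) (y v w : Model n) :
    metricG g x y v w = innerAt g ((extChartAt (𝓡 n) x).symm y)
      (trans x ((extChartAt (𝓡 n) x).symm y) ((extChartAt (𝓡 n) x).symm y) v)
      (trans x ((extChartAt (𝓡 n) x).symm y) ((extChartAt (𝓡 n) x).symm y) w) := rfl

lemma metricG_symm (g : Metric n M) (x : M) (y v w : Model n) :
    metricG g x y v w = metricG g x y w v := innerAt_symm _ _ _ _

lemma metricG_pos (g : Metric n M) {x : M} {y : Model n} (hy : y ∈ (extChartAt (𝓡 n) x).target)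
    {v : Model n} (hv : v ≠ 0) : 0 < metricG g x y v v := by
  refine innerAt_pos _ _ fun h => hv ?_
  have hz := (extChartAt (𝓡 n) x).map_target hy
  rw [← trans_cancel (mem_extChartAt_source ((extChartAt (𝓡 n) x).symm y)) hz v]
  exact (congrArg _ h).trans (map_zero _)

lemma metricG_self (g : Metric n M) (x : M) (v w : Model n) :
    metricG g x (extChartAt (𝓡 n) x x) v w = innerAt g x v w := by
  rw [metricG_apply, extChartAt_to_inv, trans_self (mem_extChartAt_source _),
    trans_self (mem_extChartAt_source _)]

lemma metricG_chartTrans (g : Metric n M) {x x' : M} {y : Model n} (hy : y ∈ overlap x x')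
    (v w : Model n) :
    metricG g x' (chartTrans x x' y) (fderiv ℝ (chartTrans x x') y v)
      (fderiv ℝ (chartTrans x x') y w) = metricG g x y v w := by
  have hz := (extChartAt (𝓡 n) x).map_target hy.1
  rw [metricG_apply, metricG_apply, fderiv_chartTrans hy, chartTrans,
    (extChartAt (𝓡 n) x').left_inv hy.2, trans_trans hz hy.2 (mem_extChartAt_source _),
    trans_trans hz hy.2 (mem_extChartAt_source _)]

/-- Inside the chart, the derivative of the inverse chart is a tangent coordinate change. This links
the coefficients that define the Christoffel symbols to the form `metricG`, which is smooth and
transforms well. -/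
lemma metricCoord_eq (g : Metric n M) {x : M} {y : Model n}
    (hy : y ∈ (extChartAt (𝓡 n) x).target) (v w : Model n) :
    metricCoord g x y v w = metricG g x y v w := by
  have hz := (extChartAt (𝓡 n) x).map_target hy
  have h : mfderiv 𝓘(ℝ, Model n) (𝓡 n) (extChartAt (𝓡 n) x).symm y =
      trans x ((extChartAt (𝓡 n) x).symm y) ((extChartAt (𝓡 n) x).symm y) := by
    have h1 := TangentBundle.symmL_trivializationAt (I := 𝓡 n) (x₀ := x)
      (x := (extChartAt (𝓡 n) x).symm y) (by rwa [extChartAt_source] at hz)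
    rw [(extChartAt (𝓡 n) x).right_inv hy, ModelWithCorners.range_eq_univ,
      mfderivWithin_univ] at h1
    rw [← h1, TangentBundle.symmL_trivializationAt_eq_core (by rwa [extChartAt_source] at hz)]
  rw [metricCoord, h]
  rfl

-- The metric is a smooth section of a bundle of bilinear forms, and `metricG` is that section read
-- in the trivialization at `x`.
set_option synthInstance.maxHeartbeats 400000 in
set_option maxHeartbeats 1000000 in
lemma contDiffOn_metricG (g : Metric n M) (x : M) :
    ContDiffOn ℝ ∞ (metricG g x) (extChartAt (𝓡 n) x).target := by
  have h0 := g.contMDiff.contMDiffOn (s := (chartAt (Model n) x).source)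
  have h1 := ((trivializationAt (Model n →L[ℝ] Model n →L[ℝ] ℝ)
    (fun z : M => TangentSpace (𝓡 n) z →L[ℝ] TangentSpace (𝓡 n) z →L[ℝ] Bundle.Trivial M ℝ z)
    x).contMDiffOn_iff (IB := 𝓡 n) (IM := 𝓡 n) (n := ∞) ?_).1 h0
  · have h2 := h1.2.comp (contMDiffOn_extChartAt_symm (I := 𝓡 n) (n := ∞) x)
      (fun y hy => by simpa [extChartAt_source] using (extChartAt (𝓡 n) x).map_target hy)
    rw [contMDiffOn_iff_contDiffOn] at h2
    refine h2.congr fun y hy => ?_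
    have hz := (extChartAt (𝓡 n) x).map_target hy
    rw [extChartAt_source] at hz
    ext v w
    simp only [Function.comp_apply]
    rw [hom_trivializationAt_apply]
    refine Eq.symm ((inCoordinates_apply_eq₂ (F₁ := Model n) (F₂ := Model n) (F₃ := ℝ)
      (E₁ := fun z : M => TangentSpace (𝓡 n) z) (E₂ := fun z : M => TangentSpace (𝓡 n) z)
      (E₃ := Bundle.Trivial M ℝ) hz hz (mem_univ _)).trans ?_)
    have hs : ∀ v : Model n, (trivializationAt (Model n) (fun z : M => TangentSpace (𝓡 n) z) x).symm
        ((extChartAt (𝓡 n) x).symm y) v = trans x ((extChartAt (𝓡 n) x).symm y)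
          ((extChartAt (𝓡 n) x).symm y) v := fun v => by
      have h := DFunLike.congr_fun (TangentBundle.symmL_trivializationAt_eq_core (I := 𝓡 n) hz) v
      rw [Bundle.Trivialization.symmL_apply _ hz] at h
      exact h
    rw [hs, hs, Bundle.Trivialization.linearMapAt_apply]
    exact if_pos (mem_univ _)
  · intro z hz
    rw [Trivialization.mem_source]
    exact ⟨hz, hz, mem_univ _⟩

end BlowDown

end

/-! ### Raising indices, the Hamiltonian and the geodesic vector field -/

noncomputable section

namespace BlowDown

set_option synthInstance.maxHeartbeats 200000
set_option maxSynthPendingDepth 3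
set_option linter.unusedSectionVars false

variable {n : ℕ} {M : Type*} [TopologicalSpace M] [ChartedSpace (Model n) M]
  [IsManifold (𝓡 n) ∞ M]

lemma isInvertible_of_pos {B : Model n →L[ℝ] Model n →L[ℝ] ℝ} (hB : ∀ v, v ≠ 0 → 0 < B v v) :
    ∃ e : Model n ≃L[ℝ] (Model n →L[ℝ] ℝ), (e : Model n →L[ℝ] (Model n →L[ℝ] ℝ)) = B := by
  have hinj : Function.Injective (B : Model n →ₗ[ℝ] (Model n →L[ℝ] ℝ)) := by
    rw [injective_iff_map_eq_zero]
    intro v hv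
    by_contra h
    have h1 := hB v h
    have h2 : B v = 0 := hv
    rw [h2] at h1
    simp at h1
  have hdim : Module.finrank ℝ (Model n) = Module.finrank ℝ (Model n →L[ℝ] ℝ) :=
    (InnerProductSpace.toDual ℝ (Model n)).toLinearEquiv.finrank_eq
  refine ⟨(LinearEquiv.ofInjectiveOfFinrankEq _ hinj hdim).toContinuousLinearEquiv, ?_⟩
  ext v w
  rfl

/-- The isomorphism from vectors to covectors given by the metric in the chart at `x`. -/
def metricEquiv (g : Metric n M) {x : M} {y : Model n} (hy : y ∈ (extChartAt (𝓡 n) x).target) :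
    Model n ≃L[ℝ] (Model n →L[ℝ] ℝ) :=
  (isInvertible_of_pos fun _ hv => metricG_pos g hy hv).choose

lemma coe_metricEquiv (g : Metric n M) {x : M} {y : Model n}
    (hy : y ∈ (extChartAt (𝓡 n) x).target) :
    (metricEquiv g hy : Model n →L[ℝ] (Model n →L[ℝ] ℝ)) = metricG g x y :=
  (isInvertible_of_pos fun _ hv => metricG_pos g hy hv).choose_spec

/-- The map from covectors to vectors given by the metric in the chart at `x`. -/
def raise (g : Metric n M) (x : M) (y : Model n) : (Model n →L[ℝ] ℝ) →L[ℝ] Model n :=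
  (metricG g x y).inverse

lemma raise_eq (g : Metric n M) {x : M} {y : Model n} (hy : y ∈ (extChartAt (𝓡 n) x).target) :
    raise g x y = (metricEquiv g hy).symm := by
  rw [raise, ← coe_metricEquiv g hy, ContinuousLinearMap.inverse_equiv]

lemma metricG_raise (g : Metric n M) {x : M} {y : Model n}
    (hy : y ∈ (extChartAt (𝓡 n) x).target) (ξ : Model n →L[ℝ] ℝ) :
    metricG g x y (raise g x y ξ) = ξ := by
  rw [raise_eq g hy, ← coe_metricEquiv g hy]
  exact (metricEquiv g hy).apply_symm_apply ξ

lemma raise_metricG (g : Metric n M) {x : M} {y : Model n}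
    (hy : y ∈ (extChartAt (𝓡 n) x).target) (v : Model n) :
    raise g x y (metricG g x y v) = v := by
  rw [raise_eq g hy, ← coe_metricEquiv g hy]
  exact (metricEquiv g hy).symm_apply_apply v

lemma raise_unique (g : Metric n M) {x : M} {y : Model n}
    (hy : y ∈ (extChartAt (𝓡 n) x).target) {ξ : Model n →L[ℝ] ℝ} {v : Model n}
    (h : ∀ w, metricG g x y v w = ξ w) : raise g x y ξ = v := by
  rw [← raise_metricG g hy v]
  congr 1
  ext w
  exact (h w).symm

lemma apply_raise_comm (g : Metric n M) {x : M} {y : Model n}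
    (hy : y ∈ (extChartAt (𝓡 n) x).target) (ξ η : Model n →L[ℝ] ℝ) :
    ξ (raise g x y η) = η (raise g x y ξ) := by
  conv_lhs => rw [← metricG_raise g hy ξ]
  conv_rhs => rw [← metricG_raise g hy η]
  exact metricG_symm _ _ _ _ _

lemma apply_raise_pos (g : Metric n M) {x : M} {y : Model n}
    (hy : y ∈ (extChartAt (𝓡 n) x).target) {ξ : Model n →L[ℝ] ℝ} (hξ : ξ ≠ 0) :
    0 < ξ (raise g x y ξ) := by
  have h : raise g x y ξ ≠ 0 := fun h => hξ <| by
    rw [← metricG_raise g hy ξ, h, map_zero]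
  have := metricG_pos g hy h
  rwa [metricG_raise g hy] at this

lemma contDiffOn_raise (g : Metric n M) (x : M) :
    ContDiffOn ℝ ∞ (raise g x) (extChartAt (𝓡 n) x).target := by
  intro y hy
  have h : ContDiffAt ℝ ∞ ContinuousLinearMap.inverse (metricG g x y) := by
    rw [← coe_metricEquiv g hy]
    exact contDiffAt_map_inverse _
  exact h.comp_contDiffWithinAt y (contDiffOn_metricG g x y hy)

/-- The Hamiltonian of the geodesic flow in canonical coordinates. -/
def hamil (g : Metric n M) (x : M) (q : Phase n) : ℝ := q.2 (raise g x q.1 q.2) / 2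

omit [IsManifold (𝓡 n) ∞ M] in
lemma isOpen_cotTarget (x : M) : IsOpen {q : Phase n | q.1 ∈ (extChartAt (𝓡 n) x).target} :=
  (isOpen_extChartAt_target x).preimage continuous_fst

lemma contDiffOn_hamil (g : Metric n M) (x : M) :
    ContDiffOn ℝ ∞ (hamil g x) {q | q.1 ∈ (extChartAt (𝓡 n) x).target} := by
  have h1 : ContDiffOn ℝ ∞ (fun q : Phase n => raise g x q.1)
      {q | q.1 ∈ (extChartAt (𝓡 n) x).target} :=
    (contDiffOn_raise g x).comp contDiff_fst.contDiffOn fun q hq => hq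
  exact (contDiff_snd.contDiffOn.clm_apply (h1.clm_apply contDiff_snd.contDiffOn)).div_const 2

/-- The geodesic vector field in canonical coordinates. -/
def geoField (g : Metric n M) (x : M) (q : Phase n) : Phase n :=
  (raise g x q.1 q.2, -(fderiv ℝ (hamil g x) q).comp (ContinuousLinearMap.inl ℝ _ _))

lemma contDiffOn_geoField (g : Metric n M) (x : M) :
    ContDiffOn ℝ ∞ (geoField g x) {q | q.1 ∈ (extChartAt (𝓡 n) x).target} := by
  have h1 : ContDiffOn ℝ ∞ (fun q : Phase n => raise g x q.1)
      {q | q.1 ∈ (extChartAt (𝓡 n) x).target} :=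
    (contDiffOn_raise g x).comp contDiff_fst.contDiffOn fun q hq => hq
  refine (h1.clm_apply contDiff_snd.contDiffOn).prodMk ?_
  have h2 := (contDiffOn_hamil g x).fderiv_of_isOpen (m := ∞) (isOpen_cotTarget x) (by simp)
  exact (h2.clm_comp contDiffOn_const).neg

lemma hasFDerivAt_hamil (g : Metric n M) {x : M} {q : Phase n}
    (hq : q.1 ∈ (extChartAt (𝓡 n) x).target) :
    HasFDerivAt (hamil g x) (fderiv ℝ (hamil g x) q) q :=
  (((contDiffOn_hamil g x).contDiffAt ((isOpen_cotTarget x).mem_nhds hq)).differentiableAt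
    (by simp)).hasFDerivAt

lemma fderiv_hamil_snd (g : Metric n M) {x : M} {q : Phase n}
    (hq : q.1 ∈ (extChartAt (𝓡 n) x).target) (μ : Model n →L[ℝ] ℝ) :
    fderiv ℝ (hamil g x) q (0, μ) = μ (raise g x q.1 q.2) := by
  have h1 : HasFDerivAt (fun η : Model n →L[ℝ] ℝ => ((q.1, η) : Phase n))
      (ContinuousLinearMap.inr ℝ _ _) q.2 := hasFDerivAt_prodMk_right _ _
  have h2 := HasFDerivAt.comp (g := hamil g x) q.2 (hasFDerivAt_hamil g hq) h1
  have h3 : HasFDerivAt (fun η : Model n →L[ℝ] ℝ => η (raise g x q.1 η) / 2) _ q.2 :=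
    ((hasFDerivAt_id q.2).clm_apply ((raise g x q.1).hasFDerivAt)).mul_const (2 : ℝ)⁻¹
  have h4 := DFunLike.congr_fun (h2.unique h3) μ
  have h5 := apply_raise_comm g hq q.2 μ
  simp at h4
  rw [h4, h5]
  ring

/-- The geodesic vector field is the Hamiltonian vector field of the energy. -/
lemma omega_geoField (g : Metric n M) {x : M} {q : Phase n}
    (hq : q.1 ∈ (extChartAt (𝓡 n) x).target) (w : Phase n) :
    omega w (geoField g x q) = fderiv ℝ (hamil g x) q w := by
  have h : w = (w.1, 0) + (0, w.2) := by ext <;> simp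
  conv_rhs => rw [h, map_add, fderiv_hamil_snd g hq]
  simp [omega, geoField]
  ring

/-- Nondegeneracy of the symplectic form. Identities between Hamiltonian vector fields are reduced
by it to identities between derivatives of functions. -/
lemma omega_left_injective {v w : Phase n} (h : ∀ u, omega u v = omega u w) : v = w := by
  refine Prod.ext ?_ ?_
  · by_contra hne
    have h1 := h (0, innerSL ℝ (v.1 - w.1))
    simp only [omega, map_zero, sub_zero] at h1
    rw [← sub_eq_zero, ← map_sub, innerSL_apply_apply] at h1
    exact hne (sub_eq_zero.1 (inner_self_eq_zero.1 h1))
  · ext u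
    have h1 := h (u, 0)
    simpa [omega] using h1

end BlowDown

end

/-! ### Invariance of the geodesic field and of the complex structure under changes of charts -/

noncomputable section

namespace BlowDown

set_option synthInstance.maxHeartbeats 200000
set_option maxSynthPendingDepth 3
set_option linter.unusedSectionVars false

variable {n : ℕ} {M : Type*} [TopologicalSpace M] [ChartedSpace (Model n) M]
  [IsManifold (𝓡 n) ∞ M]

lemma chartTrans_mem_target {x y : M} {v : Model n} (hv : v ∈ overlap x y) :
    chartTrans x y v ∈ (extChartAt (𝓡 n) y).target :=
  (extChartAt (𝓡 n) y).map_source hv.2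

lemma fderiv_chartTrans_surjective {x y : M} {v : Model n} (hv : v ∈ overlap x y) (w : Model n) :
    ∃ u, fderiv ℝ (chartTrans x y) v u = w :=
  ⟨trans y x ((extChartAt (𝓡 n) x).symm v) w, by
    rw [fderiv_chartTrans hv, trans_cancel ((extChartAt (𝓡 n) x).map_target hv.1) hv.2]⟩

/-- A linear map that preserves a nondegenerate form is injective, hence bijective in finite
dimension. -/
lemma fderiv_cotTrans_surjective {x y : M} {q : Phase n} (hq : q.1 ∈ overlap x y) (w : Phase n) :
    ∃ u, fderiv ℝ (cotTrans x y) q u = w := by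
  have hinj : Function.Injective (fderiv ℝ (cotTrans x y) q : Phase n →ₗ[ℝ] Phase n) := by
    rw [injective_iff_map_eq_zero]
    intro v hv
    refine omega_left_injective fun u => ?_
    rw [← omega_cotTrans hq]
    have hv' : fderiv ℝ (cotTrans x y) q v = 0 := hv
    rw [hv']
    simp [omega]
  exact LinearMap.injective_iff_surjective.1 hinj w

lemma raise_cotTrans (g : Metric n M) {x y : M} {q : Phase n} (hq : q.1 ∈ overlap x y) :
    raise g y (cotTrans x y q).1 (cotTrans x y q).2 =
      fderiv ℝ (chartTrans x y) q.1 (raise g x q.1 q.2) := by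
  rw [cotTrans_fst hq]
  refine raise_unique g (chartTrans_mem_target hq) fun w => ?_
  obtain ⟨u, rfl⟩ := fderiv_chartTrans_surjective hq w
  rw [metricG_chartTrans g hq, metricG_raise g hq.1, cotTrans_snd_comp hq]

lemma hamil_cotTrans (g : Metric n M) {x y : M} {q : Phase n} (hq : q.1 ∈ overlap x y) :
    hamil g y (cotTrans x y q) = hamil g x q := by
  rw [hamil, raise_cotTrans g hq, cotTrans_snd_comp hq, hamil]

lemma isOpen_cotOverlap (x y : M) : IsOpen {q : Phase n | q.1 ∈ overlap x y} :=
  (isOpen_overlap x y).preimage continuous_fst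

lemma hasFDerivAt_cotTrans {x y : M} {q : Phase n} (hq : q.1 ∈ overlap x y) :
    HasFDerivAt (cotTrans x y) (fderiv ℝ (cotTrans x y) q) q :=
  (((contDiffOn_cotTrans x y).contDiffAt ((isOpen_cotOverlap x y).mem_nhds hq)).differentiableAt
      (by simp)).hasFDerivAt

lemma cotTrans_mem_target {x y : M} {q : Phase n} (hq : q.1 ∈ overlap x y) :
    (cotTrans x y q).1 ∈ (extChartAt (𝓡 n) y).target := by
  rw [cotTrans_fst hq]; exact chartTrans_mem_target hq

/-- The field is determined by the symplectic form and the Hamiltonian, and the transition maps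
preserve both. -/
lemma geoField_cotTrans (g : Metric n M) {x y : M} {q : Phase n} (hq : q.1 ∈ overlap x y) :
    geoField g y (cotTrans x y q) = fderiv ℝ (cotTrans x y) q (geoField g x q) := by
  refine omega_left_injective fun u' => ?_
  obtain ⟨u, rfl⟩ := fderiv_cotTrans_surjective hq u'
  rw [omega_cotTrans hq, omega_geoField g (cotTrans_mem_target hq), omega_geoField g hq.1]
  have h1 := HasFDerivAt.comp (g := hamil g y) q
    (hasFDerivAt_hamil g (cotTrans_mem_target hq)) (hasFDerivAt_cotTrans hq)
  have h2 := (hasFDerivAt_hamil g hq.1).congr_of_eventuallyEq (f₁ := hamil g y ∘ cotTrans x y)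
    (Filter.eventually_of_mem ((isOpen_cotOverlap x y).mem_nhds hq)
      fun q hq => hamil_cotTrans g hq)
  exact DFunLike.congr_fun (h1.unique h2) u

/-- The Christoffel symbols of the first kind in the chart at `x`, as functions of the point. -/
def christoffelAt (g : Metric n M) (x : M) (y u v w : Model n) : ℝ :=
  (fderiv ℝ (metricG g x) y u v w + fderiv ℝ (metricG g x) y v u w
    - fderiv ℝ (metricG g x) y w u v) / 2

/-- The identification of tangent vectors with complex covectors, in canonical coordinates. -/
def complexLoc (g : Metric n M) (x : M) (q v : Phase n) (w : Model n) : ℂ :=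
  ((v.2 w - christoffelAt g x q.1 v.1 w (raise g x q.1 q.2) : ℝ) : ℂ) +
    Complex.I * (metricG g x q.1 v.1 w : ℝ)

lemma hasFDerivAt_metricG (g : Metric n M) {x : M} {y : Model n}
    (hy : y ∈ (extChartAt (𝓡 n) x).target) :
    HasFDerivAt (metricG g x) (fderiv ℝ (metricG g x) y) y :=
  (((contDiffOn_metricG g x).contDiffAt ((isOpen_extChartAt_target x).mem_nhds
    hy)).differentiableAt (by simp)).hasFDerivAt

lemma fderiv_metricG_symm (g : Metric n M) {x : M} {y : Model n}
    (hy : y ∈ (extChartAt (𝓡 n) x).target) (u v w : Model n) :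
    fderiv ℝ (metricG g x) y u v w = fderiv ℝ (metricG g x) y u w v := by
  have h (v w : Model n) : HasFDerivAt (fun y => metricG g x y v w) _ y :=
    ((hasFDerivAt_metricG g hy).clm_apply (hasFDerivAt_const v y)).clm_apply
      (hasFDerivAt_const w y)
  have h2 : (fun y => metricG g x y v w) = fun y => metricG g x y w v :=
    funext fun y => metricG_symm _ _ _ _ _
  have h1 := h v w
  rw [h2] at h1
  have h3 := DFunLike.congr_fun (h1.unique (h w v)) u
  simpa using h3

/-- The derivative of the invariance `metricG_chartTrans`, in which the differentials of the
transition also vary. -/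
lemma fderiv_metricG_chartTrans (g : Metric n M) {x x' : M} {y : Model n} (hy : y ∈ overlap x x')
    (u v w : Model n) :
    fderiv ℝ (metricG g x') (chartTrans x x' y) (fderiv ℝ (chartTrans x x') y u)
      (fderiv ℝ (chartTrans x x') y v) (fderiv ℝ (chartTrans x x') y w) +
    metricG g x' (chartTrans x x' y) (fderiv ℝ (fderiv ℝ (chartTrans x x')) y u v)
      (fderiv ℝ (chartTrans x x') y w) +
    metricG g x' (chartTrans x x' y) (fderiv ℝ (chartTrans x x') y v)
      (fderiv ℝ (fderiv ℝ (chartTrans x x')) y u w) = fderiv ℝ (metricG g x) y u v w := by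
  have hc := (contDiffOn_chartTrans x x').contDiffAt ((isOpen_overlap x x').mem_nhds hy)
  have hφ : HasFDerivAt (chartTrans x x') (fderiv ℝ (chartTrans x x') y) y :=
    (hc.differentiableAt (by simp)).hasFDerivAt
  have hφ2 : HasFDerivAt (fderiv ℝ (chartTrans x x'))
      (fderiv ℝ (fderiv ℝ (chartTrans x x')) y) y :=
    ((hc.fderiv_right (m := 1) (by norm_cast)).differentiableAt (by simp)).hasFDerivAt
  have hG := HasFDerivAt.comp (g := metricG g x') y
    (hasFDerivAt_metricG g (chartTrans_mem_target hy)) hφ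
  have h1 := (hG.clm_apply (hφ2.clm_apply (hasFDerivAt_const v y))).clm_apply
    (hφ2.clm_apply (hasFDerivAt_const w y))
  have h2 := ((hasFDerivAt_metricG g hy.1).clm_apply (hasFDerivAt_const v y)).clm_apply
      (hasFDerivAt_const w y)
  have h3 := h2.congr_of_eventuallyEq (f₁ := fun y => metricG g x' (chartTrans x x' y)
    (fderiv ℝ (chartTrans x x') y v) (fderiv ℝ (chartTrans x x') y w))
    (Filter.eventually_of_mem ((isOpen_overlap x x').mem_nhds hy)
      fun y hy => metricG_chartTrans g hy v w)
  have h4 := DFunLike.congr_fun (h1.unique h3) u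
  simp at h4
  linarith

/-- Of the six second derivative terms in the three metric derivatives, four cancel in pairs and the
other two coincide, which absorbs the factor one half. -/
lemma christoffelAt_chartTrans (g : Metric n M) {x x' : M} {y : Model n} (hy : y ∈ overlap x x')
    (u v w : Model n) :
    christoffelAt g x' (chartTrans x x' y) (fderiv ℝ (chartTrans x x') y u)
      (fderiv ℝ (chartTrans x x') y v) (fderiv ℝ (chartTrans x x') y w) +
    metricG g x' (chartTrans x x' y) (fderiv ℝ (fderiv ℝ (chartTrans x x')) y u v)
      (fderiv ℝ (chartTrans x x') y w) = christoffelAt g x y u v w := by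
  simp only [christoffelAt, ← fderiv_metricG_chartTrans g hy]
  rw [fderiv_chartTrans_symm hy v u, fderiv_chartTrans_symm hy w u, fderiv_chartTrans_symm hy w v,
    metricG_symm g x' (chartTrans x x' y) (fderiv ℝ (chartTrans x x') y u)
      (fderiv ℝ (fderiv ℝ (chartTrans x x')) y v w),
    metricG_symm g x' (chartTrans x x' y) (fderiv ℝ (chartTrans x x') y v)
      (fderiv ℝ (fderiv ℝ (chartTrans x x')) y u w)]
  ring

/-- The inhomogeneous term of the Christoffel law, evaluated at `ξ^♯`, is the covector applied to
the second derivative of the transition. The coordinates `δξ` transform with the same term, so it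
drops out of the vertical part. -/
lemma complexLoc_cotTrans (g : Metric n M) {x y : M} {q : Phase n} (hq : q.1 ∈ overlap x y)
    (v : Phase n) (w : Model n) :
    complexLoc g y (cotTrans x y q) (fderiv ℝ (cotTrans x y) q v)
      (fderiv ℝ (chartTrans x y) q.1 w) = complexLoc g x q v w := by
  obtain ⟨h1, h2⟩ := fderiv_cotTrans hq v
  have h3 := christoffelAt_chartTrans g hq v.1 w (raise g x q.1 q.2)
  have h4 : metricG g y (chartTrans x y q.1) (fderiv ℝ (fderiv ℝ (chartTrans x y)) q.1 v.1 w)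
      (fderiv ℝ (chartTrans x y) q.1 (raise g x q.1 q.2)) =
      (cotTrans x y q).2 (fderiv ℝ (fderiv ℝ (chartTrans x y)) q.1 v.1 w) := by
    rw [← raise_cotTrans g hq, metricG_symm, cotTrans_fst hq,
      metricG_raise g (chartTrans_mem_target hq)]
  rw [complexLoc, complexLoc, h1, raise_cotTrans g hq, cotTrans_fst hq, metricG_chartTrans g hq,
    ← h3, ← h2, h4]
  congr 2
  ring

lemma christoffelAt_symm (g : Metric n M) {x : M} {y : Model n}
    (hy : y ∈ (extChartAt (𝓡 n) x).target) (u v w : Model n) :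
    christoffelAt g x y u v w = christoffelAt g x y v u w := by
  rw [christoffelAt, christoffelAt, fderiv_metricG_symm g hy w u v]
  ring

/-- The symplectic form in terms of vertical and horizontal parts. -/
lemma omega_eq_complexLoc (g : Metric n M) {x : M} {q : Phase n}
    (hq : q.1 ∈ (extChartAt (𝓡 n) x).target) (v w : Phase n) :
    omega v w = (complexLoc g x q v w.1).re - (complexLoc g x q w v.1).re := by
  simp only [complexLoc, Complex.add_re, Complex.ofReal_re, Complex.mul_re, Complex.I_re,
    Complex.I_im, Complex.ofReal_im, omega]
  -- The connection is torsion free, so the two Christoffel terms cancel.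
  rw [christoffelAt_symm g hq]
  ring

/-- The geodesic vector field is horizontal. -/
lemma complexLoc_geoField (g : Metric n M) {x : M} {q : Phase n}
    (hq : q.1 ∈ (extChartAt (𝓡 n) x).target) (w : Model n) :
    complexLoc g x q (geoField g x q) w = Complex.I * (q.2 w : ℝ) := by
  have hR : HasFDerivAt (raise g x) (fderiv ℝ (raise g x) q.1) q.1 :=
    (((contDiffOn_raise g x).contDiffAt ((isOpen_extChartAt_target x).mem_nhds
      hq)).differentiableAt (by simp)).hasFDerivAt
  have h1 := HasFDerivAt.comp (g := hamil g x) q.1 (hasFDerivAt_hamil g hq)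
    (hasFDerivAt_prodMk_left q.1 q.2)
  have h2 : HasFDerivAt (fun y : Model n => q.2 (raise g x y q.2) / 2) _ q.1 :=
    ((q.2.hasFDerivAt.comp q.1 (hR.clm_apply (hasFDerivAt_const q.2 q.1)))).mul_const (2 : ℝ)⁻¹
  have h3 := DFunLike.congr_fun (h1.unique h2) w
  -- Differentiating `g(ξ^♯, u) = ξ(u)` with `u` frozen at the base point trades the derivative of
  -- `raise` in `∂H/∂x` for minus that of the metric. It remains that `Γ(u, w, u)` is half of `∂_w
  -- g(u, u)`.
  have h4 := ((hasFDerivAt_metricG g hq).clm_apply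
    (hR.clm_apply (hasFDerivAt_const q.2 q.1))).clm_apply
      (hasFDerivAt_const (raise g x q.1 q.2) q.1)
  have h5 := (hasFDerivAt_const (𝕜 := ℝ) (q.2 (raise g x q.1 q.2)) q.1).congr_of_eventuallyEq
    (f₁ := fun y => metricG g x y (raise g x y q.2) (raise g x q.1 q.2))
    (Filter.eventually_of_mem ((isOpen_extChartAt_target x).mem_nhds hq)
      fun y hy => by simp only [metricG_raise g hy])
  have h6 := DFunLike.congr_fun (h4.unique h5) w
  simp at h3 h6
  have h7 : metricG g x q.1 (fderiv ℝ (raise g x) q.1 w q.2) (raise g x q.1 q.2) =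
      q.2 (fderiv ℝ (raise g x) q.1 w q.2) := by
    rw [metricG_symm, metricG_raise g hq]
  rw [complexLoc]
  have h8 : metricG g x q.1 (geoField g x q).1 w = q.2 w := by
    rw [geoField, metricG_raise g hq]
  have h9 : (geoField g x q).2 w - christoffelAt g x q.1 (geoField g x q).1 w
      (raise g x q.1 q.2) = 0 := by
    simp only [geoField, neg_apply, ContinuousLinearMap.comp_apply,
      ContinuousLinearMap.inl_apply, christoffelAt]
    rw [fderiv_metricG_symm g hq (raise g x q.1 q.2) w]
    linarith
  rw [h8, h9]
  simp

end BlowDown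

end

/-! ### Translation of the intrinsic definitions into canonical coordinates -/

noncomputable section

namespace BlowDown

set_option synthInstance.maxHeartbeats 200000
set_option maxSynthPendingDepth 3
set_option linter.unusedSectionVars false

variable {n : ℕ} {M : Type*} [TopologicalSpace M] [ChartedSpace (Model n) M]
  [IsManifold (𝓡 n) ∞ M]

lemma hasMFDerivAt_iff_written {E E' H H' N N' : Type*} [NormedAddCommGroup E] [NormedSpace ℝ E]
    [NormedAddCommGroup E'] [NormedSpace ℝ E'] [TopologicalSpace H] [TopologicalSpace H']
    [TopologicalSpace N] [TopologicalSpace N'] {I : ModelWithCorners ℝ E H} [I.Boundaryless]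
    {I' : ModelWithCorners ℝ E' H'} [ChartedSpace H N] [ChartedSpace H' N'] {f : N → N'} {a : N}
    {L : E →L[ℝ] E'} :
    HasMFDerivAt I I' f a L ↔ ContinuousAt f a ∧
      HasFDerivAt (writtenInExtChartAt I I' a f) L (extChartAt I a a) := by
  refine and_congr_right fun _ => ?_
  rw [← hasFDerivWithinAt_univ, ← ModelWithCorners.range_eq_univ I]
  rfl

lemma cotChart_self_apply (p : Cotangent n M) :
    cotChart n p.1 p = (extChartAt (𝓡 n) p.1 p.1, covec p) := by
  rw [cotChart_apply (mem_extChartAt_source _)]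
  refine Prod.ext rfl ?_
  ext v
  exact congrArg (covec p) (trans_self (mem_extChartAt_source _) v)

lemma cotChart_fst {x : M} {p : Cotangent n M} (hp : p.1 ∈ (extChartAt (𝓡 n) x).source) :
    (cotChart n x p).1 = extChartAt (𝓡 n) x p.1 := by
  rw [cotChart_apply hp]

lemma cotChart_mem_overlap {x y : M} {p : Cotangent n M} (hx : p.1 ∈ (extChartAt (𝓡 n) x).source)
    (hy : p.1 ∈ (extChartAt (𝓡 n) y).source) : (cotChart n x p).1 ∈ overlap x y := by
  rw [cotChart_fst hx]
  refine ⟨(extChartAt (𝓡 n) x).map_source hx, ?_⟩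
  rwa [(extChartAt (𝓡 n) x).left_inv hx]

lemma cotChart_mem_target {x : M} {p : Cotangent n M}
    (hx : p.1 ∈ (extChartAt (𝓡 n) x).source) : (cotChart n x p).1 ∈ (extChartAt (𝓡 n) x).target :=
  (cotChart_mem_overlap hx hx).1

lemma cotTrans_cotChart {x y : M} {p : Cotangent n M} (hx : p.1 ∈ (extChartAt (𝓡 n) x).source) :
    cotTrans x y (cotChart n x p) = cotChart n y p := by
  rw [cotTrans, (cotChart n x).left_inv (mem_cotChart_source.2 hx)]

lemma continuous_proj' : Continuous (fun p : Cotangent n M => p.1) :=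
  FiberBundle.continuous_proj _ _

lemma isOpen_cotSource (x : M) : IsOpen {p : Cotangent n M | p.1 ∈ (extChartAt (𝓡 n) x).source} :=
  (isOpen_extChartAt_source x).preimage continuous_proj'

lemma raise_self (g : Metric n M) (p : Cotangent n M) :
    raise g p.1 (cotChart n p.1 p).1 (cotChart n p.1 p).2 = sharp g p := by
  have h : metricG g p.1 (extChartAt (𝓡 n) p.1 p.1) = innerAt g p.1 := by
    ext v w
    exact metricG_self g p.1 v w
  rw [cotChart_self_apply, raise, h]
  rfl

lemma energy_eq (g : Metric n M) {x : M} {p : Cotangent n M}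
    (hp : p.1 ∈ (extChartAt (𝓡 n) x).source) : energy g p = hamil g x (cotChart n x p) := by
  have h1 : energy g p = hamil g p.1 (cotChart n p.1 p) := by
    rw [hamil, raise_self, cotChart_self_apply]
    rfl
  rw [h1, ← cotTrans_cotChart (y := x) (mem_extChartAt_source _),
    hamil_cotTrans g (cotChart_mem_overlap (mem_extChartAt_source _) hp)]

lemma hasMFDerivAt_energy (g : Metric n M) (p : Cotangent n M) :
    HasMFDerivAt (cotModel n) 𝓘(ℝ, ℝ) (energy g) p
      (fderiv ℝ (hamil g p.1) (cotChart n p.1 p) : Phase n →L[ℝ] ℝ) := by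
  have hev : energy g =ᶠ[nhds p] hamil g p.1 ∘ extChartAt (cotModel n) p := by
    filter_upwards [(isOpen_cotSource p.1).mem_nhds (mem_extChartAt_source p.1)] with q hq
    rw [extChartAt_eq_cotChart]
    exact energy_eq g hq
  have hd := hasFDerivAt_hamil g (cotChart_mem_target (mem_extChartAt_source p.1))
  refine HasMFDerivAt.congr_of_eventuallyEq (f := hamil g p.1 ∘ extChartAt (cotModel n) p) ?_ hev
  refine hasMFDerivAt_iff_written.2 ⟨ContinuousAt.comp ?_ (continuousAt_extChartAt p), ?_⟩
  · rw [extChartAt_eq_cotChart]; exact hd.continuousAt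
  · rw [extChartAt_eq_cotChart]
    refine hd.congr_of_eventuallyEq ?_
    filter_upwards [(isOpen_cotTarget p.1).mem_nhds
      (cotChart_mem_target (mem_extChartAt_source p.1))] with q hq
    simp only [writtenInExtChartAt, extChartAt_eq_cotChart, Function.comp_apply]
    rw [(cotChart n p.1).right_inv (mem_cotChart_target.2 hq)]
    rfl

lemma hasMFDerivAt_proj (p : Cotangent n M) :
    HasMFDerivAt (cotModel n) (𝓡 n) (TotalSpace.proj : Cotangent n M → M) p
      (ContinuousLinearMap.fst ℝ (Model n) (Model n →L[ℝ] ℝ)) := by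
  refine hasMFDerivAt_iff_written.2 ⟨continuous_proj'.continuousAt, ?_⟩
  rw [extChartAt_eq_cotChart]
  refine hasFDerivAt_fst.congr_of_eventuallyEq ?_
  filter_upwards [(isOpen_cotTarget p.1).mem_nhds
      (cotChart_mem_target (mem_extChartAt_source p.1))] with q hq
  simp only [writtenInExtChartAt, extChartAt_eq_cotChart, Function.comp_apply]
  rw [cotChart_symm_apply hq]
  exact (extChartAt (𝓡 n) p.1).right_inv hq

lemma mfderiv_proj_apply (p : Cotangent n M) (v : TangentSpace (cotModel n) p) :
    mfderiv (cotModel n) (𝓡 n) (TotalSpace.proj : Cotangent n M → M) p v = (comps p v).1 := by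
  rw [(hasMFDerivAt_proj p).mfderiv]; rfl

lemma symplecticForm_eq (p : Cotangent n M) (v w : TangentSpace (cotModel n) p) :
    symplecticForm p v w = omega v w := rfl

lemma metricDeriv_eq (g : Metric n M) (x : M) (u v w : Model n) :
    metricDeriv g x u v w = fderiv ℝ (metricG g x) (extChartAt (𝓡 n) x x) u v w := by
  have hx := mem_extChartAt_target (I := 𝓡 n) x
  have h := ((hasFDerivAt_metricG g hx).clm_apply (hasFDerivAt_const v _)).clm_apply
      (hasFDerivAt_const w _)
  have h2 := h.congr_of_eventuallyEq (f₁ := fun y => metricCoord g x y v w)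
    (Filter.eventually_of_mem ((isOpen_extChartAt_target x).mem_nhds hx)
      fun y hy => metricCoord_eq g hy v w)
  rw [metricDeriv, h2.fderiv]
  simp

lemma complexPart_eq (g : Metric n M) (p : Cotangent n M) (v : TangentSpace (cotModel n) p)
    (w : Model n) :
    complexPart g p v w = complexLoc g p.1 (cotChart n p.1 p) (comps p v) w := by
  have h1 : christoffel g p.1 (comps p v).1 w (sharp g p) =
      christoffelAt g p.1 (cotChart n p.1 p).1 (comps p v).1 w
        (raise g p.1 (cotChart n p.1 p).1 (cotChart n p.1 p).2) := by
    rw [raise_self, cotChart_self_apply]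
    have h (u v w : Model n) : christoffel g p.1 u v w =
        christoffelAt g p.1 (extChartAt (𝓡 n) p.1 p.1) u v w := by
      simp only [christoffel, metricDeriv_eq, christoffelAt]
    exact h _ _ _
  have h2 : g.inner p.1 (mfderiv (cotModel n) (𝓡 n) (TotalSpace.proj : Cotangent n M → M) p v) w =
      metricG g p.1 (cotChart n p.1 p).1 (comps p v).1 w := by
    rw [mfderiv_proj_apply, cotChart_self_apply, metricG_self]
    rfl
  rw [complexPart, verticalPart, complexLoc, h1, h2]

lemma actionForm_eq (p : Cotangent n M) (v : TangentSpace (cotModel n) p) :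
    actionForm p v = covec p (comps p v).1 := by
  rw [actionForm, mfderiv_proj_apply]; rfl

section Maps

variable {N : Type*} [NormedAddCommGroup N] [NormedSpace ℝ N]

lemma hasMFDerivAt_iff_cotChart {F : N → Cotangent n M} {a : N} {L : N →L[ℝ] Phase n} :
    HasMFDerivAt 𝓘(ℝ, N) (cotModel n) F a L ↔
      ContinuousAt F a ∧ HasFDerivAt (fun b => cotChart n (F a).1 (F b)) L a := by
  rw [hasMFDerivAt_iff_written]
  have : writtenInExtChartAt 𝓘(ℝ, N) (cotModel n) a F = fun b => cotChart n (F a).1 (F b) := by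
    funext b
    simp only [writtenInExtChartAt, extChartAt_eq_cotChart, Function.comp_apply,
      extChartAt_model_space_eq_id, PartialEquiv.refl_symm, PartialEquiv.refl_coe, id]
  rw [this, extChartAt_model_space_eq_id]
  rfl

lemma hasFDerivAt_cotChart_change {F : N → Cotangent n M} {a : N} {L : N →L[ℝ] Phase n} {x y : M}
    (hF : ContinuousAt F a)
    (hx : (F a).1 ∈ (extChartAt (𝓡 n) x).source) (hy : (F a).1 ∈ (extChartAt (𝓡 n) y).source)
    (h : HasFDerivAt (fun b => cotChart n x (F b)) L a) :
    HasFDerivAt (fun b => cotChart n y (F b))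
      ((fderiv ℝ (cotTrans x y) (cotChart n x (F a))).comp L) a := by
  have h1 := HasFDerivAt.comp (g := cotTrans x y) a
    (hasFDerivAt_cotTrans (cotChart_mem_overlap hx hy)) h
  refine h1.congr_of_eventuallyEq ?_
  filter_upwards [hF.eventually_mem ((isOpen_cotSource x).mem_nhds hx)] with b hb
  exact (cotTrans_cotChart hb).symm

lemma contMDiffAt_iff_cotChart {F : N → Cotangent n M} {a : N} {x : M}
    (hx : (F a).1 ∈ (extChartAt (𝓡 n) x).source) :
    ContMDiffAt 𝓘(ℝ, N) (cotModel n) 1 F a ↔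
      ContinuousAt F a ∧ ContDiffAt ℝ 1 (fun b => cotChart n x (F b)) a := by
  have h := contMDiffAt_iff_target_of_mem_source (I := 𝓘(ℝ, N)) (I' := cotModel n) (n := 1)
    (f := F) (x := a) (y := covector x 0) (by
      rw [← extChartAt_source (cotModel n)]; exact mem_cotChart_source.2 hx)
  rw [h, contMDiffAt_iff_contDiffAt]
  rfl

end Maps

lemma hasDerivAt_cotChart_change {c : ℝ → Cotangent n M} {t : ℝ} {v : Phase n} {x y : M}
    (hc : ContinuousAt c t)
    (hx : (c t).1 ∈ (extChartAt (𝓡 n) x).source) (hy : (c t).1 ∈ (extChartAt (𝓡 n) y).source)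
    (h : HasDerivAt (fun s => cotChart n x (c s)) v t) :
    HasDerivAt (fun s => cotChart n y (c s)) (fderiv ℝ (cotTrans x y) (cotChart n x (c t)) v) t := by
  have := hasFDerivAt_cotChart_change hc hx hy h.hasFDerivAt
  simpa using this.hasDerivAt

lemma hasMFDerivAt_curve_iff {c : ℝ → Cotangent n M} {t : ℝ} {v : Phase n} :
    HasMFDerivAt 𝓘(ℝ, ℝ) (cotModel n) c t
      (ContinuousLinearMap.toSpanSingleton ℝ v : ℝ →L[ℝ] Phase n) ↔
      ContinuousAt c t ∧ HasDerivAt (fun s => cotChart n (c t).1 (c s)) v t := by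
  rw [hasDerivAt_iff_hasFDerivAt]
  exact hasMFDerivAt_iff_cotChart

/-- In canonical coordinates, the orbits of the geodesic flow are the integral curves of the
geodesic vector field. -/
lemma isGeodesicOrbit_iff {g : Metric n M} {c : ℝ → Cotangent n M} :
    IsGeodesicOrbit g c ↔ ∀ t, ContinuousAt c t ∧
      HasDerivAt (fun s => cotChart n (c t).1 (c s))
        (geoField g (c t).1 (cotChart n (c t).1 (c t))) t := by
  refine forall_congr' fun t => ?_
  have ht := cotChart_mem_target (mem_extChartAt_source (I := 𝓡 n) (c t).1)
  have hsp (v : Phase n) : (1 : ℝ →L[ℝ] ℝ).smulRight v =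
      (ContinuousLinearMap.toSpanSingleton ℝ v : ℝ →L[ℝ] Phase n) := by
    ext <;> simp
  constructor
  · rintro ⟨X, hX, hω⟩
    obtain ⟨h1, h2⟩ := (hasMFDerivAt_curve_iff (v := X)).1 (hsp X ▸ hX)
    refine ⟨h1, ?_⟩
    -- Hamilton's equation determines the velocity, since the symplectic form is nondegenerate.
    have : X = geoField g (c t).1 (cotChart n (c t).1 (c t)) := by
      refine omega_left_injective fun u => ?_
      rw [omega_geoField g ht]
      have h3 := hω u
      rw [(hasMFDerivAt_energy g (c t)).mfderiv] at h3
      exact h3.symm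
    rwa [← this]
  · rintro ⟨h1, h2⟩
    refine ⟨geoField g (c t).1 (cotChart n (c t).1 (c t)), ?_, fun w => ?_⟩
    · have h3 := hasMFDerivAt_curve_iff.2 ⟨h1, h2⟩
      rw [← hsp] at h3
      exact h3
    · rw [(hasMFDerivAt_energy g (c t)).mfderiv]
      exact (omega_geoField g ht w).symm

end BlowDown

end

/-! ### Local flows of class `C^1` -/

noncomputable section

open Filter Topology Metric

namespace BlowDown

set_option synthInstance.maxHeartbeats 200000
set_option maxSynthPendingDepth 3
set_option linter.unusedSectionVars false

section Flow

variable {E : Type*} [NormedAddCommGroup E] [NormedSpace ℝ E]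

/-- Negative times are reduced to the forward Gronwall inequality by reflecting time. -/
lemma norm_le_gronwallBound_abs {z z' : ℝ → E} {K ε a : ℝ}
    (hz : ∀ t ∈ Ioo (-a) a, HasDerivAt z (z' t) t) (h0 : z 0 = 0)
    (hb : ∀ t ∈ Ioo (-a) a, ‖z' t‖ ≤ K * ‖z t‖ + ε) {t : ℝ} (ht : t ∈ Ioo (-a) a) :
    ‖z t‖ ≤ gronwallBound 0 K ε |t| := by
  have ha : 0 < a := by have := ht.1.trans ht.2; linarith
  rcases le_total 0 t with h | h
  · have hsub : ∀ s ∈ Icc 0 t, s ∈ Ioo (-a) a := fun s hs => ⟨by linarith [hs.1], by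
      linarith [hs.2, ht.2]⟩
    have := norm_le_gronwallBound_of_norm_deriv_right_le (f := z) (f' := z') (δ := 0) (K := K)
      (ε := ε) (a := 0) (b := t) (fun s hs => (hz s (hsub s hs)).continuousAt.continuousWithinAt)
      (fun s hs => (hz s (hsub s ⟨hs.1, hs.2.le⟩)).hasDerivWithinAt) (by simp [h0])
      (fun s hs => hb s (hsub s ⟨hs.1, hs.2.le⟩)) t ⟨h, le_rfl⟩
    rw [abs_of_nonneg h]
    rwa [sub_zero] at this
  · have hsub : ∀ s ∈ Icc 0 (-t), -s ∈ Ioo (-a) a := fun s hs => ⟨by linarith [hs.2, ht.1], by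
      linarith [hs.1, ht.2]⟩
    have hd : ∀ s ∈ Icc 0 (-t), HasDerivAt (fun s => z (-s)) (-z' (-s)) s := fun s hs => by
      have := (hz (-s) (hsub s hs)).scomp s (hasDerivAt_neg s)
      simpa [Function.comp_def] using this
    have := norm_le_gronwallBound_of_norm_deriv_right_le (f := fun s => z (-s))
      (f' := fun s => -z' (-s)) (δ := 0) (K := K)
      (ε := ε) (a := 0) (b := -t) (fun s hs => (hd s hs).continuousAt.continuousWithinAt)
      (fun s hs => (hd s ⟨hs.1, hs.2.le⟩).hasDerivWithinAt) (by simp [h0])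
      (fun s hs => by rw [norm_neg]; exact hb _ (hsub s ⟨hs.1, hs.2.le⟩)) (-t) ⟨by linarith, le_rfl⟩
    rw [abs_of_nonpos h]
    simpa using this

/-- A solution of the variational equation is the derivative of a Lipschitz local flow with
respect to the initial point. -/
lemma hasFDerivAt_of_variational {f : E → E} {q₀ q : E} {ρ δ t : ℝ} {K₁ K₂ L : ℝ} (hK₁ : 1 ≤ K₁)
    (hK₂ : 0 ≤ K₂) (hL : 0 ≤ L)
    (hf : ∀ x ∈ ball q₀ ρ, HasFDerivAt f (fderiv ℝ f x) x)
    (hf1 : ∀ x ∈ ball q₀ ρ, ‖fderiv ℝ f x‖ ≤ K₁)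
    (hf2 : ∀ x ∈ ball q₀ ρ, ∀ y ∈ ball q₀ ρ, ‖fderiv ℝ f x - fderiv ℝ f y‖ ≤ K₂ * ‖x - y‖)
    {Φ : ℝ → E → E} {Y : ℝ → E → E →L[ℝ] E}
    (hmem : ∀ q ∈ ball q₀ δ, ∀ t ∈ Ioo (-δ) δ, Φ t q ∈ ball q₀ ρ)
    (h0 : ∀ q ∈ ball q₀ δ, Φ 0 q = q ∧ Y 0 q = ContinuousLinearMap.id ℝ E)
    (hΦ : ∀ q ∈ ball q₀ δ, ∀ t ∈ Ioo (-δ) δ, HasDerivAt (Φ · q) (f (Φ t q)) t)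
    (hY : ∀ q ∈ ball q₀ δ, ∀ t ∈ Ioo (-δ) δ,
      HasDerivAt (Y · q) ((fderiv ℝ f (Φ t q)).comp (Y t q)) t)
    (hlip : ∀ q ∈ ball q₀ δ, ∀ q' ∈ ball q₀ δ, ∀ t ∈ Ioo (-δ) δ,
      ‖Φ t q - Φ t q'‖ ≤ L * ‖q - q'‖)
    (hq : q ∈ ball q₀ δ) (ht : t ∈ Ioo (-δ) δ) : HasFDerivAt (Φ t) (Y t q) q := by
  -- The remainder of the expansion at first order satisfies a linear differential inequality. Its
  -- source is the Taylor error of `f`, at most `K₂ L² ‖q' - q‖²`, so Gronwall makes the remainder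
  -- quadratic.
  have key : ∀ q' ∈ ball q₀ δ, ‖Φ t q' - Φ t q - Y t q (q' - q)‖ ≤
      (K₂ * L ^ 2 / K₁ * (Real.exp (K₁ * |t|) - 1)) * ‖q' - q‖ ^ 2 := by
    intro q' hq'
    have hz := norm_le_gronwallBound_abs (z := fun t => Φ t q' - Φ t q - Y t q (q' - q))
      (z' := fun t => f (Φ t q') - f (Φ t q) - (fderiv ℝ f (Φ t q)) (Y t q (q' - q)))
      (K := K₁) (ε := K₂ * L ^ 2 * ‖q' - q‖ ^ 2) (a := δ)
      (fun s hs => ((hΦ q' hq' s hs).sub (hΦ q hq s hs)).sub (by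
        simpa using (hY q hq s hs).clm_apply (hasDerivAt_const s (q' - q))))
      (by simp [h0 q hq, h0 q' hq']) (fun s hs => by
        have h1 : ‖f (Φ s q') - f (Φ s q) - fderiv ℝ f (Φ s q) (Φ s q' - Φ s q)‖ ≤
            (K₂ * ‖Φ s q' - Φ s q‖) * ‖Φ s q' - Φ s q‖ := by
          have hseg : segment ℝ (Φ s q) (Φ s q') ⊆ ball q₀ ρ :=
            (convex_ball q₀ ρ).segment_subset (hmem q hq s hs) (hmem q' hq' s hs)
          refine Convex.norm_image_sub_le_of_norm_hasFDerivWithin_le' (s := segment ℝ _ _)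
            (fun x hx => (hf x (hseg hx)).hasFDerivWithinAt) (fun x hx => ?_)
            (convex_segment (Φ s q) (Φ s q')) (left_mem_segment ..) (right_mem_segment ..)
          refine (hf2 x (hseg hx) _ (hmem q hq s hs)).trans ?_
          gcongr
          rw [← dist_eq_norm, ← dist_eq_norm, dist_comm, dist_comm (Φ s q')]
          exact le_trans (by
            have := dist_add_dist_of_mem_segment hx
            linarith [dist_nonneg (x := x) (y := Φ s q')]) le_rfl
        have h2 := hlip q' hq' q hq s hs
        have h3 : ‖fderiv ℝ f (Φ s q) (Φ s q' - Φ s q - Y s q (q' - q))‖ ≤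
            K₁ * ‖Φ s q' - Φ s q - Y s q (q' - q)‖ :=
          ContinuousLinearMap.le_of_opNorm_le _ (hf1 _ (hmem q hq s hs)) _
        calc ‖f (Φ s q') - f (Φ s q) - (fderiv ℝ f (Φ s q)) (Y s q (q' - q))‖
            = ‖fderiv ℝ f (Φ s q) (Φ s q' - Φ s q - Y s q (q' - q)) +
              (f (Φ s q') - f (Φ s q) - fderiv ℝ f (Φ s q) (Φ s q' - Φ s q))‖ := by
              congr 1
              simp only [map_sub]
              abel
          _ ≤ _ := norm_add_le _ _
          _ ≤ K₁ * ‖Φ s q' - Φ s q - Y s q (q' - q)‖ +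
              (K₂ * ‖Φ s q' - Φ s q‖) * ‖Φ s q' - Φ s q‖ := add_le_add h3 h1
          _ ≤ K₁ * ‖Φ s q' - Φ s q - Y s q (q' - q)‖ +
              (K₂ * (L * ‖q' - q‖)) * (L * ‖q' - q‖) := by gcongr
          _ = _ := by ring) ht
    refine hz.trans (le_of_eq ?_)
    rw [gronwallBound_of_K_ne_0 (by positivity)]
    field_simp
    ring
  rw [hasFDerivAt_iff_isLittleO]
  set C := K₂ * L ^ 2 / K₁ * (Real.exp (K₁ * |t|) - 1)
  have hO : (fun q' => Φ t q' - Φ t q - Y t q (q' - q)) =O[𝓝 q] fun q' => ‖q' - q‖ ^ 2 := by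
    refine Asymptotics.IsBigO.of_bound C ?_
    filter_upwards [isOpen_ball.mem_nhds hq] with q' hq'
    simpa using key q' hq'
  refine hO.trans_isLittleO ?_
  have := Asymptotics.isLittleO_pow_sub_sub q (m := 2) (by norm_num)
  exact this

/-- The field is coupled with its variational equation, a system that is `C^1` when `f` is `C^2`.
Picard–Lindelöf gives solutions that are Lipschitz in the initial data, and
`hasFDerivAt_of_variational` identifies the second component `Y` with the derivative of the flow
`Φ`. Retaining `Y` gives its time derivative without interchanging derivatives of a map that is only
`C^1`. -/
theorem exists_local_flow [CompleteSpace E] {f : E → E} {q₀ : E} (hf : ContDiffAt ℝ 2 f q₀)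
    {U : Set E} (hU : U ∈ 𝓝 q₀) :
    ∃ δ > 0, ∃ (Φ : ℝ → E → E) (Y : ℝ → E → E →L[ℝ] E), ∀ q ∈ ball q₀ δ,
      (Φ 0 q = q ∧ Y 0 q = ContinuousLinearMap.id ℝ E) ∧ ∀ t ∈ Ioo (-δ) δ, Φ t q ∈ U ∧
        HasDerivAt (Φ · q) (f (Φ t q)) t ∧
        HasDerivAt (Y · q) ((fderiv ℝ f (Φ t q)).comp (Y t q)) t ∧
        HasFDerivAt (Φ t) (Y t q) q ∧
        ContDiffAt ℝ 1 (fun p : ℝ × E => Φ p.1 p.2) (t, q) := by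
  have hf' : ContDiffAt ℝ 1 (fderiv ℝ f) q₀ := hf.fderiv_right (by norm_num)
  -- a ball on which `f` is controlled
  obtain ⟨K₂, s, hs, hlip2⟩ := hf'.exists_lipschitzOnWith
  have hd : ∀ᶠ x in 𝓝 q₀, HasFDerivAt f (fderiv ℝ f x) x := by
    filter_upwards [hf.eventually (by simp)] with x hx
    exact (hx.differentiableAt (by simp)).hasFDerivAt
  have hbd : ∀ᶠ x in 𝓝 q₀, ‖fderiv ℝ f x‖ ≤ ‖fderiv ℝ f q₀‖ + 1 := by
    have := hf'.continuousAt.norm.eventually (gt_mem_nhds (lt_add_one ‖fderiv ℝ f q₀‖))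
    exact this.mono fun x hx => hx.le
  obtain ⟨ρ, hρ, hball⟩ := Metric.mem_nhds_iff.1 (inter_mem (inter_mem hU hs) (hd.and hbd))
  -- the flow of the augmented system
  let F : E × (E →L[ℝ] E) → E × (E →L[ℝ] E) := fun w => (f w.1, (fderiv ℝ f w.1).comp w.2)
  let w₀ : E × (E →L[ℝ] E) := (q₀, ContinuousLinearMap.id ℝ E)
  have hF : ContDiffAt ℝ 1 F w₀ := by
    have h1 : ContDiffAt ℝ 1 (fun w : E × (E →L[ℝ] E) => f w.1) w₀ :=
      ContDiffAt.comp w₀ (hf.of_le (by norm_num)) contDiffAt_fst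
    have h2 : ContDiffAt ℝ 1 (fun w : E × (E →L[ℝ] E) => fderiv ℝ f w.1) w₀ :=
      ContDiffAt.comp w₀ hf' contDiffAt_fst
    exact h1.prodMk (h2.clm_comp contDiffAt_snd)
  obtain ⟨ε, hε, a, r, L, K, hr, hPL⟩ := IsPicardLindelof.of_contDiffAt_one hF
  obtain ⟨α, hα, L', hL'⟩ := (hPL 0).exists_forall_mem_closedBall_eq_hasDerivWithinAt_lipschitzOnWith
  have hcont : ContinuousOn (fun p : (E × (E →L[ℝ] E)) × ℝ => α p.1 p.2)
      (closedBall w₀ r ×ˢ Icc (0 - ε) (0 + ε)) :=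
    continuousOn_prod_of_continuousOn_lipschitzOnWith _ L'
      (fun x hx => HasDerivWithinAt.continuousOn (hα x hx).2) hL'
  have hr' : (0 : ℝ) < r := hr
  have hin : ∀ q ∈ ball q₀ r, ((q, ContinuousLinearMap.id ℝ E) : E × (E →L[ℝ] E)) ∈
      closedBall w₀ r := fun q hq => by
    rw [mem_closedBall, Prod.dist_eq]
    simpa [w₀] using (mem_ball.1 hq).le
  have hcont2 : ContinuousOn (fun p : ℝ × E => α (p.2, ContinuousLinearMap.id ℝ E) p.1)
      (Ioo (-ε) ε ×ˢ ball q₀ r) := by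
    refine hcont.comp (f := fun p : ℝ × E => ((p.2, ContinuousLinearMap.id ℝ E), p.1))
      (by fun_prop) ?_
    rintro ⟨t, q⟩ ⟨ht, hq⟩
    exact ⟨hin q hq, by simpa using ht.1.le, by simpa using ht.2.le⟩
  have hopen : IsOpen (Ioo (-ε) ε ×ˢ ball q₀ (r : ℝ)) := isOpen_Ioo.prod isOpen_ball
  have h00 : ((0 : ℝ), q₀) ∈ Ioo (-ε) ε ×ˢ ball q₀ (r : ℝ) :=
    ⟨⟨by linarith, hε⟩, mem_ball_self hr'⟩
  have hev : ∀ᶠ p : ℝ × E in 𝓝 (0, q₀), (α (p.2, ContinuousLinearMap.id ℝ E) p.1).1 ∈ ball q₀ ρ := by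
    have hc := (hcont2.continuousAt (hopen.mem_nhds h00)).fst
    refine hc.eventually_mem (isOpen_ball.mem_nhds ?_)
    simp only
    rw [(hα _ (hin q₀ (mem_ball_self hr'))).1]
    exact mem_ball_self hρ
  obtain ⟨δ, hδ, hδball⟩ := Metric.mem_nhds_iff.1 (inter_mem hev (hopen.mem_nhds h00))
  have hprod : ∀ q ∈ ball q₀ δ, ∀ t ∈ Ioo (-δ) δ, ((t, q) : ℝ × E) ∈ ball ((0 : ℝ), q₀) δ := by
    intro q hq t ht
    rw [← ball_prod_same]
    exact ⟨by rw [Real.ball_eq_Ioo]; simpa using ht, hq⟩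
  let Φ : ℝ → E → E := fun t q => (α (q, ContinuousLinearMap.id ℝ E) t).1
  let Y : ℝ → E → E →L[ℝ] E := fun t q => (α (q, ContinuousLinearMap.id ℝ E) t).2
  have hmem : ∀ q ∈ ball q₀ δ, ∀ t ∈ Ioo (-δ) δ, Φ t q ∈ ball q₀ ρ := fun q hq t ht =>
    (hδball (hprod q hq t ht)).1
  have hin2 : ∀ q ∈ ball q₀ δ, ∀ t ∈ Ioo (-δ) δ, t ∈ Ioo (-ε) ε ∧ q ∈ ball q₀ (r : ℝ) :=
    fun q hq t ht => (hδball (hprod q hq t ht)).2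
  have h0δ : (0 : ℝ) ∈ Ioo (-δ) δ := ⟨by linarith, hδ⟩
  have h0 : ∀ q ∈ ball q₀ δ, Φ 0 q = q ∧ Y 0 q = ContinuousLinearMap.id ℝ E := fun q hq => by
    have h := (hα _ (hin q (hin2 q hq 0 h0δ).2)).1
    simp only [Φ, Y]
    constructor <;> rw [h]
  have hder : ∀ q ∈ ball q₀ δ, ∀ t ∈ Ioo (-δ) δ,
      HasDerivAt (α (q, ContinuousLinearMap.id ℝ E)) (F (α (q, ContinuousLinearMap.id ℝ E) t)) t :=
    fun q hq t ht => by
      obtain ⟨ht', hq'⟩ := hin2 q hq t ht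
      have := (hα _ (hin q hq')).2 t ⟨by linarith [ht'.1], by linarith [ht'.2]⟩
      exact this.hasDerivAt (Icc_mem_nhds (by linarith [ht'.1]) (by linarith [ht'.2]))
  have hΦ : ∀ q ∈ ball q₀ δ, ∀ t ∈ Ioo (-δ) δ, HasDerivAt (Φ · q) (f (Φ t q)) t :=
    fun q hq t ht => (hder q hq t ht).fst
  have hY : ∀ q ∈ ball q₀ δ, ∀ t ∈ Ioo (-δ) δ,
      HasDerivAt (Y · q) ((fderiv ℝ f (Φ t q)).comp (Y t q)) t :=
    fun q hq t ht => (hder q hq t ht).snd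
  have hlip : ∀ q ∈ ball q₀ δ, ∀ q' ∈ ball q₀ δ, ∀ t ∈ Ioo (-δ) δ,
      ‖Φ t q - Φ t q'‖ ≤ L' * ‖q - q'‖ := by
    intro q hq q' hq' t ht
    obtain ⟨ht', hqr⟩ := hin2 q hq t ht
    have := (hL' t ⟨by linarith [ht'.1], by linarith [ht'.2]⟩).dist_le_mul _ (hin q hqr) _
      (hin q' (hin2 q' hq' t ht).2)
    rw [dist_eq_norm, dist_eq_norm] at this
    refine ((norm_fst_le _).trans this).trans (le_of_eq ?_)
    simp [Prod.norm_def]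
  have hΦY : ∀ q ∈ ball q₀ δ, ∀ t ∈ Ioo (-δ) δ, HasFDerivAt (Φ t) (Y t q) q :=
    fun q hq t ht => hasFDerivAt_of_variational (K₁ := ‖fderiv ℝ f q₀‖ + 1) (K₂ := K₂) (L := L')
      (by linarith [norm_nonneg (fderiv ℝ f q₀)]) K₂.2 L'.2
      (fun x hx => (hball hx).2.1) (fun x hx => (hball hx).2.2)
      (fun x hx y hy => by
        have := hlip2.dist_le_mul x (hball hx).1.2 y (hball hy).1.2
        rwa [dist_eq_norm, dist_eq_norm] at this) hmem h0 hΦ hY hlip hq ht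
  have hDopen : IsOpen (Ioo (-δ) δ ×ˢ ball q₀ δ) := isOpen_Ioo.prod isOpen_ball
  have hcont3 : ContinuousOn (fun p : ℝ × E => α (p.2, ContinuousLinearMap.id ℝ E) p.1)
      (Ioo (-δ) δ ×ˢ ball q₀ δ) := hcont2.mono fun p hp => hin2 p.2 hp.2 p.1 hp.1
  have hcΦ : ContinuousOn (fun p : ℝ × E => f (Φ p.1 p.2)) (Ioo (-δ) δ ×ˢ ball q₀ δ) := by
    intro p hp
    have h1 := (hball (hmem p.2 hp.2 p.1 hp.1)).2.1.continuousAt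
    exact ContinuousAt.comp_continuousWithinAt (f := fun p : ℝ × E => Φ p.1 p.2) h1
      (hcont3 p hp).fst
  have hcY : ContinuousOn (fun p : ℝ × E => Y p.1 p.2) (Ioo (-δ) δ ×ˢ ball q₀ δ) :=
    fun p hp => (hcont3 p hp).snd
  refine ⟨δ, hδ, Φ, Y, fun q hq => ⟨h0 q hq, fun t ht => ⟨(hball (hmem q hq t ht)).1.1,
    hΦ q hq t ht, hY q hq t ht, hΦY q hq t ht, ?_⟩⟩⟩
  -- Joint regularity follows from continuity of the two partial derivatives, `f ∘ Φ` in time and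
  -- `Y` in space.
  rw [contDiffAt_one_iff]
  refine ⟨fun p => (ContinuousLinearMap.toSpanSingleton ℝ (f (Φ p.1 p.2))).coprod (Y p.1 p.2),
    _, hDopen.mem_nhds ⟨ht, hq⟩, ?_, ?_⟩
  · have : Continuous fun p : E × (E →L[ℝ] E) =>
        (ContinuousLinearMap.toSpanSingleton ℝ p.1).coprod p.2 := by
      have h1 : (fun p : E × (E →L[ℝ] E) => (ContinuousLinearMap.toSpanSingleton ℝ p.1).coprod p.2) =
          fun p => (ContinuousLinearMap.toSpanSingletonCLE (𝕜 := ℝ) p.1).comp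
            (ContinuousLinearMap.fst ℝ ℝ E) + p.2.comp (ContinuousLinearMap.snd ℝ ℝ E) := by
        ext p <;> simp
      rw [h1]
      fun_prop
    exact this.comp_continuousOn (hcΦ.prodMk hcY)
  · rintro ⟨t', q'⟩ hp
    refine (hasStrictFDerivAt_uncurry_coprod (𝕜 := ℝ) (u := (t', q')) (f := Φ)
      (f₁ := fun t q => ContinuousLinearMap.toSpanSingleton ℝ (f (Φ t q))) (f₂ := Y) ?_ ?_ ?_
      ?_).hasFDerivAt
    · filter_upwards [hDopen.mem_nhds hp] with v hv
      exact (hΦ v.2 hv.2 v.1 hv.1).hasFDerivAt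
    · filter_upwards [hDopen.mem_nhds hp] with v hv
      exact hΦY v.2 hv.2 v.1 hv.1
    · have h1 := (hcΦ.continuousAt (hDopen.mem_nhds hp))
      exact ((ContinuousLinearMap.toSpanSingletonCLE (𝕜 := ℝ) (E := E)).continuous.continuousAt).comp h1
    · exact hcY.continuousAt (hDopen.mem_nhds hp)

end Flow
end BlowDown

end

/-! ### Orbits: uniqueness, homogeneity, energy and flow boxes -/

noncomputable section

namespace BlowDown

set_option synthInstance.maxHeartbeats 200000
set_option maxSynthPendingDepth 3
set_option linter.unusedSectionVars false

variable {n : ℕ} {M : Type*} [TopologicalSpace M] [ChartedSpace (Model n) M]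
  [IsManifold (𝓡 n) ∞ M]

section Charts

lemma continuousAt_cotChart {x : M} {p : Cotangent n M}
    (hp : p.1 ∈ (extChartAt (𝓡 n) x).source) : ContinuousAt (cotChart n x) p := by
  have h : p ∈ (extChartAt (cotModel n) (covector x 0 : Cotangent n M)).source := by
    rw [extChartAt_eq_cotChart]; exact mem_cotChart_source.2 hp
  have := continuousAt_extChartAt' (I := cotModel n) h
  rwa [extChartAt_eq_cotChart] at this

lemma continuousAt_cotChart_symm {x : M} {q : Phase n}
    (hq : q.1 ∈ (extChartAt (𝓡 n) x).target) : ContinuousAt (cotChart n x).symm q := by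
  have h : q ∈ (extChartAt (cotModel n) (covector x 0 : Cotangent n M)).target := by
    rw [extChartAt_eq_cotChart]; exact mem_cotChart_target.2 hq
  have := continuousAt_extChartAt_symm'' (I := cotModel n) h
  rwa [extChartAt_eq_cotChart] at this

lemma cotChart_symm_mem {x : M} {q : Phase n} (hq : q.1 ∈ (extChartAt (𝓡 n) x).target) :
    ((cotChart n x).symm q).1 ∈ (extChartAt (𝓡 n) x).source :=
  mem_cotChart_source.1 ((cotChart n x).map_target (mem_cotChart_target.2 hq))

lemma cotChart_right_inv {x : M} {q : Phase n} (hq : q.1 ∈ (extChartAt (𝓡 n) x).target) :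
    cotChart n x ((cotChart n x).symm q) = q :=
  (cotChart n x).right_inv (mem_cotChart_target.2 hq)

lemma cotChart_left_inv {x : M} {p : Cotangent n M}
    (hp : p.1 ∈ (extChartAt (𝓡 n) x).source) : (cotChart n x).symm (cotChart n x p) = p :=
  (cotChart n x).left_inv (mem_cotChart_source.2 hp)

lemma cotChart_injOn {x : M} {p q : Cotangent n M} (hp : p.1 ∈ (extChartAt (𝓡 n) x).source)
    (hq : q.1 ∈ (extChartAt (𝓡 n) x).source) (h : cotChart n x p = cotChart n x q) : p = q :=
  (cotChart n x).injOn (mem_cotChart_source.2 hp) (mem_cotChart_source.2 hq) h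

instance [T2Space M] : T2Space (Cotangent n M) := by
  refine ⟨fun p q hpq => ?_⟩
  by_cases h : p.1 = q.1
  · have hp := mem_extChartAt_source (I := 𝓡 n) p.1
    have hq : q.1 ∈ (extChartAt (𝓡 n) p.1).source := h ▸ hp
    have hne : cotChart n p.1 p ≠ cotChart n p.1 q := fun h' => hpq (cotChart_injOn hp hq h')
    obtain ⟨u, v, hu, hv, hpu, hqv, huv⟩ := t2_separation hne
    have hU := (continuousAt_cotChart hp).preimage_mem_nhds (hu.mem_nhds hpu)
    have hV := (continuousAt_cotChart hq).preimage_mem_nhds (hv.mem_nhds hqv)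
    obtain ⟨u', hu', hou, hpu'⟩ := mem_nhds_iff.1 hU
    obtain ⟨v', hv', hov, hqv'⟩ := mem_nhds_iff.1 hV
    exact ⟨u', v', hou, hov, hpu', hqv',
      Disjoint.mono hu' hv' (Disjoint.preimage _ huv)⟩
  · obtain ⟨u, v, hu, hv, hpu, hqv, huv⟩ := t2_separation h
    exact ⟨_, _, hu.preimage continuous_proj', hv.preimage continuous_proj', hpu, hqv,
      Disjoint.preimage _ huv⟩

end Charts

/-- `c` satisfies the equation of the geodesic flow at the time `t`. -/
def IsOrbitAt (g : Metric n M) (c : ℝ → Cotangent n M) (t : ℝ) : Prop :=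
  ContinuousAt c t ∧ HasDerivAt (fun s => cotChart n (c t).1 (c s))
    (geoField g (c t).1 (cotChart n (c t).1 (c t))) t

/-- Any chart around the point may be used, because the geodesic field transforms like a velocity.
-/
lemma isOrbitAt_iff {g : Metric n M} {c : ℝ → Cotangent n M} {t : ℝ} {x : M}
    (hx : (c t).1 ∈ (extChartAt (𝓡 n) x).source) :
    IsOrbitAt g c t ↔ ContinuousAt c t ∧ HasDerivAt (fun s => cotChart n x (c s))
      (geoField g x (cotChart n x (c t))) t := by
  have hc := mem_extChartAt_source (I := 𝓡 n) (c t).1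
  refine and_congr_right fun hcont => ⟨fun h => ?_, fun h => ?_⟩
  · have := hasDerivAt_cotChart_change hcont hc hx h
    rwa [← geoField_cotTrans g (cotChart_mem_overlap hc hx), cotTrans_cotChart hc] at this
  · have := hasDerivAt_cotChart_change hcont hx hc h
    rwa [← geoField_cotTrans g (cotChart_mem_overlap hx hc), cotTrans_cotChart hx] at this

lemma contDiffAt_geoField (g : Metric n M) {x : M} {q : Phase n}
    (hq : q.1 ∈ (extChartAt (𝓡 n) x).target) : ContDiffAt ℝ ∞ (geoField g x) q :=
  (contDiffOn_geoField g x).contDiffAt ((isOpen_cotTarget x).mem_nhds hq)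

lemma IsOrbitAt.eventuallyEq {g : Metric n M} {c₁ c₂ : ℝ → Cotangent n M} {t : ℝ}
    (h₁ : ∀ᶠ s in nhds t, IsOrbitAt g c₁ s) (h₂ : ∀ᶠ s in nhds t, IsOrbitAt g c₂ s)
    (h : c₁ t = c₂ t) : c₁ =ᶠ[nhds t] c₂ := by
  set x := (c₁ t).1 with hx
  have hs1 : (c₁ t).1 ∈ (extChartAt (𝓡 n) x).source := mem_extChartAt_source _
  have hs2 : (c₂ t).1 ∈ (extChartAt (𝓡 n) x).source := h ▸ hs1
  obtain ⟨K, s, hs, hK⟩ := ((contDiffAt_geoField g (cotChart_mem_target hs1)).of_le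
    (m := 1) (by simp)).exists_lipschitzOnWith
  have key : ∀ c : ℝ → Cotangent n M, (∀ᶠ s in nhds t, IsOrbitAt g c s) → c t = c₁ t →
      ∀ᶠ r in nhds t, (HasDerivAt (fun s => cotChart n x (c s))
        (geoField g x (cotChart n x (c r))) r ∧ cotChart n x (c r) ∈ s) ∧
        (c r).1 ∈ (extChartAt (𝓡 n) x).source := by
    intro c hc hct
    have hcs : (c t).1 ∈ (extChartAt (𝓡 n) x).source := hct ▸ hs1
    have hcont : ContinuousAt c t := hc.self_of_nhds.1
    have h3 : ContinuousAt (fun r => cotChart n x (c r)) t :=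
      ContinuousAt.comp (g := cotChart n x) (continuousAt_cotChart hcs) hcont
    filter_upwards [hc, hcont.eventually_mem ((isOpen_cotSource x).mem_nhds hcs),
      h3.eventually_mem (by rw [hct]; exact hs)] with r hr1 hr2 hr3
    exact ⟨⟨((isOrbitAt_iff hr2).1 hr1).2, hr3⟩, hr2⟩
  have k1 := key c₁ h₁ rfl
  have k2 := key c₂ h₂ h.symm
  have := ODE_solution_unique_of_eventually (v := fun _ => geoField g x) (s := fun _ => s)
    (Filter.Eventually.of_forall fun _ => hK) (k1.mono fun _ h => h.1) (k2.mono fun _ h => h.1)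
    (by rw [h])
  filter_upwards [this, k1, k2] with r h1 h2 h3
  exact cotChart_injOn h2.2 h3.2 h1

/-- The set where the germs agree is open, and relatively closed: two orbits that differ at a time
differ nearby, as the cotangent bundle is Hausdorff, and two that agree at a time have equal germs
there. -/
lemma IsOrbitAt.eqOn [T2Space M] {g : Metric n M} {c₁ c₂ : ℝ → Cotangent n M} {s : Set ℝ}
    (hs : IsOpen s) (hs' : IsPreconnected s)
    (h₁ : ∀ t ∈ s, IsOrbitAt g c₁ t) (h₂ : ∀ t ∈ s, IsOrbitAt g c₂ t) {t₀ : ℝ} (ht₀ : t₀ ∈ s)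
    (h : c₁ t₀ = c₂ t₀) : EqOn c₁ c₂ s := by
  set u := {t | c₁ =ᶠ[nhds t] c₂} with hu
  have hopen : IsOpen u := isOpen_setOfPred_eventually_nhds
  have hev : ∀ t ∈ s, c₁ t = c₂ t → t ∈ u := fun t ht he =>
    IsOrbitAt.eventuallyEq (Filter.eventually_of_mem (hs.mem_nhds ht) h₁)
      (Filter.eventually_of_mem (hs.mem_nhds ht) h₂) he
  have hsub : s ⊆ u := by
    refine hs'.subset_of_closure_inter_subset hopen ⟨t₀, ht₀, hev t₀ ht₀ h⟩ ?_
    rintro t ⟨htc, hts⟩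
    refine hev t hts ?_
    by_contra hne
    have h1 : ∀ᶠ r in nhds t, c₁ r ≠ c₂ r := by
      exact ((h₁ t hts).1.prodMk_nhds (h₂ t hts).1).eventually_mem
        ((isOpen_ne_fun continuous_fst continuous_snd).mem_nhds hne)
    obtain ⟨r, hr1, hr2⟩ := (mem_closure_iff_frequently.1 htc).and_eventually h1 |>.exists
    exact hr2 hr1.self_of_nhds
  exact fun t ht => (hsub ht).self_of_nhds

lemma isGeodesicOrbit_iff_isOrbitAt {g : Metric n M} {c : ℝ → Cotangent n M} :
    IsGeodesicOrbit g c ↔ ∀ t, IsOrbitAt g c t := isGeodesicOrbit_iff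

lemma IsGeodesicOrbit.eq [T2Space M] {g : Metric n M} {c₁ c₂ : ℝ → Cotangent n M}
    (h₁ : IsGeodesicOrbit g c₁) (h₂ : IsGeodesicOrbit g c₂) {t : ℝ} (h : c₁ t = c₂ t) :
    c₁ = c₂ :=
  funext fun s => IsOrbitAt.eqOn isOpen_univ isPreconnected_univ
    (fun t _ => isGeodesicOrbit_iff.1 h₁ t) (fun t _ => isGeodesicOrbit_iff.1 h₂ t)
    (mem_univ t) h (mem_univ s)

lemma IsOrbitAt.shift {g : Metric n M} {c : ℝ → Cotangent n M} {a t : ℝ}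
    (h : IsOrbitAt g c (t + a)) : IsOrbitAt g (fun s => c (s + a)) t :=
  ⟨ContinuousAt.comp (g := c) h.1 (by fun_prop), h.2.comp_add_const t a⟩

lemma IsGeodesicOrbit.shift {g : Metric n M} {c : ℝ → Cotangent n M}
    (h : IsGeodesicOrbit g c) (a : ℝ) : IsGeodesicOrbit g (fun s => c (s + a)) :=
  isGeodesicOrbit_iff.2 fun t => IsOrbitAt.shift (isGeodesicOrbit_iff.1 h (t + a))

/-- Multiplication by `l` in the fibres of `T^*M`. -/
def fibreScale (l : ℝ) (p : Cotangent n M) : Cotangent n M := covector p.1 (l • covec p)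

lemma cotChart_fibreScale (l : ℝ) {x : M} {p : Cotangent n M}
    (hp : p.1 ∈ (extChartAt (𝓡 n) x).source) :
    cotChart n x (fibreScale l p) = ((cotChart n x p).1, l • (cotChart n x p).2) := by
  rw [cotChart_apply hp, cotChart_apply (p := fibreScale l p) hp]
  rfl

/-- Multiplication by `l` in the fibres, in canonical coordinates. -/
def phaseScale (l : ℝ) : Phase n →L[ℝ] Phase n :=
  (ContinuousLinearMap.fst ℝ _ _).prod (l • ContinuousLinearMap.snd ℝ _ _)

lemma continuous_fibreScale (l : ℝ) : Continuous (fibreScale (n := n) (M := M) l) := by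
  refine continuous_iff_continuousAt.2 fun p => ?_
  have hp := mem_extChartAt_source (I := 𝓡 n) p.1
  have h1 : ContinuousAt (fun q => (cotChart n p.1).symm (phaseScale l (cotChart n p.1 q))) p := by
    refine ContinuousAt.comp (g := (cotChart n p.1).symm) ?_
      ((phaseScale l).continuous.continuousAt.comp (continuousAt_cotChart hp))
    exact continuousAt_cotChart_symm (cotChart_mem_target hp)
  refine h1.congr ?_
  filter_upwards [(isOpen_cotSource p.1).mem_nhds hp] with q hq
  have : phaseScale l (cotChart n p.1 q) = cotChart n p.1 (fibreScale l q) :=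
    (cotChart_fibreScale l hq).symm
  rw [this, cotChart_left_inv (p := fibreScale l q) hq]

/-- The Hamiltonian is homogeneous of degree two in the fibres; differentiate this identity. -/
lemma geoField_phaseScale (g : Metric n M) {x : M} (l : ℝ) {q : Phase n}
    (hq : q.1 ∈ (extChartAt (𝓡 n) x).target) :
    geoField g x (phaseScale l q) = l • phaseScale l (geoField g x q) := by
  have h1 : HasFDerivAt (hamil g x ∘ phaseScale l) _ q :=
    HasFDerivAt.comp (g := hamil g x) q (hasFDerivAt_hamil g (q := phaseScale l q) hq)
      (phaseScale l).hasFDerivAt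
  have h2 : hamil g x ∘ phaseScale l = fun q => l ^ 2 * hamil g x q := by
    funext q
    simp [hamil, phaseScale]
    ring
  have h3 := (hasFDerivAt_hamil g hq).const_mul (l ^ 2)
  rw [h2] at h1
  have h4 := h1.unique h3
  refine Prod.ext ?_ ?_
  · simp [geoField, phaseScale]
  · ext v
    have h5 := DFunLike.congr_fun h4 (v, 0)
    simp [phaseScale] at h5
    simp [geoField, phaseScale] at h5 ⊢
    rw [h5]
    ring

lemma IsGeodesicOrbit.fibreScale {g : Metric n M} {c : ℝ → Cotangent n M}
    (h : IsGeodesicOrbit g c) (l : ℝ) :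
    IsGeodesicOrbit g (fun t => fibreScale l (c (l * t))) := by
  refine isGeodesicOrbit_iff_isOrbitAt.2 fun t => ?_
  have h0 := isGeodesicOrbit_iff.1 h (l * t)
  have hx := mem_extChartAt_source (I := 𝓡 n) (c (l * t)).1
  have hcont : ContinuousAt (fun s => c (l * s)) t :=
    ContinuousAt.comp (g := c) h0.1 (by fun_prop)
  refine (isOrbitAt_iff (c := fun t => BlowDown.fibreScale l (c (l * t))) (x := (c (l * t)).1) hx).2
    ⟨(continuous_fibreScale l).continuousAt.comp hcont, ?_⟩
  have h1 : HasDerivAt (fun s => cotChart n (c (l * t)).1 (c (l * s)))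
      (l • geoField g (c (l * t)).1 (cotChart n (c (l * t)).1 (c (l * t)))) t :=
    HasDerivAt.scomp (h := fun s => l * s) t h0.2 (by simpa using (hasDerivAt_id t).const_mul l)
  have h2 := (phaseScale (n := n) l).hasFDerivAt.comp_hasDerivAt t h1
  have h3 : cotChart n (c (l * t)).1 (BlowDown.fibreScale l (c (l * t))) =
    phaseScale l (cotChart n (c (l * t)).1 (c (l * t))) := cotChart_fibreScale l hx
  rw [h3, geoField_phaseScale g l (cotChart_mem_target hx), ← map_smul]
  refine h2.congr_of_eventuallyEq ?_
  filter_upwards [hcont.eventually_mem ((isOpen_cotSource (c (l * t)).1).mem_nhds hx)] with s hs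
  exact cotChart_fibreScale l hs

lemma isGeodesicOrbit_const (g : Metric n M) (z : M) :
    IsGeodesicOrbit g (fun _ => (covector z 0 : Cotangent n M)) := by
  refine isGeodesicOrbit_iff_isOrbitAt.2 fun t => ⟨continuousAt_const, ?_⟩
  have hz : (covector z 0 : Cotangent n M).1 ∈ (extChartAt (𝓡 n) z).source :=
    mem_extChartAt_source (I := 𝓡 n) z
  -- The zero covector is fixed by scaling with `0`, and homogeneity with the factor `0` forces the
  -- field to vanish there.
  have h1 : fibreScale 0 (covector z 0 : Cotangent n M) = covector z 0 := by
    simp [fibreScale, covector]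
  have h2 : cotChart n z (covector z 0) = phaseScale 0 (cotChart n z (covector z 0)) := by
    conv_lhs => rw [← h1]
    exact cotChart_fibreScale 0 hz
  have h3 : geoField g z (cotChart n z (covector z 0)) = 0 := by
    rw [h2, geoField_phaseScale g 0 (cotChart_mem_target hz), zero_smul]
  have h4 : geoField g (covector z 0 : Cotangent n M).1
    (cotChart n (covector z 0 : Cotangent n M).1 (covector z 0)) = 0 := h3
  rw [h4]
  exact hasDerivAt_const _ _

/-- The derivative of the energy along an orbit is the symplectic form of the velocity with itself.
-/
lemma IsGeodesicOrbit.energy_eq {g : Metric n M} {c : ℝ → Cotangent n M}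
    (h : IsGeodesicOrbit g c) (s t : ℝ) : energy g (c s) = energy g (c t) := by
  have hd : ∀ t, HasDerivAt (fun s => energy g (c s)) 0 t := by
    intro t
    have h0 := isGeodesicOrbit_iff.1 h t
    have hx := mem_extChartAt_source (I := 𝓡 n) (c t).1
    have h1 := (hasFDerivAt_hamil g (cotChart_mem_target hx)).comp_hasDerivAt t h0.2
    rw [← omega_geoField g (cotChart_mem_target hx)] at h1
    have h2 : ∀ v : Phase n, omega v v = 0 := fun v => sub_self _
    rw [h2] at h1
    refine h1.congr_of_eventuallyEq ?_
    filter_upwards [h0.1.eventually_mem ((isOpen_cotSource (c t).1).mem_nhds hx)] with s hs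
    exact BlowDown.energy_eq g hs
  exact is_const_of_deriv_eq_zero (fun t => (hd t).differentiableAt) (fun t => (hd t).deriv) s t

/-- A local flow of the geodesic vector field in a chart. -/
lemma exists_flowBox [T2Space M] (g : Metric n M) {x : M} {p : Cotangent n M}
    (hp : p.1 ∈ (extChartAt (𝓡 n) x).source) :
    ∃ δ > 0, ∃ (Φ : ℝ → Phase n → Phase n) (Y : ℝ → Phase n → Phase n →L[ℝ] Phase n),
      (∀ q ∈ Metric.ball (cotChart n x p) δ,
        (Φ 0 q = q ∧ Y 0 q = ContinuousLinearMap.id ℝ _) ∧ ∀ t ∈ Ioo (-δ) δ,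
          (Φ t q).1 ∈ (extChartAt (𝓡 n) x).target ∧
          HasDerivAt (Y · q) ((fderiv ℝ (geoField g x) (Φ t q)).comp (Y t q)) t ∧
          HasFDerivAt (Φ t) (Y t q) q ∧
          ContDiffAt ℝ 1 (fun p : ℝ × Phase n => Φ p.1 p.2) (t, q)) ∧
      ∀ c, IsGeodesicOrbit g c → ∀ t₁, (c t₁).1 ∈ (extChartAt (𝓡 n) x).source →
        cotChart n x (c t₁) ∈ Metric.ball (cotChart n x p) δ → ∀ s ∈ Ioo (-δ) δ,
          (c (t₁ + s)).1 ∈ (extChartAt (𝓡 n) x).source ∧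
            cotChart n x (c (t₁ + s)) = Φ s (cotChart n x (c t₁)) := by
  obtain ⟨δ, hδ, Φ, Y, H⟩ := exists_local_flow
    ((contDiffAt_geoField g (cotChart_mem_target hp)).of_le (m := 2)
      (WithTop.coe_le_coe.2 (le_top : (2 : ℕ∞) ≤ ⊤)))
    ((isOpen_cotTarget x).mem_nhds (cotChart_mem_target hp))
  refine ⟨δ, hδ, Φ, Y, fun q hq => ⟨(H q hq).1, fun t ht => ?_⟩, ?_⟩
  · obtain ⟨h1, h2, h3, h4, h5⟩ := (H q hq).2 t ht
    exact ⟨h1, h3, h4, h5⟩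
  · intro c hc t₁ ht₁ hball s hs
    set q := cotChart n x (c t₁)
    let c' : ℝ → Cotangent n M := fun s => (cotChart n x).symm (Φ s q)
    have hΦ : ∀ t ∈ Ioo (-δ) δ, (Φ t q).1 ∈ (extChartAt (𝓡 n) x).target ∧
        HasDerivAt (Φ · q) (geoField g x (Φ t q)) t := fun t ht =>
      ⟨((H q hball).2 t ht).1, ((H q hball).2 t ht).2.1⟩
    have hc' : ∀ t ∈ Ioo (-δ) δ, IsOrbitAt g c' t := by
      intro t ht
      obtain ⟨h1, h2⟩ := hΦ t ht
      have hm : (c' t).1 ∈ (extChartAt (𝓡 n) x).source := cotChart_symm_mem h1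
      refine (isOrbitAt_iff hm).2 ⟨ContinuousAt.comp (g := (cotChart n x).symm)
        (continuousAt_cotChart_symm h1) h2.continuousAt, ?_⟩
      have : cotChart n x (c' t) = Φ t q := cotChart_right_inv h1
      rw [this]
      refine h2.congr_of_eventuallyEq ?_
      filter_upwards [h2.continuousAt.eventually_mem ((isOpen_cotTarget x).mem_nhds h1)] with r hr
      exact cotChart_right_inv hr
    have h0 : (0 : ℝ) ∈ Ioo (-δ) δ := ⟨by linarith, hδ⟩
    have heq := IsOrbitAt.eqOn (c₁ := fun s => c (s + t₁)) (c₂ := c') isOpen_Ioo isPreconnected_Ioo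
      (fun t _ => isGeodesicOrbit_iff.1 (hc.shift t₁) t) hc' h0 (by
        simp only [c', (H q hball).1.1, zero_add]
        exact (cotChart_left_inv ht₁).symm) hs
    have heq' : c (t₁ + s) = c' s := by rw [add_comm]; exact heq
    rw [heq']
    exact ⟨cotChart_symm_mem (hΦ s hs).1, cotChart_right_inv (hΦ s hs).1⟩

end BlowDown

end

/-! ### The unit cosphere and regularity of the flow out of a point -/

noncomputable section

namespace BlowDown

set_option synthInstance.maxHeartbeats 200000
set_option maxSynthPendingDepth 3
set_option linter.unusedSectionVars false

variable {n : ℕ} {M : Type*} [TopologicalSpace M] [ChartedSpace (Model n) M]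
  [IsManifold (𝓡 n) ∞ M]

section Cosphere

variable (g : Metric n M) (z : M)

/-- The identification of covectors with vectors at `z`. -/
def sharpAt : (Model n →L[ℝ] ℝ) →L[ℝ] Model n := raise g z (extChartAt (𝓡 n) z z)

lemma cotChart_covector (ξ : Model n →L[ℝ] ℝ) :
    cotChart n z (covector z ξ) = (extChartAt (𝓡 n) z z, ξ) :=
  cotChart_self_apply (covector z ξ)

lemma energy_covector (ξ : Model n →L[ℝ] ℝ) : energy g (covector z ξ) = ξ (sharpAt g z ξ) / 2 := by
  rw [energy_eq g (x := z) (mem_extChartAt_source (I := 𝓡 n) z), cotChart_covector]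
  rfl

lemma normSq_covector (ξ : Model n →L[ℝ] ℝ) : normSq g (covector z ξ) = ξ (sharpAt g z ξ) := by
  have := energy_covector g z ξ
  rw [energy] at this
  linarith

lemma sharpAt_symm (ξ η : Model n →L[ℝ] ℝ) : ξ (sharpAt g z η) = η (sharpAt g z ξ) :=
  apply_raise_comm g (mem_extChartAt_target z) ξ η

lemma sharpAt_pos {ξ : Model n →L[ℝ] ℝ} (h : ξ ≠ 0) : 0 < ξ (sharpAt g z ξ) :=
  apply_raise_pos g (mem_extChartAt_target z) h

variable {g z} in
lemma mem_unitCosphere {ξ : Model n →L[ℝ] ℝ} : ξ ∈ unitCosphere g z ↔ ξ (sharpAt g z ξ) = 1 := by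
  rw [unitCosphere, mem_ofPred_eq, normSq_covector]

lemma smul_mem_unitCosphere {ξ : Model n →L[ℝ] ℝ} (h : ξ ≠ 0) :
    (Real.sqrt (ξ (sharpAt g z ξ)))⁻¹ • ξ ∈ unitCosphere g z := by
  have hp := sharpAt_pos g z h
  rw [mem_unitCosphere]
  simp only [map_smul, smul_apply, smul_eq_mul]
  rw [← mul_assoc, ← mul_inv, Real.mul_self_sqrt hp.le, inv_mul_cancel₀ hp.ne']

lemma neg_mem_unitCosphere {ξ : Model n →L[ℝ] ℝ} (h : ξ ∈ unitCosphere g z) :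
    -ξ ∈ unitCosphere g z := by
  rw [mem_unitCosphere] at h ⊢
  simpa using h

/-- All geodesics that issue from `z` are defined for all times. -/
def IsCompleteAt : Prop := ∀ ξ : Model n →L[ℝ] ℝ, ∃ c : ℝ → Cotangent n M,
  IsGeodesicOrbit g c ∧ c 0 = covector z ξ

variable {g z}

/-- Nonzero covectors are multiples of unit ones, and `IsGeodesicOrbit.fibreScale` rescales the
orbits; the zero covector has a constant orbit. Completeness for all covectors allows
differentiation in the whole fibre, off the sphere. -/
lemma isCompleteAt_of_unitCosphere (h : ∀ ξ ∈ unitCosphere g z, ∃ c : ℝ → Cotangent n M,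
    IsGeodesicOrbit g c ∧ c 0 = covector z ξ) : IsCompleteAt g z := by
  intro ξ
  by_cases h0 : ξ = 0
  · subst h0
    exact ⟨_, isGeodesicOrbit_const g z, rfl⟩
  · obtain ⟨c, hc, hc0⟩ := h _ (smul_mem_unitCosphere g z h0)
    refine ⟨_, hc.fibreScale (Real.sqrt (ξ (sharpAt g z ξ))), ?_⟩
    have hp := Real.sqrt_pos.2 (sharpAt_pos g z h0)
    rw [mul_zero, hc0]
    change covector z (_ • (_ • ξ)) = _
    rw [smul_smul, mul_inv_cancel₀ hp.ne', one_smul]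

end Cosphere

section Iota

variable {g : Metric n M} {z : M} (hz : IsCompleteAt g z)
include hz

lemma isGeodesicOrbit_iota (ξ : Model n →L[ℝ] ℝ) : IsGeodesicOrbit g (fun t => iota g z t ξ) := by
  have h := hz ξ
  have : (fun t => iota g z t ξ) = h.choose := by
    funext t
    rw [iota, geodesicFlow, dif_pos h]
  rw [this]
  exact h.choose_spec.1

lemma iota_zero (ξ : Model n →L[ℝ] ℝ) : iota g z 0 ξ = covector z ξ := by
  have h := hz ξ
  rw [iota, geodesicFlow, dif_pos h]
  exact h.choose_spec.2

lemma isOrbitAt_iota (ξ : Model n →L[ℝ] ℝ) (t : ℝ) : IsOrbitAt g (fun t => iota g z t ξ) t :=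
  isGeodesicOrbit_iff.1 (isGeodesicOrbit_iota hz ξ) t

lemma energy_iota (t : ℝ) (ξ : Model n →L[ℝ] ℝ) :
    energy g (iota g z t ξ) = ξ (sharpAt g z ξ) / 2 := by
  rw [(isGeodesicOrbit_iota hz ξ).energy_eq t 0, iota_zero hz, energy_covector]

variable [T2Space M]

lemma eq_iota {c : ℝ → Cotangent n M} (hc : IsGeodesicOrbit g c) {ξ : Model n →L[ℝ] ℝ}
    (h0 : c 0 = covector z ξ) (t : ℝ) : c t = iota g z t ξ :=
  congrFun (hc.eq (isGeodesicOrbit_iota hz ξ) (t := 0) (by rw [h0, iota_zero hz])) t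

lemma iota_smul (l t : ℝ) (ξ : Model n →L[ℝ] ℝ) :
    iota g z t (l • ξ) = fibreScale l (iota g z (l * t) ξ) := by
  refine (eq_iota hz ((isGeodesicOrbit_iota hz ξ).fibreScale l) ?_ t).symm
  rw [mul_zero, iota_zero hz]
  rfl

lemma expMap_smul (t : ℝ) (ξ : Model n →L[ℝ] ℝ) : expMap g z (t • ξ) = (iota g z t ξ).1 := by
  rw [expMap, iota_smul hz, mul_one]
  rfl

lemma iota_inj {t : ℝ} {ξ η : Model n →L[ℝ] ℝ} (h : iota g z t ξ = iota g z t η) : ξ = η := by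
  have h1 := congrFun ((isGeodesicOrbit_iota hz ξ).eq (isGeodesicOrbit_iota hz η) h) 0
  rw [iota_zero hz, iota_zero hz] at h1
  exact congrArg covec h1

/-- If the flow is regular in the initial covector at one time, then so it is, in all
variables, at the neighbouring times. -/
lemma exists_contMDiffAt_iota (ξ₀ : Model n →L[ℝ] ℝ) (t₀ : ℝ) : ∃ ε > 0, ∀ t₁ ∈ Ioo (t₀ - ε) (t₀ + ε),
    ContMDiffAt 𝓘(ℝ, Model n →L[ℝ] ℝ) (cotModel n) 1 (iota g z t₁) ξ₀ →
    ∀ t ∈ Ioo (t₀ - ε) (t₀ + ε), ContMDiffAt 𝓘(ℝ, ℝ × (Model n →L[ℝ] ℝ)) (cotModel n) 1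
      (fun p : ℝ × (Model n →L[ℝ] ℝ) => iota g z p.1 p.2) (t, ξ₀) := by
  set x := (iota g z t₀ ξ₀).1
  have hx : (iota g z t₀ ξ₀).1 ∈ (extChartAt (𝓡 n) x).source := mem_extChartAt_source _
  obtain ⟨δ, hδ, Φ, Y, H1, H2⟩ := exists_flowBox g hx
  have hcont := (isOrbitAt_iota hz ξ₀ t₀).1
  have hcont2 : ContinuousAt (fun t => cotChart n x (iota g z t ξ₀)) t₀ :=
    ContinuousAt.comp (g := cotChart n x) (continuousAt_cotChart hx) hcont
  obtain ⟨ε, hε, hball⟩ := Metric.eventually_nhds_iff_ball.1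
    ((hcont.eventually_mem ((isOpen_cotSource x).mem_nhds hx)).and
      (hcont2.eventually_mem (Metric.ball_mem_nhds _ hδ)))
  have hmin : 0 < min ε (δ / 2) := lt_min hε (by linarith)
  refine ⟨min ε (δ / 2), hmin, fun t₁ ht₁ hreg t ht => ?_⟩
  obtain ⟨hs₁, hb₁⟩ := hball t₁ (by
    rw [Real.ball_eq_Ioo]
    exact ⟨by linarith [ht₁.1, min_le_left ε (δ / 2)], by linarith [ht₁.2, min_le_left ε (δ / 2)]⟩)
  have htt : t - t₁ ∈ Ioo (-δ) δ := by
    have := min_le_right ε (δ / 2)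
    exact ⟨by linarith [ht₁.2, ht.1], by linarith [ht₁.1, ht.2]⟩
  obtain ⟨hr1, hr2⟩ := (contMDiffAt_iff_cotChart hs₁).1 hreg
  -- Near `(t, ξ₀)` the map is the local flow for the time `p.1 - t₁` applied to its slice at time
  -- `t₁`, so regularity of one slice spreads to the whole flow box.
  have hev : ∀ᶠ p : ℝ × (Model n →L[ℝ] ℝ) in nhds (t, ξ₀),
      (iota g z p.1 p.2).1 ∈ (extChartAt (𝓡 n) x).source ∧
      cotChart n x (iota g z p.1 p.2) = Φ (p.1 - t₁) (cotChart n x (iota g z t₁ p.2)) := by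
    have e1 : ∀ᶠ p : ℝ × (Model n →L[ℝ] ℝ) in nhds (t, ξ₀), p.1 - t₁ ∈ Ioo (-δ) δ :=
      ContinuousAt.eventually_mem (f := fun p : ℝ × (Model n →L[ℝ] ℝ) => p.1 - t₁)
        (by fun_prop) (isOpen_Ioo.mem_nhds htt)
    have e2 : ∀ᶠ p : ℝ × (Model n →L[ℝ] ℝ) in nhds (t, ξ₀),
        (iota g z t₁ p.2).1 ∈ (extChartAt (𝓡 n) x).source :=
      ContinuousAt.eventually_mem (f := fun p : ℝ × (Model n →L[ℝ] ℝ) => iota g z t₁ p.2)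
        (ContinuousAt.comp (g := iota g z t₁) hr1 continuousAt_snd)
        ((isOpen_cotSource x).mem_nhds hs₁)
    have e3 : ∀ᶠ p : ℝ × (Model n →L[ℝ] ℝ) in nhds (t, ξ₀),
        cotChart n x (iota g z t₁ p.2) ∈ Metric.ball (cotChart n x (iota g z t₀ ξ₀)) δ :=
      ContinuousAt.eventually_mem
        (f := fun p : ℝ × (Model n →L[ℝ] ℝ) => cotChart n x (iota g z t₁ p.2))
        (ContinuousAt.comp (g := fun ξ => cotChart n x (iota g z t₁ ξ)) hr2.continuousAt
          continuousAt_snd)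
        (Metric.isOpen_ball.mem_nhds hb₁)
    filter_upwards [e1, e2, e3] with p h1 h2 h3
    have := H2 _ (isGeodesicOrbit_iota hz p.2) t₁ h2 h3 (p.1 - t₁) h1
    rwa [add_sub_cancel] at this
  have hC : ContDiffAt ℝ 1 (fun p : ℝ × (Model n →L[ℝ] ℝ) =>
      Φ (p.1 - t₁) (cotChart n x (iota g z t₁ p.2))) (t, ξ₀) := by
    have h5 := ((H1 _ hb₁).2 _ htt).2.2.2
    have h6 : ContDiffAt ℝ 1 (fun p : ℝ × (Model n →L[ℝ] ℝ) =>
        (p.1 - t₁, cotChart n x (iota g z t₁ p.2))) (t, ξ₀) :=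
      (contDiffAt_fst.sub contDiffAt_const).prodMk
        (ContDiffAt.comp (t, ξ₀) (g := fun ξ => cotChart n x (iota g z t₁ ξ)) hr2 contDiffAt_snd)
    exact ContDiffAt.comp (t, ξ₀) (g := fun p : ℝ × Phase n => Φ p.1 p.2) h5 h6
  have hC' : ContDiffAt ℝ 1 (fun p : ℝ × (Model n →L[ℝ] ℝ) => cotChart n x (iota g z p.1 p.2))
      (t, ξ₀) := hC.congr_of_eventuallyEq (hev.mono fun p hp => hp.2)
  have hs : (iota g z t ξ₀).1 ∈ (extChartAt (𝓡 n) x).source := hev.self_of_nhds.1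
  refine (contMDiffAt_iff_cotChart (F := fun p : ℝ × (Model n →L[ℝ] ℝ) => iota g z p.1 p.2)
    (a := (t, ξ₀)) hs).2 ⟨?_, hC'⟩
  have h7 : ContinuousAt (fun p : ℝ × (Model n →L[ℝ] ℝ) =>
      (cotChart n x).symm (cotChart n x (iota g z p.1 p.2))) (t, ξ₀) :=
    ContinuousAt.comp (g := (cotChart n x).symm)
      (continuousAt_cotChart_symm (cotChart_mem_target hs)) hC'.continuousAt
  refine h7.congr ?_
  filter_upwards [hev] with p hp
  exact cotChart_left_inv hp.1

/-- The times at which the slice is regular at `ξ` form a set that is open and closed, both by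
`exists_contMDiffAt_iota`: within its window, regularity at one time gives regularity at all. At
time `0` the slice is the inclusion of the fibre. -/
lemma contMDiffAt_iota (t : ℝ) (ξ : Model n →L[ℝ] ℝ) :
    ContMDiffAt 𝓘(ℝ, ℝ × (Model n →L[ℝ] ℝ)) (cotModel n) 1
      (fun p : ℝ × (Model n →L[ℝ] ℝ) => iota g z p.1 p.2) (t, ξ) := by
  set A : Set ℝ := {t | ContMDiffAt 𝓘(ℝ, Model n →L[ℝ] ℝ) (cotModel n) 1 (iota g z t) ξ}
  have hcut : ∀ t, ContMDiffAt 𝓘(ℝ, ℝ × (Model n →L[ℝ] ℝ)) (cotModel n) 1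
      (fun p : ℝ × (Model n →L[ℝ] ℝ) => iota g z p.1 p.2) (t, ξ) → t ∈ A := by
    intro t ht
    have hx : (iota g z t ξ).1 ∈ (extChartAt (𝓡 n) (iota g z t ξ).1).source :=
      mem_extChartAt_source _
    obtain ⟨h1, h2⟩ := (contMDiffAt_iff_cotChart
      (F := fun p : ℝ × (Model n →L[ℝ] ℝ) => iota g z p.1 p.2) (a := (t, ξ)) hx).1 ht
    refine (contMDiffAt_iff_cotChart hx).2
      ⟨ContinuousAt.comp (g := fun p : ℝ × (Model n →L[ℝ] ℝ) => iota g z p.1 p.2)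
        (f := fun ξ => (t, ξ)) h1 (by fun_prop), ?_⟩
    exact ContDiffAt.comp ξ (g := fun p : ℝ × (Model n →L[ℝ] ℝ) =>
      cotChart n (iota g z t ξ).1 (iota g z p.1 p.2)) (f := fun ξ => (t, ξ)) h2
      (contDiffAt_const.prodMk contDiffAt_id)
  have hopen : IsOpen A := by
    refine isOpen_iff_mem_nhds.2 fun t₀ ht₀ => ?_
    obtain ⟨ε, hε, h⟩ := exists_contMDiffAt_iota hz ξ t₀
    filter_upwards [Ioo_mem_nhds (show t₀ - ε < t₀ by linarith) (show t₀ < t₀ + ε by linarith)]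
      with t ht
    exact hcut t (h t₀ ⟨by linarith, by linarith⟩ ht₀ t ht)
  have hclosed : IsClosed A := by
    refine isOpen_compl_iff.1 (isOpen_iff_mem_nhds.2 fun t₀ ht₀ => ?_)
    obtain ⟨ε, hε, h⟩ := exists_contMDiffAt_iota hz ξ t₀
    filter_upwards [Ioo_mem_nhds (show t₀ - ε < t₀ by linarith) (show t₀ < t₀ + ε by linarith)]
      with t ht hA
    exact ht₀ (hcut t₀ (h t ht hA t₀ ⟨by linarith, by linarith⟩))
  have h0 : (0 : ℝ) ∈ A := by
    have h1 : iota g z 0 = covector z := funext fun ξ => iota_zero hz ξ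
    have hs : (iota g z 0 ξ).1 ∈ (extChartAt (𝓡 n) z).source := by
      rw [h1]; exact mem_extChartAt_source (I := 𝓡 n) z
    have hC : ContDiff ℝ 1 (fun ξ => cotChart n z (iota g z 0 ξ)) := by
      simp only [h1, cotChart_covector]
      fun_prop
    refine (contMDiffAt_iff_cotChart hs).2 ⟨?_, hC.contDiffAt⟩
    have h7 : ContinuousAt (fun ξ => (cotChart n z).symm (cotChart n z (iota g z 0 ξ))) ξ :=
      ContinuousAt.comp (g := (cotChart n z).symm)
        (continuousAt_cotChart_symm (cotChart_mem_target hs)) hC.continuous.continuousAt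
    refine h7.congr (Filter.Eventually.of_forall fun η => ?_)
    refine cotChart_left_inv ?_
    rw [h1]; exact mem_extChartAt_source (I := 𝓡 n) z
  have hA : A = univ := IsClopen.eq_univ ⟨hclosed, hopen⟩ ⟨0, h0⟩
  obtain ⟨ε, hε, h⟩ := exists_contMDiffAt_iota hz ξ t
  have ht : t ∈ Ioo (t - ε) (t + ε) := ⟨by linarith, by linarith⟩
  exact h t ht (hA ▸ mem_univ t : t ∈ A) t ht

lemma continuous_iota : Continuous (fun p : ℝ × (Model n →L[ℝ] ℝ) => iota g z p.1 p.2) :=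
  continuous_iff_continuousAt.2 fun p => (contMDiffAt_iota hz p.1 p.2).continuousAt

lemma contDiffAt_iota {t : ℝ} {ξ : Model n →L[ℝ] ℝ} {x : M}
    (hx : (iota g z t ξ).1 ∈ (extChartAt (𝓡 n) x).source) :
    ContDiffAt ℝ 1 (fun p : ℝ × (Model n →L[ℝ] ℝ) => cotChart n x (iota g z p.1 p.2)) (t, ξ) :=
  ((contMDiffAt_iff_cotChart (F := fun p : ℝ × (Model n →L[ℝ] ℝ) => iota g z p.1 p.2)
    (a := (t, ξ)) hx).1 (contMDiffAt_iota hz t ξ)).2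

end Iota

end BlowDown

end

/-! ### The linearized flow, its symplectic invariants and the Gauss lemma -/

noncomputable section

namespace BlowDown

set_option synthInstance.maxHeartbeats 200000
set_option maxSynthPendingDepth 3
set_option linter.unusedSectionVars false

variable {n : ℕ} {M : Type*} [TopologicalSpace M] [ChartedSpace (Model n) M]
  [IsManifold (𝓡 n) ∞ M]

/-- The derivative of the geodesic vector field is an infinitesimal symplectic map. -/
lemma omega_fderiv_geoField (g : Metric n M) {x : M} {q : Phase n}
    (hq : q.1 ∈ (extChartAt (𝓡 n) x).target) (v w : Phase n) :
    omega (fderiv ℝ (geoField g x) q v) w + omega v (fderiv ℝ (geoField g x) q w) = 0 := by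
  have hH := (contDiffOn_hamil g x).contDiffAt ((isOpen_cotTarget x).mem_nhds hq)
  have hX : HasFDerivAt (geoField g x) (fderiv ℝ (geoField g x) q) q :=
    ((contDiffAt_geoField g hq).differentiableAt (by simp)).hasFDerivAt
  have hH' : HasFDerivAt (fderiv ℝ (hamil g x)) (fderiv ℝ (fderiv ℝ (hamil g x)) q) q :=
    ((hH.fderiv_right (m := 1) (by exact WithTop.coe_le_coe.2 le_top)).differentiableAt
      (by simp)).hasFDerivAt
  -- Differentiating Hamilton's equation shows that the linearization paired with `u` is the Hessian
  -- of the Hamiltonian. The claim is the symmetry of the Hessian.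
  have key (u v : Phase n) : omega u (fderiv ℝ (geoField g x) q v) =
      fderiv ℝ (fderiv ℝ (hamil g x)) q v u := by
    have h1 : HasFDerivAt (fun q => omega u (geoField g x q)) _ q :=
      (u.2.hasFDerivAt.comp q hX.fst).sub (hX.snd.clm_apply (hasFDerivAt_const u.1 q))
    have h2 := (hH'.clm_apply (hasFDerivAt_const u q)).congr_of_eventuallyEq
      (f₁ := fun q => omega u (geoField g x q))
      (Filter.eventually_of_mem ((isOpen_cotTarget x).mem_nhds hq)
        fun q hq => omega_geoField g hq u)
    have h3 := DFunLike.congr_fun (h1.unique h2) v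
    simpa [omega] using h3
  have hanti : ∀ v w : Phase n, omega v w = -omega w v := fun v w => by simp [omega]
  have hsymm : IsSymmSndFDerivAt ℝ (hamil g x) q := hH.isSymmSndFDerivAt (by
    rw [minSmoothness_of_isRCLikeNormedField]; exact WithTop.coe_le_coe.2 le_top)
  rw [hanti, key, key, hsymm.eq]
  ring

lemma hasDerivAt_fst' {E F : Type*} [NormedAddCommGroup E] [NormedSpace ℝ E]
    [NormedAddCommGroup F] [NormedSpace ℝ F] {c : ℝ → E × F} {v : E × F} {t : ℝ}
    (h : HasDerivAt c v t) : HasDerivAt (fun s => (c s).1) v.1 t := h.fst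

lemma hasDerivAt_snd' {E F : Type*} [NormedAddCommGroup E] [NormedSpace ℝ E]
    [NormedAddCommGroup F] [NormedSpace ℝ F] {c : ℝ → E × F} {v : E × F} {t : ℝ}
    (h : HasDerivAt c v t) : HasDerivAt (fun s => (c s).2) v.2 t := h.snd

section Jacobi

variable {g : Metric n M} {z : M}

/-- The derivative of the geodesic flow with respect to the initial covector. -/
def jac (g : Metric n M) (z x : M) (t : ℝ) (ξ : Model n →L[ℝ] ℝ) :
    (Model n →L[ℝ] ℝ) →L[ℝ] Phase n :=
  fderiv ℝ (fun ξ' => cotChart n x (iota g z t ξ')) ξ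

/-- The velocity of the geodesic flow. -/
def speed (g : Metric n M) (z x : M) (t : ℝ) (ξ : Model n →L[ℝ] ℝ) : Phase n :=
  geoField g x (cotChart n x (iota g z t ξ))

variable [T2Space M] (hz : IsCompleteAt g z) {t : ℝ} {ξ : Model n →L[ℝ] ℝ} {x : M}
include hz

lemma continuous_iota_time (ξ : Model n →L[ℝ] ℝ) : Continuous (fun t => iota g z t ξ) :=
  (continuous_iota hz).comp (by fun_prop : Continuous fun t : ℝ => (t, ξ))

lemma hasDerivAt_iota (hx : (iota g z t ξ).1 ∈ (extChartAt (𝓡 n) x).source) :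
    HasDerivAt (fun s => cotChart n x (iota g z s ξ)) (speed g z x t ξ) t :=
  ((isOrbitAt_iff (c := fun s => iota g z s ξ) hx).1 (isOrbitAt_iota hz ξ t)).2

lemma hasStrictFDerivAt_iota (hx : (iota g z t ξ).1 ∈ (extChartAt (𝓡 n) x).source) :
    HasStrictFDerivAt (fun p : ℝ × (Model n →L[ℝ] ℝ) => cotChart n x (iota g z p.1 p.2))
      ((ContinuousLinearMap.toSpanSingleton ℝ (speed g z x t ξ)).coprod (jac g z x t ξ))
      (t, ξ) := by
  have h := (contDiffAt_iota hz hx).hasStrictFDerivAt (by simp)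
  have h1 := h.hasFDerivAt
  have h2 : HasFDerivAt (fun s : ℝ => (s, ξ)) (ContinuousLinearMap.inl ℝ ℝ (Model n →L[ℝ] ℝ)) t :=
    hasFDerivAt_prodMk_left t ξ
  have h3 : HasFDerivAt (fun η => (t, η)) (ContinuousLinearMap.inr ℝ ℝ (Model n →L[ℝ] ℝ)) ξ :=
    hasFDerivAt_prodMk_right t ξ
  have h4 := (HasFDerivAt.comp t (f := fun s : ℝ => (s, ξ)) h1 h2).hasDerivAt.unique
    (hasDerivAt_iota hz hx)
  have h5 := (HasFDerivAt.comp ξ (f := fun η => (t, η)) h1 h3).fderiv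
  refine h.congr_fderiv (ContinuousLinearMap.ext fun p => ?_)
  have h6 : p = p.1 • ((1 : ℝ), (0 : Model n →L[ℝ] ℝ)) + (0, p.2) := by ext <;> simp
  conv_lhs => rw [h6, map_add, map_smul]
  exact congrArg₂ (· + ·) (congrArg (p.1 • ·) h4) (DFunLike.congr_fun h5 p.2).symm

lemma hasFDerivAt_jac (hx : (iota g z t ξ).1 ∈ (extChartAt (𝓡 n) x).source) :
    HasFDerivAt (fun ξ' => cotChart n x (iota g z t ξ')) (jac g z x t ξ) ξ := by
  have h := HasFDerivAt.comp ξ (f := fun η => (t, η)) (hasStrictFDerivAt_iota hz hx).hasFDerivAt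
    (hasFDerivAt_prodMk_right t ξ)
  rwa [ContinuousLinearMap.coprod_comp_inr] at h

lemma eventually_iota_mem (hx : (iota g z t ξ).1 ∈ (extChartAt (𝓡 n) x).source) :
    ∀ᶠ p : ℝ × (Model n →L[ℝ] ℝ) in nhds (t, ξ),
      (iota g z p.1 p.2).1 ∈ (extChartAt (𝓡 n) x).source :=
  ContinuousAt.eventually_mem (x := (t, ξ)) (continuous_iota hz).continuousAt
    ((isOpen_cotSource x).mem_nhds hx)

lemma eventually_iota_mem_time (hx : (iota g z t ξ).1 ∈ (extChartAt (𝓡 n) x).source) :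
    ∀ᶠ s in nhds t, (iota g z s ξ).1 ∈ (extChartAt (𝓡 n) x).source :=
  (continuous_iota_time hz ξ).continuousAt.eventually_mem ((isOpen_cotSource x).mem_nhds hx)

lemma continuousAt_jac (hx : (iota g z t ξ).1 ∈ (extChartAt (𝓡 n) x).source) :
    ContinuousAt (fun p : ℝ × (Model n →L[ℝ] ℝ) => jac g z x p.1 p.2) (t, ξ) := by
  have h := ((contDiffAt_iota hz hx).fderiv_right (m := 0) (by simp)).continuousAt
  have h2 := h.clm_comp (continuousAt_const
    (y := ContinuousLinearMap.inr ℝ ℝ (Model n →L[ℝ] ℝ)))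
  refine h2.congr ?_
  filter_upwards [eventually_iota_mem hz hx] with p hp
  rw [(hasStrictFDerivAt_iota hz (t := p.1) (ξ := p.2) hp).hasFDerivAt.fderiv]
  exact ContinuousLinearMap.coprod_comp_inr _ _

lemma continuousAt_cotChart_iota (hx : (iota g z t ξ).1 ∈ (extChartAt (𝓡 n) x).source) :
    ContinuousAt (fun p : ℝ × (Model n →L[ℝ] ℝ) => cotChart n x (iota g z p.1 p.2)) (t, ξ) :=
  (contDiffAt_iota hz hx).continuousAt

lemma continuousAt_speed (hx : (iota g z t ξ).1 ∈ (extChartAt (𝓡 n) x).source) :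
    ContinuousAt (fun p : ℝ × (Model n →L[ℝ] ℝ) => speed g z x p.1 p.2) (t, ξ) :=
  ContinuousAt.comp (g := geoField g x)
    (contDiffAt_geoField g (cotChart_mem_target hx)).continuousAt (continuousAt_cotChart_iota hz hx)

/-- Near `t` the derivative in the initial covector is its value at `t` followed by the linearized
local flow `A`, which is differentiable in time. This gives the variational equation although `ι` is
only known to be `C^1`, and it propagates zeros of the derivative. -/
lemma exists_jac_eq (hx : (iota g z t ξ).1 ∈ (extChartAt (𝓡 n) x).source) :
    ∃ A : ℝ → Phase n →L[ℝ] Phase n,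
      (∀ᶠ s in nhds t, jac g z x s ξ = (A s).comp (jac g z x t ξ)) ∧
      A t = ContinuousLinearMap.id ℝ _ ∧
      HasDerivAt A (fderiv ℝ (geoField g x) (cotChart n x (iota g z t ξ))) t := by
  obtain ⟨δ, hδ, Φ, Y, H1, H2⟩ := exists_flowBox g hx
  set q := cotChart n x (iota g z t ξ)
  have hq : q ∈ Metric.ball q δ := Metric.mem_ball_self hδ
  have h0 : (0 : ℝ) ∈ Ioo (-δ) δ := ⟨by linarith, hδ⟩
  refine ⟨fun s => Y (s - t) q, ?_, by simp only [sub_self]; exact (H1 q hq).1.2, ?_⟩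
  · filter_upwards [Ioo_mem_nhds (show t - δ < t by linarith) (show t < t + δ by linarith)] with s hs
    have hst : s - t ∈ Ioo (-δ) δ := ⟨by linarith [hs.1], by linarith [hs.2]⟩
    have h1 := HasFDerivAt.comp (g := Φ (s - t)) ξ ((H1 q hq).2 _ hst).2.2.1 (hasFDerivAt_jac hz hx)
    refine HasFDerivAt.fderiv (h1.congr_of_eventuallyEq ?_)
    have hc : ContinuousAt (fun ξ' => cotChart n x (iota g z t ξ')) ξ :=
      (hasFDerivAt_jac hz hx).continuousAt
    have hi : ContinuousAt (fun ξ' => iota g z t ξ') ξ :=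
      ((continuous_iota hz).comp (by fun_prop : Continuous fun ξ' => (t, ξ'))).continuousAt
    filter_upwards [hi.eventually_mem ((isOpen_cotSource x).mem_nhds hx),
      hc.eventually_mem (Metric.ball_mem_nhds _ hδ)] with ξ' h2 h3
    have := (H2 _ (isGeodesicOrbit_iota hz ξ') t h2 h3 _ hst).2
    rwa [add_sub_cancel] at this
  · have h1 := ((H1 q hq).2 0 h0).2.1
    rw [(H1 q hq).1.1, (H1 q hq).1.2, ContinuousLinearMap.comp_id] at h1
    have h2 : HasDerivAt (fun s : ℝ => s - t) 1 t := (hasDerivAt_id t).sub_const t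
    have h3 := HasDerivAt.scomp (g₁ := (Y · q)) (h := fun s => s - t) t
      (by rw [sub_self]; exact h1) h2
    rwa [one_smul] at h3

/-- The variational equation. -/
lemma hasDerivAt_jac (hx : (iota g z t ξ).1 ∈ (extChartAt (𝓡 n) x).source) :
    HasDerivAt (fun s => jac g z x s ξ)
      ((fderiv ℝ (geoField g x) (cotChart n x (iota g z t ξ))).comp (jac g z x t ξ)) t := by
  obtain ⟨A, h1, h2, h3⟩ := exists_jac_eq hz hx
  have h4 := h3.clm_comp (hasDerivAt_const t (jac g z x t ξ))
  simp only [ContinuousLinearMap.comp_zero, add_zero] at h4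
  exact h4.congr_of_eventuallyEq h1

lemma hasDerivAt_speed (hx : (iota g z t ξ).1 ∈ (extChartAt (𝓡 n) x).source) :
    HasDerivAt (fun s => speed g z x s ξ)
      (fderiv ℝ (geoField g x) (cotChart n x (iota g z t ξ)) (speed g z x t ξ)) t :=
  ((contDiffAt_geoField g (cotChart_mem_target hx)).differentiableAt
    (by simp)).hasFDerivAt.comp_hasDerivAt t (hasDerivAt_iota hz hx)

lemma jac_change {y : M} (hx : (iota g z t ξ).1 ∈ (extChartAt (𝓡 n) x).source)
    (hy : (iota g z t ξ).1 ∈ (extChartAt (𝓡 n) y).source) :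
    jac g z y t ξ = (fderiv ℝ (cotTrans x y) (cotChart n x (iota g z t ξ))).comp (jac g z x t ξ) := by
  have hi : ContinuousAt (fun ξ' => iota g z t ξ') ξ :=
    ((continuous_iota hz).comp (by fun_prop : Continuous fun ξ' => (t, ξ'))).continuousAt
  exact (hasFDerivAt_cotChart_change hi hx hy (hasFDerivAt_jac hz hx)).fderiv

lemma speed_change {y : M} (hx : (iota g z t ξ).1 ∈ (extChartAt (𝓡 n) x).source)
    (hy : (iota g z t ξ).1 ∈ (extChartAt (𝓡 n) y).source) :
    speed g z y t ξ = fderiv ℝ (cotTrans x y) (cotChart n x (iota g z t ξ)) (speed g z x t ξ) := by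
  rw [speed, speed, ← geoField_cotTrans g (cotChart_mem_overlap hx hy), cotTrans_cotChart hx]

lemma jac_zero (ξ η : Model n →L[ℝ] ℝ) : jac g z z 0 ξ η = (0, η) := by
  have h1 : HasFDerivAt (fun ξ' => cotChart n z (iota g z 0 ξ'))
      (ContinuousLinearMap.inr ℝ (Model n) (Model n →L[ℝ] ℝ)) ξ := by
    simp only [iota_zero hz, cotChart_covector]
    exact hasFDerivAt_prodMk_right _ _
  rw [jac, h1.fderiv]
  rfl

/-- A solution of a linear equation that vanishes at one time vanishes at all: its zero set is open
by `exists_jac_eq` and closed by continuity. At time `0` the solution is `(0, η)`. -/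
lemma jac_eq_zero_iff (hx : (iota g z t ξ).1 ∈ (extChartAt (𝓡 n) x).source)
    {η : Model n →L[ℝ] ℝ} : jac g z x t ξ η = 0 ↔ η = 0 := by
  refine ⟨fun h => ?_, fun h => by rw [h, map_zero]⟩
  have hs : ∀ t, (iota g z t ξ).1 ∈ (extChartAt (𝓡 n) (iota g z t ξ).1).source :=
    fun t => mem_extChartAt_source _
  have hch : ∀ {t : ℝ} {x y : M}, (iota g z t ξ).1 ∈ (extChartAt (𝓡 n) x).source →
      (iota g z t ξ).1 ∈ (extChartAt (𝓡 n) y).source → jac g z x t ξ η = 0 →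
      jac g z y t ξ η = 0 := by
    intro t x y hx hy h
    rw [jac_change hz hx hy, ContinuousLinearMap.comp_apply, h, map_zero]
  set A : Set ℝ := {t | jac g z (iota g z t ξ).1 t ξ η = 0}
  have hopen : IsOpen A := by
    refine isOpen_iff_mem_nhds.2 fun t₀ ht₀ => ?_
    obtain ⟨B, h1, -, -⟩ := exists_jac_eq hz (hs t₀)
    filter_upwards [h1, eventually_iota_mem_time hz (hs t₀)] with s h2 h3
    refine hch h3 (hs s) ?_
    rw [h2, ContinuousLinearMap.comp_apply]
    exact (congrArg (B s) ht₀).trans (map_zero _)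
  have hclosed : IsClosed A := by
    refine isOpen_compl_iff.1 (isOpen_iff_mem_nhds.2 fun t₀ ht₀ => ?_)
    have hc : ContinuousAt (fun s => jac g z (iota g z t₀ ξ).1 s ξ η) t₀ :=
      ((hasDerivAt_jac hz (hs t₀)).clm_apply (hasDerivAt_const t₀ η)).continuousAt
    filter_upwards [hc.eventually_ne ht₀, eventually_iota_mem_time hz (hs t₀)] with s h2 h3 h4
    exact h2 (hch (hs s) h3 h4)
  have ht : t ∈ A := hch hx (hs t) h
  have hA : A = univ := IsClopen.eq_univ ⟨hclosed, hopen⟩ ⟨t, ht⟩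
  have h0 : (0 : ℝ) ∈ A := hA ▸ mem_univ _
  have h1 : jac g z z 0 ξ η = 0 :=
    hch (hs 0) (by rw [iota_zero hz]; exact mem_extChartAt_source (I := 𝓡 n) z) h0
  rw [jac_zero hz] at h1
  exact congrArg Prod.snd h1

/-- The symplectic products of the solutions of the variational equation are constant. -/
lemma omega_const {v w : M → ℝ → Phase n}
    (hv : ∀ t x, (iota g z t ξ).1 ∈ (extChartAt (𝓡 n) x).source → HasDerivAt (v x)
      (fderiv ℝ (geoField g x) (cotChart n x (iota g z t ξ)) (v x t)) t)
    (hw : ∀ t x, (iota g z t ξ).1 ∈ (extChartAt (𝓡 n) x).source → HasDerivAt (w x)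
      (fderiv ℝ (geoField g x) (cotChart n x (iota g z t ξ)) (w x t)) t)
    (hv' : ∀ t x y, (iota g z t ξ).1 ∈ (extChartAt (𝓡 n) x).source →
      (iota g z t ξ).1 ∈ (extChartAt (𝓡 n) y).source →
      v y t = fderiv ℝ (cotTrans x y) (cotChart n x (iota g z t ξ)) (v x t))
    (hw' : ∀ t x y, (iota g z t ξ).1 ∈ (extChartAt (𝓡 n) x).source →
      (iota g z t ξ).1 ∈ (extChartAt (𝓡 n) y).source →
      w y t = fderiv ℝ (cotTrans x y) (cotChart n x (iota g z t ξ)) (w x t))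
    (hx : (iota g z t ξ).1 ∈ (extChartAt (𝓡 n) x).source) :
    omega (v x t) (w x t) = omega (v z 0) (w z 0) := by
  have hs : ∀ t, (iota g z t ξ).1 ∈ (extChartAt (𝓡 n) (iota g z t ξ).1).source :=
    fun t => mem_extChartAt_source _
  have hch : ∀ {t : ℝ} {x y : M}, (iota g z t ξ).1 ∈ (extChartAt (𝓡 n) x).source →
      (iota g z t ξ).1 ∈ (extChartAt (𝓡 n) y).source →
      omega (v y t) (w y t) = omega (v x t) (w x t) := by
    intro t x y hx hy
    rw [hv' t x y hx hy, hw' t x y hx hy, omega_cotTrans (cotChart_mem_overlap hx hy)]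
  set φ : ℝ → ℝ := fun t => omega (v (iota g z t ξ).1 t) (w (iota g z t ξ).1 t)
  have hd : ∀ t, HasDerivAt φ 0 t := by
    intro t
    have h1 := hv t _ (hs t)
    have h2 := hw t _ (hs t)
    have h3 : HasDerivAt (fun s => omega (v (iota g z t ξ).1 s) (w (iota g z t ξ).1 s)) _ t :=
      ((hasDerivAt_snd' h1).clm_apply (hasDerivAt_fst' h2)).sub
        ((hasDerivAt_snd' h2).clm_apply (hasDerivAt_fst' h1))
    have h4 := omega_fderiv_geoField g (cotChart_mem_target (hs t)) (v (iota g z t ξ).1 t)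
      (w (iota g z t ξ).1 t)
    refine (h3.congr_of_eventuallyEq ?_).congr_deriv ?_
    · filter_upwards [eventually_iota_mem_time hz (hs t)] with s h5
      exact hch h5 (hs s)
    · simp only [omega] at h4
      linarith
  have h1 := is_const_of_deriv_eq_zero (fun t => (hd t).differentiableAt)
    (fun t => (hd t).deriv) t 0
  have h0 : (iota g z 0 ξ).1 ∈ (extChartAt (𝓡 n) z).source := by
    rw [iota_zero hz]; exact mem_extChartAt_source (I := 𝓡 n) z
  rw [← hch hx (hs t), ← hch h0 (hs 0)]
  exact h1

/-- The product is conserved, and at time `0` both vectors lie in the fibre over `z`, which is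
Lagrangian. -/
lemma omega_jac_jac (hx : (iota g z t ξ).1 ∈ (extChartAt (𝓡 n) x).source)
    (η₁ η₂ : Model n →L[ℝ] ℝ) : omega (jac g z x t ξ η₁) (jac g z x t ξ η₂) = 0 := by
  have hd (η : Model n →L[ℝ] ℝ) : ∀ t x, (iota g z t ξ).1 ∈ (extChartAt (𝓡 n) x).source →
      HasDerivAt (fun t => jac g z x t ξ η)
      (fderiv ℝ (geoField g x) (cotChart n x (iota g z t ξ)) (jac g z x t ξ η)) t := by
    intro t x hx
    simpa using (hasDerivAt_jac hz hx).clm_apply (hasDerivAt_const t η)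
  have hc (η : Model n →L[ℝ] ℝ) : ∀ t x y, (iota g z t ξ).1 ∈ (extChartAt (𝓡 n) x).source →
      (iota g z t ξ).1 ∈ (extChartAt (𝓡 n) y).source → jac g z y t ξ η =
      fderiv ℝ (cotTrans x y) (cotChart n x (iota g z t ξ)) (jac g z x t ξ η) := by
    intro t x y hx hy
    rw [jac_change hz hx hy, ContinuousLinearMap.comp_apply]
  rw [omega_const hz (v := fun x t => jac g z x t ξ η₁) (w := fun x t => jac g z x t ξ η₂)
    (hd η₁) (hd η₂) (hc η₁) (hc η₂) hx, jac_zero hz, jac_zero hz]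
  simp [omega]

/-- Pairing with the Hamiltonian field differentiates the energy, and by conservation the energy is
a function of the initial covector alone. -/
lemma omega_jac_speed (hx : (iota g z t ξ).1 ∈ (extChartAt (𝓡 n) x).source)
    (η : Model n →L[ℝ] ℝ) : omega (jac g z x t ξ η) (speed g z x t ξ) = η (sharpAt g z ξ) := by
  have h1 := (hasFDerivAt_hamil g (cotChart_mem_target hx)).comp ξ (hasFDerivAt_jac hz hx)
  have h2 : HasFDerivAt (fun ξ : Model n →L[ℝ] ℝ => ξ (sharpAt g z ξ) / 2) _ ξ :=
    ((hasFDerivAt_id ξ).clm_apply (sharpAt g z).hasFDerivAt).mul_const (2 : ℝ)⁻¹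
  have hi : ContinuousAt (fun ξ' => iota g z t ξ') ξ :=
    ((continuous_iota hz).comp (by fun_prop : Continuous fun ξ' => (t, ξ'))).continuousAt
  have h3 := h1.congr_of_eventuallyEq (f₁ := fun ξ : Model n →L[ℝ] ℝ => ξ (sharpAt g z ξ) / 2) (by
    filter_upwards [hi.eventually_mem ((isOpen_cotSource x).mem_nhds hx)] with η hη
    rw [← energy_iota hz t η, energy_eq g hη]
    rfl)
  have h4 := DFunLike.congr_fun (h3.unique h2) η
  rw [speed, omega_geoField g (cotChart_mem_target hx)]
  refine h4.trans ?_
  have := sharpAt_symm g z ξ η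
  simp only [id, smul_apply, add_apply,
    ContinuousLinearMap.comp_apply, ContinuousLinearMap.flip_apply, smul_eq_mul,
    ContinuousLinearMap.id_apply, this]
  ring

/-- The derivative of the flow in the radial direction. -/
lemma jac_radial (hx : (iota g z t ξ).1 ∈ (extChartAt (𝓡 n) x).source) :
    jac g z x t ξ ξ = (0, (cotChart n x (iota g z t ξ)).2) + t • speed g z x t ξ := by
  -- The identity `ι(t, l ξ) = l · ι(l t, ξ)` is differentiated at `l = 1`: the factor in the fibre
  -- gives the radial vertical vector, the rescaled time gives `t` times the velocity.
  have h1 : HasDerivAt (fun l : ℝ => cotChart n x (iota g z t (l • ξ))) (jac g z x t ξ ξ) 1 := by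
    have := (hasFDerivAt_jac hz (ξ := (1 : ℝ) • ξ) (by rwa [one_smul])).comp_hasDerivAt (1 : ℝ)
      ((hasDerivAt_id (1 : ℝ)).smul_const ξ)
    rw [one_smul] at this
    simpa only [one_smul, Function.comp_def, id] using this
  have h2 : HasDerivAt (fun l : ℝ => cotChart n x (iota g z (l * t) ξ)) (t • speed g z x t ξ) 1 :=
    HasDerivAt.scomp (g₁ := fun s => cotChart n x (iota g z s ξ)) (h := fun l => l * t) (1 : ℝ)
      (by rw [one_mul]; exact hasDerivAt_iota hz hx)
      (by simpa using (hasDerivAt_id (1 : ℝ)).mul_const t)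
  have h3 : HasDerivAt (fun l : ℝ => ((cotChart n x (iota g z (l * t) ξ)).1,
      l • (cotChart n x (iota g z (l * t) ξ)).2))
      ((t • speed g z x t ξ).1, (1 : ℝ) • (t • speed g z x t ξ).2 +
        (1 : ℝ) • (cotChart n x (iota g z (1 * t) ξ)).2) 1 :=
    (hasDerivAt_fst' h2).prodMk ((hasDerivAt_id (1 : ℝ)).smul (hasDerivAt_snd' h2))
  have hcont : ContinuousAt (fun l : ℝ => iota g z (l * t) ξ) 1 :=
    ((continuous_iota_time hz ξ).comp (by fun_prop : Continuous fun l : ℝ => l * t)).continuousAt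
  have h4 := h3.congr_of_eventuallyEq (f₁ := fun l : ℝ => cotChart n x (iota g z t (l • ξ))) (by
    filter_upwards [hcont.eventually_mem ((isOpen_cotSource x).mem_nhds (by
      simpa only [one_mul, mem_ofPred_eq] using hx))] with l hl
    rw [iota_smul hz]
    exact cotChart_fibreScale l hl)
  rw [h1.unique h4]
  refine Prod.ext ?_ ?_
  · simp
  · simp [add_comm]

/-- The Gauss lemma. -/
lemma action_jac (hx : (iota g z t ξ).1 ∈ (extChartAt (𝓡 n) x).source)
    (η : Model n →L[ℝ] ℝ) :
    (cotChart n x (iota g z t ξ)).2 (jac g z x t ξ η).1 = t * η (sharpAt g z ξ) := by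
  have h1 := omega_jac_jac hz hx η ξ
  have h2 := omega_jac_speed hz hx η
  -- In the vanishing product of the `η` and `ξ` variations, the radial vertical part contributes
  -- minus the action and the rest is `t` times the product with the velocity.
  rw [jac_radial hz hx] at h1
  simp only [omega, Prod.fst_add, Prod.snd_add, Prod.smul_fst, Prod.smul_snd, zero_add,
    add_apply, smul_apply, map_smul, smul_eq_mul] at h1 h2
  rw [← h2]
  linarith

lemma action_speed (hx : (iota g z t ξ).1 ∈ (extChartAt (𝓡 n) x).source) :
    (cotChart n x (iota g z t ξ)).2 (speed g z x t ξ).1 = ξ (sharpAt g z ξ) := by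
  have h := energy_iota hz t ξ
  rw [energy_eq g hx, hamil] at h
  exact (div_left_inj' (two_ne_zero)).1 h

end Jacobi

end BlowDown

end

/-! ### Returns to `z` and lifting of curves in the blow-down Lagrangian -/

noncomputable section

namespace BlowDown

set_option synthInstance.maxHeartbeats 200000
set_option maxSynthPendingDepth 3
set_option linter.unusedSectionVars false

variable {n : ℕ} {M : Type*} [TopologicalSpace M] [ChartedSpace (Model n) M]
  [IsManifold (𝓡 n) ∞ M]

section Compact

variable (g : Metric n M) (z : M)

lemma continuous_sharpAt_self : Continuous fun ξ : Model n →L[ℝ] ℝ => ξ (sharpAt g z ξ) := by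
  fun_prop

lemma isCompact_unitCosphere : IsCompact (unitCosphere g z) := by
  have hclosed : IsClosed (unitCosphere g z) := by
    have : unitCosphere g z = {ξ | ξ (sharpAt g z ξ) = 1} := by
      ext ξ; exact mem_unitCosphere
    rw [this]
    exact isClosed_eq (continuous_sharpAt_self g z) continuous_const
  -- In dimension zero the norm sphere is empty. Otherwise the minimum of the dual quadratic form on
  -- it bounds the norm of unit covectors.
  rcases (Metric.sphere (0 : Model n →L[ℝ] ℝ) 1).eq_empty_or_nonempty with he | hne
  · refine Metric.isCompact_of_isClosed_isBounded hclosed ?_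
    have : unitCosphere g z ⊆ {0} := by
      intro ξ _
      by_contra h
      have h1 : ‖ξ‖⁻¹ • ξ ∈ Metric.sphere (0 : Model n →L[ℝ] ℝ) 1 := by
        rw [mem_sphere_zero_iff_norm, norm_smul, norm_inv, norm_norm,
          inv_mul_cancel₀ (norm_ne_zero_iff.2 h)]
      rw [he] at h1
      exact h1
    exact Bornology.isBounded_singleton.subset this
  · obtain ⟨ν, hν, hmin⟩ := (isCompact_sphere (0 : Model n →L[ℝ] ℝ) 1).exists_isMinOn hne
      (continuous_sharpAt_self g z).continuousOn
    have hν0 : ν ≠ 0 := by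
      rintro rfl
      simp at hν
    have hm := sharpAt_pos g z hν0
    refine Metric.isCompact_of_isClosed_isBounded hclosed ?_
    refine (Metric.isBounded_iff_subset_closedBall 0).2 ⟨Real.sqrt (1 / ν (sharpAt g z ν)), ?_⟩
    intro ξ hξ
    rw [mem_closedBall_zero_iff]
    rw [mem_unitCosphere] at hξ
    have hξ0 : ξ ≠ 0 := by
      rintro rfl
      simp at hξ
    have hn : 0 < ‖ξ‖ := norm_pos_iff.2 hξ0
    have h1 : ‖ξ‖⁻¹ • ξ ∈ Metric.sphere (0 : Model n →L[ℝ] ℝ) 1 := by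
      rw [mem_sphere_zero_iff_norm, norm_smul, norm_inv, norm_norm, inv_mul_cancel₀ hn.ne']
    have h2 := isMinOn_iff.1 hmin _ h1
    simp only [map_smul, smul_apply, smul_eq_mul, hξ, mul_one] at h2
    refine Real.le_sqrt_of_sq_le ?_
    rw [le_div_iff₀ hm]
    have h3 : ‖ξ‖⁻¹ * ‖ξ‖⁻¹ * ‖ξ‖ ^ 2 = 1 := by field_simp
    calc ‖ξ‖ ^ 2 * ν (sharpAt g z ν) ≤ ‖ξ‖ ^ 2 * (‖ξ‖⁻¹ * ‖ξ‖⁻¹) := by gcongr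
      _ = 1 := by rw [mul_comm]; exact h3

end Compact

section Returns

variable {g : Metric n M} {z : M} {T : ℝ} (hb : IsBlowDownPoint g z T)
include hb

lemma IsBlowDownPoint.isCompleteAt : IsCompleteAt g z := isCompleteAt_of_unitCosphere hb.complete

variable [T2Space M]

/-- Conservation of energy makes the returning covector a unit one; uniqueness of orbits does the
rest. -/
lemma exists_shift_of_proj_eq {a : ℝ} {ξ : Model n →L[ℝ] ℝ} (hξ : ξ ∈ unitCosphere g z)
    (h : (iota g z a ξ).1 = z) :
    ∃ η ∈ unitCosphere g z, ∀ t, iota g z (t + a) ξ = iota g z t η := by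
  have hz := hb.isCompleteAt
  obtain ⟨η, hη⟩ : ∃ η, iota g z a ξ = covector z η := by
    generalize iota g z a ξ = p at h
    obtain ⟨y, η⟩ := p
    subst h
    exact ⟨η, rfl⟩
  refine ⟨η, ?_, fun t => ?_⟩
  · have h1 := energy_iota hz a ξ
    rw [hη, energy_covector, mem_unitCosphere.1 hξ] at h1
    rw [mem_unitCosphere]
    linarith
  · exact eq_iota hz ((isGeodesicOrbit_iota hz ξ).shift a) (by rw [zero_add, hη]) t

/-- Negative times are reached through the reversal `ι(t, -ξ) = -ι(-t, ξ)`, the case `l = -1` of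
homogeneity. -/
lemma exists_shift (k : ℤ) {ξ : Model n →L[ℝ] ℝ} (hξ : ξ ∈ unitCosphere g z) :
    ∃ η ∈ unitCosphere g z, ∀ t, iota g z (t + k * T) ξ = iota g z t η := by
  have hz := hb.isCompleteAt
  have hnat : ∀ (k : ℕ), ∀ ξ ∈ unitCosphere g z,
      ∃ η ∈ unitCosphere g z, ∀ t, iota g z (t + k * T) ξ = iota g z t η := by
    intro k
    induction k with
    | zero => exact fun ξ hξ => ⟨ξ, hξ, fun t => by simp⟩
    | succ k ih =>
      intro ξ hξ
      obtain ⟨η, hη, h⟩ := exists_shift_of_proj_eq hb hξ (hb.returns ξ hξ)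
      obtain ⟨ζ, hζ, h'⟩ := ih η hη
      refine ⟨ζ, hζ, fun t => ?_⟩
      rw [← h', ← h]
      congr 1
      push_cast
      ring
  obtain ⟨m, rfl | rfl⟩ := k.eq_nat_or_neg
  · exact_mod_cast hnat m ξ hξ
  · refine exists_shift_of_proj_eq hb hξ ?_
    obtain ⟨η, hη, h⟩ := hnat m (-ξ) (neg_mem_unitCosphere g z hξ)
    have h1 := iota_smul hz (-1) (m * T) ξ
    have h2 := h 0
    rw [zero_add, iota_zero hz] at h2
    rw [neg_one_smul ℝ ξ, h2] at h1
    have h3 : z = (iota g z (-1 * (m * T)) ξ).1 := congrArg TotalSpace.proj h1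
    have h4 : ((-(m : ℤ) : ℤ) : ℝ) * T = -1 * (m * T) := by push_cast; ring
    rw [h4]
    exact h3.symm

/-- After a shift by whole periods the remainder lies in `[0, T)`, where only `0` is compatible with
`T` being the first return time. -/
lemma exists_int_of_proj_eq {a : ℝ} {ξ : Model n →L[ℝ] ℝ} (hξ : ξ ∈ unitCosphere g z)
    (h : (iota g z a ξ).1 = z) : ∃ k : ℤ, a = k * T := by
  have hT := hb.time_pos
  obtain ⟨η, hη, hs⟩ := exists_shift hb ⌊a / T⌋ hξ
  refine ⟨⌊a / T⌋, ?_⟩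
  set r := a - ⌊a / T⌋ * T
  have h0 : 0 ≤ r := by
    have := Int.floor_le (a / T)
    rw [le_div_iff₀ hT] at this
    linarith
  have h1 : r < T := by
    have := Int.lt_floor_add_one (a / T)
    rw [div_lt_iff₀ hT] at this
    linarith
  have h2 := hs r
  rw [sub_add_cancel] at h2
  rcases h0.eq_or_lt with h3 | h3
  · linarith
  · refine absurd ?_ (hb.first η hη r ⟨h3, h1⟩)
    rw [← h2, h]

lemma exists_int_of_iota_eq {t₁ t₂ : ℝ} {ξ₁ ξ₂ : Model n →L[ℝ] ℝ} (hξ : ξ₁ ∈ unitCosphere g z)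
    (h : iota g z t₁ ξ₁ = iota g z t₂ ξ₂) : ∃ k : ℤ, t₁ = t₂ + k * T := by
  have hz := hb.isCompleteAt
  have h1 := ((isGeodesicOrbit_iota hz ξ₁).shift (t₁ - t₂)).eq (isGeodesicOrbit_iota hz ξ₂)
    (t := t₂) (by simpa using h)
  have h2 := congrFun h1 0
  simp only [zero_add, iota_zero hz] at h2
  obtain ⟨k, hk⟩ := exists_int_of_proj_eq hb hξ (a := t₁ - t₂) (by rw [h2]; rfl)
  exact ⟨k, by linarith⟩

/-- Freeing the time from `[0, T]` lets lifted curves run across the multiples of `T`. -/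
lemma mem_blowDownLagrangian {p : Cotangent n M} : p ∈ blowDownLagrangian g z T ↔
    ∃ t, ∃ ξ ∈ unitCosphere g z, iota g z t ξ = p := by
  have hT := hb.time_pos
  refine ⟨fun ⟨t, _, ξ, hξ, h⟩ => ⟨t, ξ, hξ, h⟩, fun ⟨t, ξ, hξ, h⟩ => ?_⟩
  obtain ⟨η, hη, hs⟩ := exists_shift hb ⌊t / T⌋ hξ
  refine ⟨t - ⌊t / T⌋ * T, ⟨?_, ?_⟩, η, hη, ?_⟩
  · have := Int.floor_le (t / T)
    rw [le_div_iff₀ hT] at this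
    linarith
  · have := Int.lt_floor_add_one (t / T)
    rw [div_lt_iff₀ hT] at this
    linarith
  · rw [← hs, sub_add_cancel, h]

/-- The map `ι_z` is open onto the blow-down Lagrangian. -/
lemma exists_nhds_subset_image {t : ℝ} {ξ : Model n →L[ℝ] ℝ}
    {U : Set (ℝ × (Model n →L[ℝ] ℝ))} (hU : U ∈ nhds (t, ξ)) :
    ∀ᶠ p in nhds (iota g z t ξ), p ∈ blowDownLagrangian g z T →
      ∃ w ∈ U, w.2 ∈ unitCosphere g z ∧ iota g z w.1 w.2 = p := by
  have hz := hb.isCompleteAt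
  have hT := hb.time_pos
  obtain ⟨V, hVU, hV, hmem⟩ := mem_nhds_iff.1 hU
  -- Every point of the Lagrangian has a preimage in this compact window of length `T`. The image of
  -- the window minus `V` is closed and misses the given point, since two preimages differ by a
  -- multiple of `T` and half a period leaves only the multiple `0`. Near the point, preimages in
  -- the window thus lie in `V`.
  set C : Set (ℝ × (Model n →L[ℝ] ℝ)) := Icc (t - T / 2) (t + T / 2) ×ˢ unitCosphere g z
  have hC : IsCompact C := isCompact_Icc.prod (isCompact_unitCosphere g z)
  have hK : IsClosed ((fun p : ℝ × (Model n →L[ℝ] ℝ) => iota g z p.1 p.2) '' (C \ V)) :=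
    ((hC.diff hV).image (continuous_iota hz)).isClosed
  have hnot : iota g z t ξ ∉ (fun p : ℝ × (Model n →L[ℝ] ℝ) => iota g z p.1 p.2) '' (C \ V) := by
    rintro ⟨⟨t', ξ'⟩, ⟨⟨ht', hξ'⟩, hnV⟩, h⟩
    obtain ⟨k, hk⟩ := exists_int_of_iota_eq hb hξ' h
    have h1 : |(k : ℝ)| * T < 1 * T := by
      rw [← abs_of_pos hT, ← abs_mul, abs_of_pos hT, abs_lt]
      simp only [mem_Icc] at ht'
      constructor <;> linarith [ht'.1, ht'.2]
    have h2 : |k| < 1 := by exact_mod_cast lt_of_mul_lt_mul_right h1 hT.le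
    rw [Int.abs_lt_one_iff] at h2
    simp only [h2, Int.cast_zero, zero_mul, add_zero] at hk
    subst hk
    have h5 : ξ' = ξ := iota_inj hz h
    exact hnV (by rwa [h5])
  filter_upwards [hK.isOpen_compl.mem_nhds hnot] with p hp hpΛ
  obtain ⟨t', ξ', hξ', rfl⟩ := (mem_blowDownLagrangian hb).1 hpΛ
  set k := round ((t' - t) / T)
  obtain ⟨η, hη, hs⟩ := exists_shift hb k hξ'
  have h1 : |(t' - t) / T - k| ≤ 1 / 2 := abs_sub_round _
  have h2 : |t' - t - k * T| ≤ T / 2 := by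
    have : t' - t - k * T = ((t' - t) / T - k) * T := by field_simp
    rw [this, abs_mul, abs_of_pos hT]
    nlinarith
  rw [abs_le] at h2
  have h3 := hs (t' - k * T)
  rw [sub_add_cancel] at h3
  refine ⟨(t' - k * T, η), hVU ?_, hη, h3.symm⟩
  by_contra hnV
  exact hp ⟨(t' - k * T, η), ⟨⟨⟨by linarith [h2.1], by linarith [h2.2]⟩, hη⟩, hnV⟩, h3.symm⟩

lemma ne_zero_of_mem_unitCosphere {ξ : Model n →L[ℝ] ℝ} (hξ : ξ ∈ unitCosphere g z) : ξ ≠ 0 := by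
  rintro rfl
  rw [mem_unitCosphere] at hξ
  simp at hξ

/-- Continuous curves in the blow-down Lagrangian lift to `ℝ × S^*_z M`. -/
lemma exists_lift {γ : ℝ → Cotangent n M} (hγ : Continuous γ)
    (hmem : ∀ s, γ s ∈ blowDownLagrangian g z T) {s₀ t₀ : ℝ} {ξ₀ : Model n →L[ℝ] ℝ}
    (hξ₀ : ξ₀ ∈ unitCosphere g z) (h₀ : iota g z t₀ ξ₀ = γ s₀) :
    ∃ (t : ℝ → ℝ) (ξ : ℝ → Model n →L[ℝ] ℝ), Continuous t ∧ Continuous ξ ∧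
      (∀ s, ξ s ∈ unitCosphere g z) ∧ (∀ s, iota g z (t s) (ξ s) = γ s) ∧ t s₀ = t₀ ∧ ξ s₀ = ξ₀ := by
  have hz := hb.isCompleteAt
  have hT := hb.time_pos
  choose t' ξ' hξ' hι using fun s => (mem_blowDownLagrangian hb).1 (hmem s)
  -- The chosen preimages need not vary continuously, but their times modulo `T` are determined by
  -- the curve, and openness of `ι` makes them continuous.
  have hτ : Continuous fun s => (t' s : AddCircle T) := by
    refine continuous_iff_continuousAt.2 fun s => ?_
    refine tendsto_nhds.2 fun W hW hWs => ?_
    have hU : {w : ℝ × (Model n →L[ℝ] ℝ) | ((w.1 : ℝ) : AddCircle T) ∈ W} ∈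
        nhds (t' s, ξ' s) :=
      (hW.preimage ((AddCircle.continuous_mk' T).comp continuous_fst)).mem_nhds hWs
    have h1 := exists_nhds_subset_image hb hU
    rw [hι s] at h1
    filter_upwards [hγ.continuousAt.eventually h1] with r hr
    obtain ⟨w, hw, hwS, hwι⟩ := hr (hmem r)
    obtain ⟨k, hk⟩ := exists_int_of_iota_eq hb (hξ' r) ((hι r).trans hwι.symm)
    have : (t' r : AddCircle T) = (w.1 : AddCircle T) := by
      rw [hk]
      rw [QuotientAddGroup.eq]
      exact ⟨-k, by simp⟩
    change (t' r : AddCircle T) ∈ W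
    rw [this]
    exact hw
  have h₀' : ((t₀ : ℝ) : AddCircle T) = t' s₀ := by
    obtain ⟨k, hk⟩ := exists_int_of_iota_eq hb hξ₀ (h₀.trans (hι s₀).symm)
    rw [hk, QuotientAddGroup.eq]
    exact ⟨-k, by simp⟩
  -- The time is lifted through the covering of the circle. Once it is fixed, the covector is unique
  -- by `iota_inj`, and its continuity again comes from openness of `ι`.
  obtain ⟨t, ⟨ht0, htτ⟩, -⟩ := (AddCircle.isCoveringMap_coe T).existsUnique_continuousMap_lifts
    ⟨fun s => (t' s : AddCircle T), hτ⟩ s₀ t₀ h₀'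
  have hex : ∀ s, ∃ η ∈ unitCosphere g z, iota g z (t s) η = γ s := by
    intro s
    have h1 : ((t s : ℝ) : AddCircle T) = t' s := congrFun htτ s
    obtain ⟨k, hk⟩ := (QuotientAddGroup.eq.1 h1 : _ ∈ AddSubgroup.zmultiples T)
    obtain ⟨η, hη, h2⟩ := exists_shift hb k (hξ' s)
    refine ⟨η, hη, ?_⟩
    have h3 : t s + k * T = t' s := by
      simp only [zsmul_eq_mul] at hk
      linarith
    rw [← h2, h3, hι]
  choose ξ hξ hιξ using hex
  refine ⟨t, ξ, t.continuous, ?_, hξ, hιξ, ht0, iota_inj hz (t := t₀) ?_⟩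
  · refine continuous_iff_continuousAt.2 fun s => ?_
    refine tendsto_nhds.2 fun W hW hWs => ?_
    have hU : Ioo (t s - T / 2) (t s + T / 2) ×ˢ W ∈ nhds (t s, ξ s) :=
      prod_mem_nhds (Ioo_mem_nhds (by linarith) (by linarith)) (hW.mem_nhds hWs)
    have h1 := exists_nhds_subset_image hb hU
    rw [hιξ s] at h1
    filter_upwards [hγ.continuousAt.eventually h1, t.continuous.continuousAt.eventually_mem
      (Ioo_mem_nhds (show t s - T / 2 < t s by linarith) (show t s < t s + T / 2 by linarith))]
      with r hr hr'
    obtain ⟨⟨a, η⟩, ⟨ha, hη⟩, hwS, hwι⟩ := hr (hmem r)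
    obtain ⟨k, hk⟩ := exists_int_of_iota_eq hb (hξ r) ((hιξ r).trans hwι.symm)
    have h1 : |(k : ℝ)| * T < 1 * T := by
      rw [← abs_of_pos hT, ← abs_mul, abs_of_pos hT, abs_lt]
      simp only [mem_Ioo] at ha hr' hk
      constructor <;> linarith [ha.1, ha.2, hr'.1, hr'.2]
    have h2 : |k| < 1 := by exact_mod_cast lt_of_mul_lt_mul_right h1 hT.le
    rw [Int.abs_lt_one_iff] at h2
    simp only [h2, Int.cast_zero, zero_mul, add_zero] at hk
    have h3 : ξ r = η := iota_inj hz (t := t r) (by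
      rw [hιξ r, ← hwι]
      simp only [hk])
    change ξ r ∈ W
    rw [h3]
    exact hη
  · rw [h₀, ← hιξ s₀, ht0]

end Returns

end BlowDown

end

/-! ### Regularity of lifts, the action form and the tangent spaces -/

noncomputable section

namespace BlowDown

set_option synthInstance.maxHeartbeats 200000
set_option maxSynthPendingDepth 3
set_option linter.unusedSectionVars false

variable {n : ℕ} {M : Type*} [TopologicalSpace M] [ChartedSpace (Model n) M]
  [IsManifold (𝓡 n) ∞ M]

/-- A continuous lift of a `C^1` curve through an immersion is `C^1`. -/
lemma contDiffAt_of_comp {E F : Type*} [NormedAddCommGroup E] [NormedSpace ℝ E]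
    [FiniteDimensional ℝ E] [NormedAddCommGroup F] [NormedSpace ℝ F] [FiniteDimensional ℝ F]
    {f : E → F} {A : E →L[ℝ] F} {u : ℝ → E} {s : ℝ} (hf : ContDiffAt ℝ 1 f (u s))
    (hA : HasFDerivAt f A (u s)) (hinj : Function.Injective A) (hu : ContinuousAt u s)
    (hfu : ContDiffAt ℝ 1 (fun r => f (u r)) s) : ContDiffAt ℝ 1 u s := by
  -- Composed with a left inverse of its derivative, the immersion becomes a local diffeomorphism,
  -- whose inverse recovers the curve.
  obtain ⟨B, hB⟩ := A.toLinearMap.exists_leftInverse_of_injective (LinearMap.ker_eq_bot.2 hinj)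
  have : CompleteSpace E := FiniteDimensional.complete ℝ E
  let B' : F →L[ℝ] E := LinearMap.toContinuousLinearMap B
  have h1 : ContDiffAt ℝ 1 (fun w => B' (f w)) (u s) := B'.contDiff.contDiffAt.comp (u s) hf
  have h2 : HasFDerivAt (fun w => B' (f w)) ((ContinuousLinearEquiv.refl ℝ E : E ≃L[ℝ] E) : E →L[ℝ] E)
      (u s) := by
    refine (B'.hasFDerivAt.comp (u s) hA).congr_fderiv ?_
    ext w
    exact LinearMap.congr_fun hB w
  have h3 := h1.to_localInverse h2 (by simp)
  have h4 := (h1.hasStrictFDerivAt' h2 (by simp)).eventually_left_inverse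
  have h5 : ContDiffAt ℝ 1 (fun r => B' (f (u r))) s := B'.contDiff.contDiffAt.comp s hfu
  have h6 : ContDiffAt ℝ 1 (fun r => h1.localInverse h2 (by simp) (B' (f (u r)))) s :=
    ContDiffAt.comp s (g := h1.localInverse h2 (by simp)) h3 h5
  refine h6.congr_of_eventuallyEq ?_
  filter_upwards [hu.eventually h4] with r hr
  exact hr.symm

section Curves

variable {g : Metric n M} {z : M} [T2Space M] (hz : IsCompleteAt g z)
include hz

/-- The symplectic product with the velocity detects `η(ξ^♯)`, and the action form then detects the
time component. What remains is `jac_eq_zero_iff`. No tangency of `η` to the sphere is needed. -/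
lemma injective_deriv_iota {t : ℝ} {ξ : Model n →L[ℝ] ℝ} {x : M} (hξ : ξ ∈ unitCosphere g z)
    (hx : (iota g z t ξ).1 ∈ (extChartAt (𝓡 n) x).source) :
    Function.Injective
      ((ContinuousLinearMap.toSpanSingleton ℝ (speed g z x t ξ)).coprod (jac g z x t ξ)) := by
  refine (injective_iff_map_eq_zero _).2 ?_
  rintro ⟨a, η⟩ h
  rw [ContinuousLinearMap.coprod_apply, ContinuousLinearMap.toSpanSingleton_apply] at h
  have h1 : omega (a • speed g z x t ξ + jac g z x t ξ η) (speed g z x t ξ) =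
      η (sharpAt g z ξ) := by
    rw [← omega_jac_speed hz hx η]
    simp [omega]
  have h2 : (cotChart n x (iota g z t ξ)).2 (a • speed g z x t ξ + jac g z x t ξ η).1 =
      a + t * η (sharpAt g z ξ) := by
    rw [← action_jac hz hx η, Prod.fst_add, Prod.smul_fst, map_add, map_smul,
      action_speed hz hx, mem_unitCosphere.1 hξ]
    simp
  rw [h] at h1 h2
  simp only [omega, Prod.snd_zero, Prod.fst_zero, map_zero, sub_zero, zero_apply] at h1 h2
  rw [← h1] at h2
  have ha : a = 0 := by linarith
  rw [ha, zero_smul, zero_add, jac_eq_zero_iff hz hx] at h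
  have h5 : η = 0 := h
  rw [ha, h5]
  rfl

lemma hasDerivAt_iota_curve {t : ℝ → ℝ} {ξ : ℝ → Model n →L[ℝ] ℝ} {s t' : ℝ}
    {ξ' : Model n →L[ℝ] ℝ} {x : M} (ht : HasDerivAt t t' s) (hξ : HasDerivAt ξ ξ' s)
    (hx : (iota g z (t s) (ξ s)).1 ∈ (extChartAt (𝓡 n) x).source) :
    HasDerivAt (fun s => cotChart n x (iota g z (t s) (ξ s)))
      (t' • speed g z x (t s) (ξ s) + jac g z x (t s) (ξ s) ξ') s := by
  have h := HasFDerivAt.comp_hasDerivAt s (f := fun s => (t s, ξ s))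
    (hasStrictFDerivAt_iota hz hx).hasFDerivAt (ht.prodMk hξ)
  simpa [Function.comp_def] using h

lemma continuous_iota_curve {t : ℝ → ℝ} {ξ : ℝ → Model n →L[ℝ] ℝ} (ht : Continuous t)
    (hξ : Continuous ξ) : Continuous (fun s => iota g z (t s) (ξ s)) :=
  (continuous_iota hz).comp (ht.prodMk hξ)

lemma contMDiff_iota_curve {t : ℝ → ℝ} {ξ : ℝ → Model n →L[ℝ] ℝ} (ht : ContDiff ℝ 1 t)
    (hξ : ContDiff ℝ 1 ξ) :
    ContMDiff 𝓘(ℝ, ℝ) (cotModel n) 1 (fun s => iota g z (t s) (ξ s)) := by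
  intro s
  have hx : (iota g z (t s) (ξ s)).1 ∈ (extChartAt (𝓡 n) (iota g z (t s) (ξ s)).1).source :=
    mem_extChartAt_source _
  refine (contMDiffAt_iff_cotChart (F := fun s => iota g z (t s) (ξ s)) hx).2
    ⟨(continuous_iota_curve hz ht.continuous hξ.continuous).continuousAt, ?_⟩
  exact ContDiffAt.comp s (g := fun p : ℝ × (Model n →L[ℝ] ℝ) =>
      cotChart n (iota g z (t s) (ξ s)).1 (iota g z p.1 p.2)) (f := fun s => (t s, ξ s))
      (contDiffAt_iota hz hx) (ht.prodMk hξ).contDiffAt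

lemma velocity_iota_curve {t : ℝ → ℝ} {ξ : ℝ → Model n →L[ℝ] ℝ} {s : ℝ}
    (ht : ContDiff ℝ 1 t) (hξ : ContDiff ℝ 1 ξ) :
    comps (iota g z (t s) (ξ s)) (velocity (fun s => iota g z (t s) (ξ s)) s) =
      deriv t s • speed g z (iota g z (t s) (ξ s)).1 (t s) (ξ s) +
        jac g z (iota g z (t s) (ξ s)).1 (t s) (ξ s) (deriv ξ s) := by
  have hx : (iota g z (t s) (ξ s)).1 ∈ (extChartAt (𝓡 n) (iota g z (t s) (ξ s)).1).source :=
    mem_extChartAt_source _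
  have h := hasDerivAt_iota_curve hz (ht.differentiable (by simp) s).hasDerivAt
    (hξ.differentiable (by simp) s).hasDerivAt hx
  have h1 := (hasMFDerivAt_curve_iff (c := fun s => iota g z (t s) (ξ s))).2
    ⟨(continuous_iota_curve hz ht.continuous hξ.continuous).continuousAt, h⟩
  rw [velocity, h1.mfderiv]
  exact one_smul ℝ _

omit hz [T2Space M] in
lemma deriv_unitCosphere {ξ : ℝ → Model n →L[ℝ] ℝ} {s : ℝ} (hξ : DifferentiableAt ℝ ξ s)
    (hS : ∀ s, ξ s ∈ unitCosphere g z) : deriv ξ s (sharpAt g z (ξ s)) = 0 := by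
  have h1 : HasDerivAt (fun s => ξ s (sharpAt g z (ξ s))) _ s :=
    hξ.hasDerivAt.clm_apply ((sharpAt g z).hasFDerivAt.comp_hasDerivAt s hξ.hasDerivAt)
  have h2 : (fun s => ξ s (sharpAt g z (ξ s))) = fun _ => 1 :=
    funext fun s => mem_unitCosphere.1 (hS s)
  rw [h2] at h1
  have h3 := h1.unique (hasDerivAt_const s 1)
  have h4 := sharpAt_symm g z (ξ s) (deriv ξ s)
  linarith

/-- The pullback of the action form by `ι_z` is `dt`. -/
lemma actionForm_iota_curve {t : ℝ → ℝ} {ξ : ℝ → Model n →L[ℝ] ℝ}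
    (ht : ContDiff ℝ 1 t) (hξ : ContDiff ℝ 1 ξ) (hS : ∀ s, ξ s ∈ unitCosphere g z) (s : ℝ) :
    actionForm (iota g z (t s) (ξ s)) (velocity (fun s => iota g z (t s) (ξ s)) s) =
      deriv t s := by
  have hx : (iota g z (t s) (ξ s)).1 ∈ (extChartAt (𝓡 n) (iota g z (t s) (ξ s)).1).source :=
    mem_extChartAt_source _
  rw [actionForm_eq, velocity_iota_curve hz ht hξ]
  -- By the Gauss lemma the covector contributes `t ξ'(ξ^♯)`, which is zero on the unit sphere; the
  -- time contributes `t' |ξ|² = t'`.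
  have h1 := action_jac hz hx (deriv ξ s)
  have h2 := action_speed hz hx
  have h3 : (cotChart n (iota g z (t s) (ξ s)).1 (iota g z (t s) (ξ s))).2 =
    covec (iota g z (t s) (ξ s)) := by rw [cotChart_self_apply]
  rw [h3] at h1 h2
  rw [Prod.fst_add, Prod.smul_fst, map_add, map_smul, h1, h2, mem_unitCosphere.1 (hS s),
    deriv_unitCosphere (hξ.differentiable (by simp) s) hS]
  simp

end Curves

/-- The parametrization by `T_z^*M` of the tangent spaces of the blow-down Lagrangian. -/
def ell (g : Metric n M) (z x : M) (t : ℝ) (ξ : Model n →L[ℝ] ℝ) :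
    (Model n →L[ℝ] ℝ) →L[ℝ] Phase n :=
  (ContinuousLinearMap.apply ℝ ℝ (sharpAt g z ξ)).smulRight (speed g z x t ξ) +
    (jac g z x t ξ).comp (ContinuousLinearMap.id ℝ _ -
      (ContinuousLinearMap.apply ℝ ℝ (sharpAt g z ξ)).smulRight ξ)

lemma ell_apply (g : Metric n M) (z x : M) (t : ℝ) (ξ η : Model n →L[ℝ] ℝ) :
    ell g z x t ξ η = η (sharpAt g z ξ) • speed g z x t ξ +
      jac g z x t ξ (η - η (sharpAt g z ξ) • ξ) := rfl

section Lagrangian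

variable {g : Metric n M} {z : M} {T : ℝ} [T2Space M] (hb : IsBlowDownPoint g z T)
include hb

/-- `C^1` curves in the blow-down Lagrangian lift to `C^1` curves in `ℝ × S^*_z M`. -/
lemma exists_contDiff_lift {γ : ℝ → Cotangent n M} (hγ : ContMDiff 𝓘(ℝ, ℝ) (cotModel n) 1 γ)
    (hmem : ∀ s, γ s ∈ blowDownLagrangian g z T) {s₀ t₀ : ℝ} {ξ₀ : Model n →L[ℝ] ℝ}
    (hξ₀ : ξ₀ ∈ unitCosphere g z) (h₀ : iota g z t₀ ξ₀ = γ s₀) :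
    ∃ (t : ℝ → ℝ) (ξ : ℝ → Model n →L[ℝ] ℝ), ContDiff ℝ 1 t ∧ ContDiff ℝ 1 ξ ∧
      (∀ s, ξ s ∈ unitCosphere g z) ∧ (∀ s, iota g z (t s) (ξ s) = γ s) ∧ t s₀ = t₀ ∧ ξ s₀ = ξ₀ := by
  have hz := hb.isCompleteAt
  obtain ⟨t, ξ, ht, hξ, hS, hι, h1, h2⟩ := exists_lift hb hγ.continuous hmem hξ₀ h₀
  have h : ∀ s, ContDiffAt ℝ 1 (fun s => (t s, ξ s)) s := by
    intro s
    have hx : (iota g z (t s) (ξ s)).1 ∈ (extChartAt (𝓡 n) (iota g z (t s) (ξ s)).1).source :=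
      mem_extChartAt_source _
    refine contDiffAt_of_comp (f := fun p : ℝ × (Model n →L[ℝ] ℝ) =>
      cotChart n (iota g z (t s) (ξ s)).1 (iota g z p.1 p.2)) (contDiffAt_iota hz hx)
      (hasStrictFDerivAt_iota hz hx).hasFDerivAt (injective_deriv_iota hz (hS s) hx)
      (ht.prodMk hξ).continuousAt ?_
    simp only [hι]
    exact ((contMDiffAt_iff_cotChart (mem_extChartAt_source _)).1 (hγ s)).2
  exact ⟨t, ξ, contDiff_iff_contDiffAt.2 fun s => (h s).fst,
    contDiff_iff_contDiffAt.2 fun s => (h s).snd, hS, hι, h1, h2⟩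

omit [T2Space M] hb in
lemma apply_sharpAt_sub {ξ : Model n →L[ℝ] ℝ} (hξ : ξ ∈ unitCosphere g z)
    (η : Model n →L[ℝ] ℝ) : (η - η (sharpAt g z ξ) • ξ) (sharpAt g z ξ) = 0 := by
  simp [mem_unitCosphere.1 hξ]

omit [T2Space M] hb in
/-- Tangent covectors of the unit sphere are velocities of curves in the sphere. -/
lemma exists_curve_unitCosphere {ξ η : Model n →L[ℝ] ℝ} (hξ : ξ ∈ unitCosphere g z)
    (hη : η (sharpAt g z ξ) = 0) : ∃ ν : ℝ → Model n →L[ℝ] ℝ, ContDiff ℝ 1 ν ∧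
      (∀ s, ν s ∈ unitCosphere g z) ∧ ν 0 = ξ ∧ deriv ν 0 = η := by
  set q := η (sharpAt g z η)
  have hq : 0 ≤ q := by
    by_cases h : η = 0
    · simp [q, h]
    · exact (sharpAt_pos g z h).le
  have hpos : ∀ s : ℝ, 0 < 1 + s ^ 2 * q := fun s => by positivity
  have hnorm : ∀ s : ℝ, (ξ + s • η) (sharpAt g z (ξ + s • η)) = 1 + s ^ 2 * q := by
    intro s
    have h1 := sharpAt_symm g z ξ η
    rw [hη] at h1
    simp only [map_add, map_smul, add_apply, smul_apply, smul_eq_mul, mem_unitCosphere.1 hξ, hη, h1]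
    ring
  -- Since `η` is orthogonal to `ξ`, the normalizing factor of the line `ξ + s η` is stationary at
  -- `0` and does not change the velocity.
  have hd : HasDerivAt (fun s : ℝ => (Real.sqrt (1 + s ^ 2 * q))⁻¹) 0 0 := by
    have h1 : HasDerivAt (fun s : ℝ => 1 + s ^ 2 * q) 0 0 := by
      have := (((hasDerivAt_id (0 : ℝ)).pow 2).mul_const q).const_add 1
      simpa using this
    have h2 := (h1.sqrt (by simp)).inv (by simp)
    rw [zero_div, neg_zero, zero_div] at h2
    exact h2
  refine ⟨fun s => (Real.sqrt (1 + s ^ 2 * q))⁻¹ • (ξ + s • η), ?_, fun s => ?_, by simp, ?_⟩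
  · refine ContDiff.smul (ContDiff.inv (ContDiff.sqrt (by fun_prop) fun s => (hpos s).ne')
      fun s => (Real.sqrt_pos.2 (hpos s)).ne') (by fun_prop)
  · change (Real.sqrt (1 + s ^ 2 * q))⁻¹ • (ξ + s • η) ∈ _
    rw [← hnorm s]
    refine smul_mem_unitCosphere g z ?_
    intro h0
    have h1 := hnorm s
    rw [h0] at h1
    simp only [map_zero] at h1
    exact (hpos s).ne h1
  · have h1 : HasDerivAt (fun s : ℝ => ξ + s • η) η 0 := by
      simpa using ((hasDerivAt_id (0 : ℝ)).smul_const η).const_add ξ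
    have h2 := hd.smul h1
    have h3 := h2.deriv
    simp only [ne_eq, OfNat.ofNat_ne_zero, not_false_eq_true, zero_pow, zero_mul, add_zero,
      Real.sqrt_one, inv_one, one_smul, zero_smul] at h3
    exact h3

/-- A curve in the Lagrangian lifts, and the lift has velocity `t' ∂_t + ξ'` with `ξ'` orthogonal to
`ξ`, which is the image of `t' ξ + ξ'` under `ell`. Conversely every value of `ell` is such a
velocity. This connects the span of velocities to the explicit frame. -/
lemma mem_tangentSpan_iff {t : ℝ} {ξ : Model n →L[ℝ] ℝ} (hξ : ξ ∈ unitCosphere g z)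
    {v : TangentSpace (cotModel n) (iota g z t ξ)} :
    v ∈ tangentSpan (blowDownLagrangian g z T) (iota g z t ξ) ↔
      ∃ η, ell g z (iota g z t ξ).1 t ξ η = comps (iota g z t ξ) v := by
  have hz := hb.isCompleteAt
  constructor
  · intro hv
    let L : (Model n →L[ℝ] ℝ) →ₗ[ℝ] TangentSpace (cotModel n) (iota g z t ξ) :=
      (ell g z (iota g z t ξ).1 t ξ).toLinearMap
    suffices h : tangentSpan (blowDownLagrangian g z T) (iota g z t ξ) ≤ LinearMap.range L from h hv
    refine Submodule.span_le.2 ?_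
    rintro w ⟨c, hc, hcΛ, hc0, hw⟩
    obtain ⟨τ, ν, hτ, hν, hS, hι, hτ0, hν0⟩ := exists_contDiff_lift hb hc hcΛ hξ hc0.symm
    have hcι : c = fun s => iota g z (τ s) (ν s) := funext fun s => (hι s).symm
    have h1 := velocity_iota_curve hz (s := 0) hτ hν
    have h2 := deriv_unitCosphere (hν.differentiable (by simp) 0) hS
    rw [hcι] at hw
    have h3 := h1.symm.trans hw
    rw [hτ0, hν0] at h3
    rw [hν0] at h2
    refine ⟨deriv τ 0 • ξ + deriv ν 0, ?_⟩
    refine Eq.trans ?_ h3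
    change ell g z (iota g z t ξ).1 t ξ _ = _
    have h4 : (deriv τ 0 • ξ + deriv ν 0) (sharpAt g z ξ) = deriv τ 0 := by
      rw [add_apply, smul_apply, mem_unitCosphere.1 hξ, h2]
      simp
    rw [ell_apply, h4, add_sub_cancel_left]
  · rintro ⟨η, hη⟩
    obtain ⟨ν, hν, hS, hν0, hν'⟩ := exists_curve_unitCosphere hξ (apply_sharpAt_sub hξ η)
    set a := η (sharpAt g z ξ)
    have hτ : ContDiff ℝ 1 fun s : ℝ => t + s * a := by fun_prop
    have hτ' : deriv (fun s : ℝ => t + s * a) 0 = a := by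
      simp
    have h1 := velocity_iota_curve hz (s := 0) hτ hν
    refine Submodule.subset_span ⟨fun s => iota g z (t + s * a) (ν s),
      contMDiff_iota_curve hz hτ hν, fun s => (mem_blowDownLagrangian hb).2 ⟨_, _, hS s, rfl⟩, ?_, ?_⟩
    · simp only [zero_mul, add_zero, hν0]
    · refine h1.trans ?_
      rw [hτ', hν', ← hη, ell_apply]
      simp only [zero_mul, add_zero, hν0]
      rfl

end Lagrangian

end BlowDown

end

/-! ### Pencils of Lagrangian frames and their real roots -/

noncomputable section

open Filter Topology

namespace BlowDown

set_option synthInstance.maxHeartbeats 200000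
set_option maxSynthPendingDepth 3
set_option linter.unusedSectionVars false

section Pencil

open Matrix

variable {ι : Type*} [Fintype ι] [DecidableEq ι]

lemma exists_orthogonal_diagonal {B : Matrix ι ι ℝ} (hB : B.IsSymm) :
    ∃ (U : Matrix ι ι ℝ) (s : ι → ℝ), U * Uᵀ = 1 ∧ U * B * Uᵀ = diagonal s := by
  have hH : B.IsHermitian := by
    rw [Matrix.IsHermitian, conjTranspose_eq_transpose_of_trivial]
    exact hB
  refine ⟨star (hH.eigenvectorUnitary : Matrix ι ι ℝ), hH.eigenvalues, ?_, ?_⟩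
  · have h := Unitary.coe_star_mul_self hH.eigenvectorUnitary
    rw [star_eq_conjTranspose, conjTranspose_eq_transpose_of_trivial, transpose_transpose] at *
    exact h
  · have h := hH.conjStarAlgAut_star_eigenvectorUnitary
    rw [Unitary.conjStarAlgAut_star_apply] at h
    rw [star_eq_conjTranspose, conjTranspose_eq_transpose_of_trivial, transpose_transpose] at *
    rw [h]
    rfl

/-- Simultaneous diagonalization of a positive definite and a symmetric matrix. -/
lemma exists_simultaneous_diagonal {A B : Matrix ι ι ℝ} (hA : A.PosDef) (hB : B.IsSymm) :
    ∃ (V : Matrix ι ι ℝ) (s : ι → ℝ), V * A * Vᵀ = 1 ∧ V * B * Vᵀ = diagonal s := by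
  have hAs : A.IsSymm := by
    have := hA.isHermitian
    rwa [Matrix.IsHermitian, conjTranspose_eq_transpose_of_trivial] at this
  obtain ⟨U, l, hU, hUA⟩ := exists_orthogonal_diagonal hAs
  have hl : ∀ i, 0 < l i := by
    refine posDef_diagonal_iff.1 ?_
    rw [← hUA, ← conjTranspose_eq_transpose_of_trivial]
    refine hA.mul_mul_conjTranspose_same ?_
    intro v w hvw
    have := congrArg (· ᵥ* Uᵀ) hvw
    simpa [vecMul_vecMul, hU] using this
  set D : Matrix ι ι ℝ := diagonal fun i => (Real.sqrt (l i))⁻¹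
  have hD : Dᵀ = D := diagonal_transpose _
  have h1 : (D * U) * A * (D * U)ᵀ = 1 := by
    have : (D * U) * A * (D * U)ᵀ = D * (U * A * Uᵀ) * D := by
      rw [transpose_mul, hD]
      simp only [Matrix.mul_assoc]
    rw [this, hUA, diagonal_mul_diagonal, diagonal_mul_diagonal, ← diagonal_one]
    congr 1
    funext i
    have h2 := Real.mul_self_sqrt (hl i).le
    have h3 := (Real.sqrt_pos.2 (hl i)).ne'
    field_simp
    nlinarith
  have hconj (V : Matrix ι ι ℝ) : (V * B * Vᵀ).IsSymm := by
    rw [Matrix.IsSymm, transpose_mul, transpose_mul, transpose_transpose, hB, Matrix.mul_assoc]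
  have h2 := hconj (D * U)
  obtain ⟨W, s, hW, hWB⟩ := exists_orthogonal_diagonal h2
  refine ⟨W * (D * U), s, ?_, ?_⟩
  · rw [transpose_mul, ← hW]
    calc W * (D * U) * A * ((D * U)ᵀ * Wᵀ) = W * ((D * U) * A * (D * U)ᵀ) * Wᵀ := by
          simp only [Matrix.mul_assoc]
      _ = _ := by rw [h1, Matrix.mul_one]
  · rw [transpose_mul, ← hWB]
    simp only [Matrix.mul_assoc]

/-- The characteristic polynomial `det (P + X Q)` of a pencil of matrices. -/
def pencil (P Q : Matrix ι ι ℝ) : Polynomial ℝ :=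
  (P.map Polynomial.C + (Polynomial.X : Polynomial ℝ) • Q.map Polynomial.C).det

lemma eval_pencil (P Q : Matrix ι ι ℝ) (x : ℝ) : (pencil P Q).eval x = (P + x • Q).det := by
  rw [pencil, ← Polynomial.coe_evalRingHom, RingHom.map_det]
  congr 1
  ext i j
  simp
  ring

/-- The complex matrix `P + z Q`. -/
def complexPencil (P Q : Matrix ι ι ℝ) (z : ℂ) : Matrix ι ι ℂ :=
  P.map (fun a : ℝ => (a : ℂ)) + z • Q.map (fun a : ℝ => (a : ℂ))

lemma aeval_pencil (P Q : Matrix ι ι ℝ) (z : ℂ) :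
    Polynomial.aeval z (pencil P Q) = (complexPencil P Q z).det := by
  have h : Polynomial.aeval z (pencil P Q) =
      (Polynomial.aeval z : Polynomial ℝ →ₐ[ℝ] ℂ).toRingHom (pencil P Q) := rfl
  rw [h, pencil, RingHom.map_det]
  congr 1
  ext i j
  simp [complexPencil]
  ring

/-- A Lagrangian frame is transverse to the complexification of the conjugate plane. -/
lemma det_complexPencil_ne_zero {P X G : Matrix ι ι ℝ} (hG : G.PosDef)
    (hsymm : (X * Pᵀ).IsSymm) (hnd : ∀ k, k ᵥ* P = 0 → k ᵥ* X = 0 → k = 0) :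
    (complexPencil P (X * G) Complex.I).det ≠ 0 := by
  intro hdet
  obtain ⟨v, hv, hv0⟩ := exists_vecMul_eq_zero_iff.2 hdet
  set k : ι → ℝ := fun i => (v i).re
  set m : ι → ℝ := fun i => (v i).im
  have hre : k ᵥ* P = m ᵥ* (X * G) := by
    funext j
    have h := congrArg Complex.re (congrFun hv0 j)
    simp only [complexPencil, vecMul, dotProduct, Matrix.add_apply, Matrix.smul_apply, map_apply,
      smul_eq_mul, Complex.re_sum, Complex.mul_re, Complex.add_re, Complex.add_im, Complex.mul_im,
      Complex.ofReal_re, Complex.ofReal_im, Complex.I_re, Complex.I_im, Pi.zero_apply,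
      Complex.zero_re, zero_mul, one_mul, mul_zero, sub_zero, add_zero, zero_add,
      Finset.sum_sub_distrib] at h
    simp only [vecMul, dotProduct, k, m]
    linarith
  have him : m ᵥ* P = -(k ᵥ* (X * G)) := by
    funext j
    have h := congrArg Complex.im (congrFun hv0 j)
    simp only [complexPencil, vecMul, dotProduct, Matrix.add_apply, Matrix.smul_apply, map_apply,
      smul_eq_mul, Complex.im_sum, Complex.mul_re, Complex.add_re, Complex.add_im, Complex.mul_im,
      Complex.ofReal_re, Complex.ofReal_im, Complex.I_re, Complex.I_im, Pi.zero_apply,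
      Complex.zero_im, zero_mul, one_mul, mul_zero, sub_zero, add_zero, zero_add,
      Finset.sum_add_distrib] at h
    simp only [vecMul, dotProduct, k, m, Pi.neg_apply]
    linarith
  -- For a null row `k + i m`, the Lagrangian condition turns `hre` and `him` into `|mX|² = -|kX|²`
  -- in the metric `G`, so both sides vanish.
  have hsymm' : (m ᵥ* X) ⬝ᵥ (k ᵥ* P) = (k ᵥ* X) ⬝ᵥ (m ᵥ* P) := by
    have h1 (a b : ι → ℝ) : (a ᵥ* X) ⬝ᵥ (b ᵥ* P) = (a ᵥ* (X * Pᵀ)) ⬝ᵥ b := by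
      rw [← vecMul_vecMul, vecMul_transpose, dotProduct_comm, ← dotProduct_mulVec,
        dotProduct_comm]
    rw [h1, h1, ← hsymm.eq, vecMul_transpose, dotProduct_comm, dotProduct_mulVec, hsymm.eq]
  rw [hre, him, dotProduct_neg, ← vecMul_vecMul, ← vecMul_vecMul] at hsymm'
  have hpos (w : ι → ℝ) : 0 ≤ w ⬝ᵥ (w ᵥ* G) ∧ (w ⬝ᵥ (w ᵥ* G) = 0 → w = 0) := by
    by_cases hw : w = 0
    · simp [hw]
    · have := hG.dotProduct_mulVec_pos hw
      rw [star_trivial, dotProduct_mulVec, dotProduct_comm] at this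
      exact ⟨this.le, fun h => absurd h this.ne'⟩
  have hm := hpos (m ᵥ* X)
  have hk := hpos (k ᵥ* X)
  have hm0 : m ᵥ* X = 0 := hm.2 (by linarith [hm.1, hk.1])
  have hk0 : k ᵥ* X = 0 := hk.2 (by linarith [hm.1, hk.1])
  have hkz : k = 0 := hnd k (by rw [hre, ← vecMul_vecMul, hm0, zero_vecMul]) hk0
  have hmz : m = 0 := hnd m (by rw [him, ← vecMul_vecMul, hk0, zero_vecMul, neg_zero]) hm0
  exact hv (funext fun i => Complex.ext (congrFun hkz i) (congrFun hmz i))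

lemma pencil_ne_zero {P X G : Matrix ι ι ℝ} (hG : G.PosDef)
    (hsymm : (X * Pᵀ).IsSymm) (hnd : ∀ k, k ᵥ* P = 0 → k ᵥ* X = 0 → k = 0) :
    pencil P (X * G) ≠ 0 := by
  intro h
  apply det_complexPencil_ne_zero hG hsymm hnd
  rw [← aeval_pencil, h, map_zero]

/-- A polynomial with nonzero value at `i` has a nonzero value at some real point. Such a point
gives a real Lagrangian plane transverse to the frame, against which the frame is a symmetric form.
-/
lemma exists_det_ne_zero {P X G : Matrix ι ι ℝ} (hG : G.PosDef)
    (hsymm : (X * Pᵀ).IsSymm) (hnd : ∀ k, k ᵥ* P = 0 → k ᵥ* X = 0 → k = 0) :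
    ∃ x : ℝ, (P + x • (X * G)).det ≠ 0 := by
  by_contra! h
  refine pencil_ne_zero hG hsymm hnd (Polynomial.funext fun x => ?_)
  rw [eval_pencil, h x, Polynomial.eval_zero]

/-- The symmetric matrix of a Lagrangian frame, relative to a transverse real plane. -/
def frameForm (P X G : Matrix ι ι ℝ) (x : ℝ) : Matrix ι ι ℝ := X * (P + x • (X * G))ᵀ

lemma frameForm_isSymm {P X G : Matrix ι ι ℝ} (hG : G.IsSymm) (hsymm : (X * Pᵀ).IsSymm) (x : ℝ) :
    (frameForm P X G x).IsSymm := by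
  have h1 : (X * (X * G)ᵀ).IsSymm := by
    rw [Matrix.IsSymm, transpose_mul, transpose_transpose, transpose_mul, hG.eq, Matrix.mul_assoc]
  rw [frameForm, transpose_add, transpose_smul, Matrix.mul_add, Matrix.mul_smul]
  exact hsymm.add (h1.smul x)

lemma isSymm_of_posDef {G : Matrix ι ι ℝ} (hG : G.PosDef) : G.IsSymm := by
  have := hG.isHermitian
  rwa [Matrix.IsHermitian, conjTranspose_eq_transpose_of_trivial] at this

/-- A diagonalization of a Lagrangian frame. -/
lemma exists_frame_diagonal {P X G : Matrix ι ι ℝ} (hG : G.PosDef) (hsymm : (X * Pᵀ).IsSymm)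
    {x : ℝ} (hx : (P + x • (X * G)).det ≠ 0) :
    ∃ (V : Matrix ι ι ℝ) (s : ι → ℝ), V.det ≠ 0 ∧
      V * frameForm P X G x * Vᵀ = diagonal s ∧
      pencil P (X * G) = Polynomial.C (P + x • (X * G)).det *
        ∏ j, (1 + (Polynomial.X - Polynomial.C x) * Polynomial.C (s j)) := by
  set R := P + x • (X * G) with hR
  have hRu : IsUnit R := (Matrix.isUnit_iff_isUnit_det _).2 (isUnit_iff_ne_zero.2 hx)
  -- With `frameForm` diagonalized relative to this positive form, the whole pencil becomes diagonal
  -- at once, with factors `1 + (y - x) s_j`.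
  have hA : (R * G⁻¹ * Rᵀ).PosDef := by
    rw [← conjTranspose_eq_transpose_of_trivial]
    exact hG.inv.mul_mul_conjTranspose_same (vecMul_injective_iff_isUnit.2 hRu)
  obtain ⟨V, s, hVA, hVB⟩ := exists_simultaneous_diagonal hA (frameForm_isSymm
    (isSymm_of_posDef hG) hsymm x)
  have hGu : IsUnit G.det := (Matrix.isUnit_iff_isUnit_det _).1 hG.isUnit
  have hV : V.det ≠ 0 := by
    intro h
    have := congrArg Matrix.det hVA
    rw [det_mul, det_mul, h, zero_mul, zero_mul, det_one] at this
    exact zero_ne_one this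
  refine ⟨V, s, hV, hVB, Polynomial.funext fun y => ?_⟩
  -- This is the right factor for which `V R W` is the identity and `V X G W` is the diagonal of
  -- `s`.
  set W := G⁻¹ * Rᵀ * Vᵀ
  have hprod : ∀ y : ℝ, V * (P + y • (X * G)) * W = diagonal fun j => 1 + (y - x) * s j := by
    intro y
    have h1 : P + y • (X * G) = R + (y - x) • (X * G) := by
      rw [hR, add_assoc, ← add_smul]
      congr 2
      ring
    have h2 : V * R * W = 1 := by
      rw [← hVA]
      simp only [W, Matrix.mul_assoc]
    have h3 : V * (X * G) * W = diagonal s := by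
      rw [← hVB, frameForm]
      simp only [W, Matrix.mul_assoc]
      rw [← Matrix.mul_assoc G, Matrix.mul_nonsing_inv _ hGu, Matrix.one_mul]
    rw [h1, Matrix.mul_add, Matrix.add_mul, h2, Matrix.mul_smul, Matrix.smul_mul, h3,
      ← diagonal_smul, ← diagonal_one, diagonal_add]
    rfl
  have hd : ∀ y : ℝ, V.det * (P + y • (X * G)).det * W.det = ∏ j, (1 + (y - x) * s j) := by
    intro y
    rw [← det_mul, ← det_mul, hprod, det_diagonal]
  have h0 : V.det * R.det * W.det = 1 := by
    have := hd x
    simpa using this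
  rw [eval_pencil, Polynomial.eval_mul, Polynomial.eval_C, Polynomial.eval_prod]
  simp only [Polynomial.eval_add, Polynomial.eval_one, Polynomial.eval_mul, Polynomial.eval_sub,
    Polynomial.eval_X, Polynomial.eval_C]
  rw [← hd y]
  linear_combination -(P + y • (X * G)).det * h0

/-- The sum of the arguments of `i - r` over the real roots `r` of a polynomial. -/
def rootArg (p : Polynomial ℝ) : ℝ :=
  (p.roots.map fun r : ℝ => Complex.arg (Complex.I - (r : ℂ))).sum

lemma rootArg_C_mul {c : ℝ} (hc : c ≠ 0) (p : Polynomial ℝ) :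
    rootArg (Polynomial.C c * p) = rootArg p := by
  rw [rootArg, rootArg, Polynomial.roots_C_mul _ hc]

lemma rootArg_X : rootArg Polynomial.X = Real.pi / 2 := by
  simp [rootArg, Polynomial.roots_X, Complex.arg_I]

/-- The linear factor with coefficient `s` has the root `x - s⁻¹`, and dividing by a negative `s`
costs half a turn. The factor itself never meets the negative axis, so this separates the continuous
part of the argument from its jumps. -/
lemma arg_I_sub (x s : ℝ) (hs : s ≠ 0) : Complex.arg (Complex.I - ((x - s⁻¹ : ℝ) : ℂ)) =
    Complex.arg (1 + (Complex.I - x) * s) + if s < 0 then Real.pi else 0 := by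
  have h1 : 1 + (Complex.I - (x : ℂ)) * s = (s : ℂ) * (Complex.I - ((x - s⁻¹ : ℝ) : ℂ)) := by
    have : (s : ℂ) ≠ 0 := by exact_mod_cast hs
    push_cast
    field_simp
    ring
  rcases hs.lt_or_gt with h | h
  · rw [if_pos h, h1]
    have h2 : (s : ℂ) * (Complex.I - ((x - s⁻¹ : ℝ) : ℂ)) =
        ((-s : ℝ) : ℂ) * -(Complex.I - ((x - s⁻¹ : ℝ) : ℂ)) := by push_cast; ring
    rw [h2, Complex.arg_real_mul _ (neg_pos.2 h), Complex.arg_neg_eq_arg_sub_pi_of_im_pos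
      (by simp)]
    ring
  · rw [if_neg (not_lt.2 h.le), h1, Complex.arg_real_mul _ h, add_zero]

/-- The root branch is a sum of principal arguments plus `π` times the negative index of the
diagonal form. A zero coefficient has no root and argument `0`. -/
lemma rootArg_prod {c x : ℝ} (hc : c ≠ 0) (s : ι → ℝ) :
    rootArg (Polynomial.C c * ∏ j, (1 + (Polynomial.X - Polynomial.C x) * Polynomial.C (s j))) =
      ∑ j, Complex.arg (1 + (Complex.I - x) * s j) +
        Real.pi * (Finset.univ.filter fun j => s j < 0).card := by
  have hfac : ∀ j, (1 + (Polynomial.X - Polynomial.C x) * Polynomial.C (s j)).roots =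
      if s j = 0 then 0 else {x - (s j)⁻¹} := by
    intro j
    split_ifs with h
    · simp [h]
    · have : (1 + (Polynomial.X - Polynomial.C x) * Polynomial.C (s j) : Polynomial ℝ) =
          Polynomial.C (s j) * (Polynomial.X - Polynomial.C (x - (s j)⁻¹)) := by
        have h2 : Polynomial.C (s j) * Polynomial.C (s j)⁻¹ = (1 : Polynomial ℝ) := by
          rw [← Polynomial.C_mul, mul_inv_cancel₀ h, Polynomial.C_1]
        rw [Polynomial.C_sub]
        linear_combination -h2
      rw [this, Polynomial.roots_C_mul _ h, Polynomial.roots_X_sub_C]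
  have hne : (∏ j, (1 + (Polynomial.X - Polynomial.C x) * Polynomial.C (s j))) ≠
      (0 : Polynomial ℝ) := by
    intro h
    have := congrArg (Polynomial.eval x) h
    simp [Polynomial.eval_prod] at this
  rw [rootArg_C_mul hc, rootArg, Polynomial.roots_prod _ _ hne, Multiset.map_bind,
    Multiset.sum_bind]
  simp only [hfac]
  rw [Finset.sum_map_val]
  rw [Finset.card_filter, Nat.cast_sum, Finset.mul_sum, ← Finset.sum_add_distrib]
  refine Finset.sum_congr rfl fun j _ => ?_
  split_ifs with h h' h'
  · simp [h] at h'
  · simp [h]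
  · simp only [Multiset.map_singleton, Multiset.sum_singleton]
    rw [arg_I_sub x _ h, if_pos h']
    simp
  · simp only [Multiset.map_singleton, Multiset.sum_singleton]
    rw [arg_I_sub x _ h, if_neg h']
    simp

end Pencil

end BlowDown

end

/-! ### Inertia of a symmetric matrix at a regular crossing -/

noncomputable section

open Filter Topology

namespace BlowDown

set_option synthInstance.maxHeartbeats 200000
set_option maxSynthPendingDepth 3
set_option linter.unusedSectionVars false

section Inertia

open Matrix

variable {ι : Type*} [Fintype ι] [DecidableEq ι]

/-- A semidefinite form that varies with definite velocity on its null vectors becomes definite. -/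
lemma eventually_neg_of_deriv {J : Type*} [Fintype J] {F : ℝ → Matrix J J ℝ} {F' : Matrix J J ℝ}
    {t₀ : ℝ} (hF : ∀ i j, HasDerivAt (fun t => F t i j) (F' i j) t₀)
    (h0 : ∀ u, u ⬝ᵥ F t₀ *ᵥ u ≤ 0)
    (h1 : ∀ u, u ≠ 0 → u ⬝ᵥ F t₀ *ᵥ u = 0 → u ⬝ᵥ F' *ᵥ u < 0) :
    ∀ᶠ t in 𝓝[>] t₀, ∀ u, u ≠ 0 → u ⬝ᵥ F t *ᵥ u < 0 := by
  have hcont : ∀ i j, ContinuousAt (fun t => F t i j) t₀ := fun i j => (hF i j).continuousAt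
  -- Compactness of the unit sphere reduces a uniform neighbourhood of times to one for each
  -- direction.
  have hev : ∀ᶠ t in 𝓝 t₀, ∀ u ∈ Metric.sphere (0 : J → ℝ) 1, t₀ < t → u ⬝ᵥ F t *ᵥ u < 0 := by
    refine (isCompact_sphere (0 : J → ℝ) 1).eventually_forall_of_forall_eventually fun u hu => ?_
    have hu0 : u ≠ 0 := by
      rintro rfl
      simp at hu
    have hc : ∀ {f : ℝ → Matrix J J ℝ} {a : Matrix J J ℝ} {l : Filter ℝ},
        (∀ i j, Tendsto (fun t => f t i j) l (𝓝 (a i j))) →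
        Tendsto (fun z : ℝ × (J → ℝ) => z.2 ⬝ᵥ f z.1 *ᵥ z.2) (l ×ˢ 𝓝 u) (𝓝 (u ⬝ᵥ a *ᵥ u)) := by
      intro f a l hf
      simp only [dotProduct, mulVec]
      refine tendsto_finsetSum _ fun i _ => ?_
      have hi (i : J) : Tendsto (fun z : ℝ × (J → ℝ) => z.2 i) (l ×ˢ 𝓝 u) (𝓝 (u i)) :=
        ((continuous_apply i).tendsto u).comp tendsto_snd
      exact (hi i).mul (tendsto_finsetSum _ fun j _ => ((hf i j).comp tendsto_fst).mul (hi j))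
    rcases (h0 u).lt_or_eq with hlt | heq
    · have h2 := hc (l := 𝓝 t₀) (f := F) (a := F t₀) fun i j => hcont i j
      rw [← nhds_prod_eq] at h2
      exact (h2.eventually_lt_const hlt).mono fun z hz _ => hz
    -- In a null direction the difference quotient decides: it tends to the negative form of `F'`,
    -- and for later times it is multiplied by a positive number.
    · have h2 := hc (l := 𝓝[≠] t₀) (f := fun t => Matrix.of fun i j => slope (fun t => F t i j) t₀ t)
        (a := F') fun i j => hasDerivAt_iff_tendsto_slope.1 (hF i j)
      have h3 := h2.eventually_lt_const (h1 u hu0 heq)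
      have h4 : ∀ᶠ z : ℝ × (J → ℝ) in 𝓝 (t₀, u), z.1 ≠ t₀ →
          z.2 ⬝ᵥ (Matrix.of fun i j => slope (fun t => F t i j) t₀ z.1) *ᵥ z.2 < 0 := by
        have h5 : ∀ᶠ z : ℝ × (J → ℝ) in 𝓝[{t₀}ᶜ ×ˢ univ] (t₀, u),
            z.2 ⬝ᵥ (Matrix.of fun i j => slope (fun t => F t i j) t₀ z.1) *ᵥ z.2 < 0 := by
          rw [nhdsWithin_prod_eq, nhdsWithin_univ]
          exact h3
        rw [eventually_nhdsWithin_iff] at h5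
        exact h5.mono fun z hz h => hz ⟨h, mem_univ _⟩
      filter_upwards [h4] with z hz hlt
      have h5 := hz hlt.ne'
      have h6 : F z.1 = F t₀ + (z.1 - t₀) • (Matrix.of fun i j => slope (fun t => F t i j) t₀ z.1) := by
        ext i j
        have : z.1 - t₀ ≠ 0 := sub_ne_zero.2 hlt.ne'
        simp only [Matrix.add_apply, Matrix.smul_apply, Matrix.of_apply, slope, vsub_eq_sub,
          smul_eq_mul]
        field_simp
        ring
      rw [h6, add_mulVec, dotProduct_add, smul_mulVec, dotProduct_smul, smul_eq_mul]
      have h7 := mul_neg_of_pos_of_neg (sub_pos.2 hlt) h5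
      linarith [h0 z.2]
  filter_upwards [nhdsWithin_le_nhds hev, self_mem_nhdsWithin] with t ht htt u hu
  have hn : 0 < ‖u‖ := norm_pos_iff.2 hu
  have h2 := ht (‖u‖⁻¹ • u) (by
    rw [mem_sphere_zero_iff_norm, norm_smul, norm_inv, norm_norm, inv_mul_cancel₀ hn.ne']) htt
  rw [mulVec_smul, smul_dotProduct, dotProduct_smul, smul_eq_mul, smul_eq_mul, ← mul_assoc] at h2
  have h3 : 0 < ‖u‖⁻¹ * ‖u‖⁻¹ := by positivity
  exact (pos_iff_neg_of_mul_neg h2).1 h3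

/-- The negative index is at least the dimension of a negative definite subspace. -/
lemma card_le_card_neg {J : Type*} [Fintype J] {B V : Matrix ι ι ℝ} {s : ι → ℝ} (hV : V.det ≠ 0)
    (hB : V * B * Vᵀ = diagonal s) (L : (J → ℝ) →ₗ[ℝ] (ι → ℝ))
    (hL : ∀ u, u ≠ 0 → L u ⬝ᵥ B *ᵥ L u < 0) :
    Fintype.card J ≤ (Finset.univ.filter fun j => s j < 0).card := by
  have hVu : IsUnit V.det := isUnit_iff_ne_zero.2 hV
  -- If all coordinates of negative sign vanish, the form is nonnegative; so a negative definite
  -- subspace injects into those coordinates.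
  let N : (J → ℝ) →ₗ[ℝ] ({j // s j < 0} → ℝ) :=
    (LinearMap.funLeft ℝ ℝ Subtype.val).comp ((vecMulLinear V⁻¹).comp L)
  have hinj : Function.Injective N := by
    refine (injective_iff_map_eq_zero _).2 fun u hu => ?_
    by_contra hne
    have h1 := hL u hne
    set w := L u ᵥ* V⁻¹ with hw
    have h2 : L u = w ᵥ* V := by
      rw [hw, vecMul_vecMul, nonsing_inv_mul _ hVu, vecMul_one]
    have h3 : L u ⬝ᵥ B *ᵥ L u = ∑ j, s j * w j ^ 2 := by
      have : L u ⬝ᵥ B *ᵥ L u = w ⬝ᵥ (V * B * Vᵀ) *ᵥ w := by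
        conv_lhs => rw [h2]
        rw [← mulVec_transpose, ← mulVec_mulVec, ← mulVec_mulVec, mulVec_transpose,
          dotProduct_mulVec w V]
      rw [this, hB]
      simp only [dotProduct, mulVec_diagonal]
      exact Finset.sum_congr rfl fun j _ => by ring
    rw [h3] at h1
    refine absurd h1 (not_lt.2 (Finset.sum_nonneg fun j _ => ?_))
    by_cases hj : s j < 0
    · have : w j = 0 := congrFun hu ⟨j, hj⟩
      rw [this]
      simp
    · exact mul_nonneg (not_lt.1 hj) (sq_nonneg _)
  have h := LinearMap.finrank_le_finrank_of_injective hinj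
  rw [Module.finrank_fintype_fun_eq_card, Module.finrank_fintype_fun_eq_card,
    Fintype.card_subtype] at h
  exact h

lemma form_neg (B : Matrix ι ι ℝ) (u : ι → ℝ) : u ⬝ᵥ (-B) *ᵥ u = -(u ⬝ᵥ B *ᵥ u) := by
  rw [neg_mulVec, dotProduct_neg]

/-- Half of the jump of the inertia of a symmetric matrix: lower bound for the negative index. -/
lemma eventually_card_le_neg {B : ℝ → Matrix ι ι ℝ} {B' : Matrix ι ι ℝ} {t₀ : ℝ}
    (hB : ∀ i j, HasDerivAt (fun t => B t i j) (B' i j) t₀)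
    {V : ℝ → Matrix ι ι ℝ} {s : ℝ → ι → ℝ}
    (hV : ∀ᶠ t in 𝓝 t₀, (V t).det ≠ 0 ∧ V t * B t * (V t)ᵀ = diagonal (s t))
    (p : ι → Prop) [DecidablePred p] (hp : ∀ j, p j → s t₀ j ≤ 0)
    (hker : ∀ k, k ≠ 0 → B t₀ *ᵥ k = 0 → (∃ j, p j ∧ s t₀ j = 0) → k ⬝ᵥ B' *ᵥ k < 0) :
    ∀ᶠ t in 𝓝[>] t₀, (Finset.univ.filter p).card ≤ (Finset.univ.filter fun j => s t j < 0).card := by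
  obtain ⟨hV0, hB0⟩ := hV.self_of_nhds
  set J := {j // p j}
  -- On the span of the rows of `V t₀` selected by `p`, the form at `t₀` is diagonal with
  -- nonpositive entries. Its null vectors lie in the kernel of the full form, where the derivative
  -- is negative.
  let E : Matrix J ι ℝ := (V t₀).submatrix Subtype.val id
  have hform (C : Matrix ι ι ℝ) (u : J → ℝ) :
      u ⬝ᵥ (E * C * Eᵀ) *ᵥ u = (u ᵥ* E) ⬝ᵥ C *ᵥ (u ᵥ* E) := by
    rw [← mulVec_mulVec, ← mulVec_mulVec, mulVec_transpose, dotProduct_mulVec u E]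
  have hE0 : E * B t₀ * Eᵀ = diagonal fun j : J => s t₀ j := by
    have : E * B t₀ * Eᵀ = (V t₀ * B t₀ * (V t₀)ᵀ).submatrix Subtype.val Subtype.val := by
      ext i j
      simp [E, Matrix.mul_apply]
    rw [this, hB0]
    ext i j
    by_cases h : i = j
    · simp [h]
    · have : i.1 ≠ j.1 := fun h' => h (Subtype.ext h')
      simp [h, this]
  have hdiag (u : J → ℝ) : u ⬝ᵥ (E * B t₀ * Eᵀ) *ᵥ u = ∑ j : J, s t₀ j * u j ^ 2 := by
    rw [hE0]
    simp only [dotProduct, mulVec_diagonal]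
    exact Finset.sum_congr rfl fun j _ => by ring
  have hinj : ∀ u : J → ℝ, u ᵥ* E = 0 → u = 0 := by
    intro u hu
    set u' : ι → ℝ := fun i => if h : p i then u ⟨i, h⟩ else 0 with hu'
    have h1 : u' ᵥ* V t₀ = u ᵥ* E := by
      funext i
      have h2 : ∀ j : J, u j = u' j.1 := fun j => by simp [hu', j.2]
      simp only [vecMul, dotProduct, E, submatrix_apply, id, h2]
      rw [← Finset.sum_filter_of_ne (p := p), Finset.sum_subtype (Finset.univ.filter p) (p := p) (by simp)
        (f := fun j => u' j * V t₀ j i)]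
      intro j _ hj
      by_contra h
      simp [hu', h] at hj
    have h2 : u' = 0 := by
      have := eq_zero_of_vecMul_eq_zero hV0 (h1.trans hu)
      exact this
    funext j
    have := congrFun h2 j.1
    simpa [hu', j.2] using this
  have hmain := eventually_neg_of_deriv (F := fun t => E * B t * Eᵀ) (F' := E * B' * Eᵀ) (t₀ := t₀)
    (fun i j => by
      simp only [Matrix.mul_apply, transpose_apply]
      exact HasDerivAt.fun_sum fun l _ => (HasDerivAt.fun_sum fun m _ =>
        (hB m l).const_mul _).mul_const _)
    (fun u => by
      rw [hdiag]
      exact Finset.sum_nonpos fun j _ => mul_nonpos_of_nonpos_of_nonneg (hp j j.2) (sq_nonneg _))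
    (fun u hu hu0 => by
      rw [hdiag] at hu0
      have hall : ∀ j : J, s t₀ j * u j ^ 2 = 0 := by
        have := (Finset.sum_eq_zero_iff_of_nonpos (s := Finset.univ)
          (f := fun j : J => s t₀ j * u j ^ 2) (fun j _ =>
          mul_nonpos_of_nonpos_of_nonneg (hp j j.2) (sq_nonneg (u j)))).1 hu0
        exact fun j => this j (Finset.mem_univ _)
      have hall' : ∀ j : J, s t₀ j * u j = 0 := by
        intro j
        rcases mul_eq_zero.1 (hall j) with h | h
        · rw [h, zero_mul]
        · rw [pow_eq_zero_iff two_ne_zero] at h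
          rw [h, mul_zero]
      obtain ⟨j, hj⟩ := Function.ne_iff.1 hu
      rw [hform]
      refine hker _ (fun h => hu (hinj u h)) ?_ ⟨j, j.2, (mul_eq_zero.1 (hall' j)).resolve_right hj⟩
      have h1 : (V t₀ * B t₀ * Eᵀ) *ᵥ u = 0 := by
        have h2 : V t₀ * B t₀ * Eᵀ = (diagonal (s t₀)).submatrix id Subtype.val := by
          rw [← hB0]
          ext i j
          simp [E, Matrix.mul_apply]
        rw [h2]
        funext i
        simp only [mulVec, dotProduct, submatrix_apply, id, diagonal_apply, Pi.zero_apply]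
        refine Finset.sum_eq_zero fun j _ => ?_
        split_ifs with h
        · rw [h]; exact hall' j
        · rw [zero_mul]
      rw [Matrix.mul_assoc, ← mulVec_mulVec, ← mulVec_mulVec, mulVec_transpose] at h1
      exact eq_zero_of_mulVec_eq_zero hV0 h1)
  filter_upwards [hmain, nhdsWithin_le_nhds hV] with t ht hVt
  have := card_le_card_neg (J := J) hVt.1 hVt.2 (vecMulLinear E) (fun u hu => by
    have := ht u hu
    rwa [hform] at this)
  rwa [Fintype.card_subtype] at this

/-- The jump of the inertia of a symmetric matrix at a regular crossing. -/
lemma eventually_inertia_right {B : ℝ → Matrix ι ι ℝ} {B' : Matrix ι ι ℝ} {t₀ : ℝ}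
    (hB : ∀ i j, HasDerivAt (fun t => B t i j) (B' i j) t₀)
    {V : ℝ → Matrix ι ι ℝ} {s : ℝ → ι → ℝ}
    (hV : ∀ᶠ t in 𝓝 t₀, (V t).det ≠ 0 ∧ V t * B t * (V t)ᵀ = diagonal (s t))
    (hker : ∀ k, k ≠ 0 → B t₀ *ᵥ k = 0 → 0 < k ⬝ᵥ B' *ᵥ k) :
    ∀ᶠ t in 𝓝[>] t₀, (Finset.univ.filter fun j => s t j < 0).card =
      (Finset.univ.filter fun j => s t₀ j < 0).card ∧ ∀ j, s t j ≠ 0 := by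
  -- Two lower bounds are used: old negative directions stay negative, and, by the same lemma for
  -- `-B`, the nonnegative ones become positive. The bounds add up to the dimension, so both are
  -- equalities and no zero is left.
  have h1 := eventually_card_le_neg hB hV (fun j => s t₀ j < 0) (fun j h => h.le)
    (fun k _ _ ⟨j, h, h'⟩ => absurd h' h.ne)
  have h2 := eventually_card_le_neg (B := fun t => -B t) (B' := -B') (V := V)
    (s := fun t => -s t) (fun i j => (hB i j).neg)
    (hV.mono fun t ht => ⟨ht.1, by rw [Matrix.mul_neg, Matrix.neg_mul, ht.2, diagonal_neg]; rfl⟩)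
    (fun j => 0 ≤ s t₀ j) (fun j h => by simpa using h)
    (fun k hk hk0 _ => by
      rw [form_neg, neg_lt_zero]
      exact hker k hk (by rwa [neg_mulVec, neg_eq_zero] at hk0))
  filter_upwards [h1, h2] with t h1 h2
  simp only [Pi.neg_apply, neg_lt_zero] at h2
  have e1 : (Finset.univ.filter fun j => s t₀ j < 0).card +
      (Finset.univ.filter fun j => 0 ≤ s t₀ j).card = Fintype.card ι := by
    have := Finset.card_filter_add_card_filter_not (s := (Finset.univ : Finset ι))
      (fun j => s t₀ j < 0)
    simpa only [not_lt, Finset.card_univ] using this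
  have e2 : (Finset.univ.filter fun j => s t j < 0).card +
      (Finset.univ.filter fun j => 0 ≤ s t j).card = Fintype.card ι := by
    have := Finset.card_filter_add_card_filter_not (s := (Finset.univ : Finset ι))
      (fun j => s t j < 0)
    simpa only [not_lt, Finset.card_univ] using this
  have hsub : (Finset.univ.filter fun j => 0 < s t j) ⊆ Finset.univ.filter fun j => 0 ≤ s t j :=
    fun j hj => by
      simp only [Finset.mem_filter, Finset.mem_univ, true_and] at hj ⊢
      exact hj.le
  have e3 := Finset.card_le_card hsub
  refine ⟨by omega, fun j hj => ?_⟩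
  have e4 := Finset.eq_of_subset_of_card_le hsub (by omega)
  have : j ∈ Finset.univ.filter fun j => 0 ≤ s t j := by simp [hj]
  rw [← e4] at this
  simp [hj] at this

lemma eventually_inertia_left {B : ℝ → Matrix ι ι ℝ} {B' : Matrix ι ι ℝ} {t₀ : ℝ}
    (hB : ∀ i j, HasDerivAt (fun t => B t i j) (B' i j) t₀)
    {V : ℝ → Matrix ι ι ℝ} {s : ℝ → ι → ℝ}
    (hV : ∀ᶠ t in 𝓝 t₀, (V t).det ≠ 0 ∧ V t * B t * (V t)ᵀ = diagonal (s t))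
    (hker : ∀ k, k ≠ 0 → B t₀ *ᵥ k = 0 → 0 < k ⬝ᵥ B' *ᵥ k) :
    ∀ᶠ t in 𝓝[<] t₀, (Finset.univ.filter fun j => s t j < 0).card =
      (Finset.univ.filter fun j => s t₀ j ≤ 0).card ∧ ∀ j, s t j ≠ 0 := by
  have htend : Tendsto (fun t : ℝ => -t) (𝓝 (-t₀)) (𝓝 t₀) := by
    simpa using (continuous_neg.tendsto (-t₀))
  -- Reversing both time and sign leaves the derivative unchanged, so the crossing is again
  -- positive; the kernel directions are negative before `t₀`.
  have h := eventually_inertia_right (B := fun t => -B (-t)) (B' := B') (V := fun t => V (-t))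
    (s := fun t => -s (-t)) (t₀ := -t₀) (fun i j => by
      have h1 : HasDerivAt (fun t => B t i j) (B' i j) (- -t₀) := by rw [neg_neg]; exact hB i j
      have := (h1.comp (-t₀) (hasDerivAt_neg (-t₀))).neg
      simp only [mul_neg, mul_one, neg_neg] at this
      exact this)
    ((htend.eventually hV).mono fun t ht => ⟨ht.1, by
      rw [Matrix.mul_neg, Matrix.neg_mul, ht.2, diagonal_neg]; rfl⟩)
    (fun k hk hk0 => hker k hk (by
      simp only [neg_neg] at hk0
      rwa [neg_mulVec, neg_eq_zero] at hk0))
  have hneg : Tendsto (fun t : ℝ => -t) (𝓝[<] t₀) (𝓝[>] (-t₀)) := tendsto_neg_nhdsLT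
  filter_upwards [hneg.eventually h] with t ht
  simp only [neg_neg, Pi.neg_apply, neg_lt_zero, ne_eq, neg_eq_zero] at ht
  refine ⟨?_, ht.2⟩
  have e1 : (Finset.univ.filter fun j => s t₀ j ≤ 0).card +
      (Finset.univ.filter fun j => 0 < s t₀ j).card = Fintype.card ι := by
    have := Finset.card_filter_add_card_filter_not (s := (Finset.univ : Finset ι))
      (fun j => s t₀ j ≤ 0)
    simpa only [not_le, Finset.card_univ] using this
  have e2 : (Finset.univ.filter fun j => s t j < 0).card +
      (Finset.univ.filter fun j => 0 < s t j).card = Fintype.card ι := by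
    have := Finset.card_filter_add_card_filter_not (s := (Finset.univ : Finset ι))
      (fun j => s t j < 0)
    have h3 : (Finset.univ.filter fun j => ¬ s t j < 0) = Finset.univ.filter fun j => 0 < s t j := by
      ext j
      simp only [Finset.mem_filter, Finset.mem_univ, true_and, not_lt]
      exact ⟨fun h => lt_of_le_of_ne h (Ne.symm (ht.2 j)), fun h => h.le⟩
    rwa [h3, Finset.card_univ] at this
  omega

end Inertia

end BlowDown

end

/-! ### Continuous phases and the jump of the index function -/

noncomputable section

open Filter Topology

namespace BlowDown

set_option synthInstance.maxHeartbeats 200000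
set_option maxSynthPendingDepth 3
set_option linter.unusedSectionVars false

section Phase

lemma continuous_circle_mk {A : Type*} [TopologicalSpace A] {f : A → ℂ} (hf : Continuous f)
    (h0 : ∀ a, f a ≠ 0) : ∃ c : C(A, Circle), ∀ a, (c a : ℂ) = f a / ‖f a‖ := by
  have h : ∀ a, f a / ‖f a‖ ∈ Submonoid.unitSphere ℂ := by
    intro a
    refine mem_sphere_zero_iff_norm.2 ?_
    rw [norm_div, Complex.norm_real, norm_norm, div_self (norm_ne_zero_iff.2 (h0 a))]
  refine ⟨⟨fun a => (⟨f a / ‖f a‖, h a⟩ : Circle), ?_⟩, fun a => rfl⟩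
  refine Continuous.subtype_mk (hf.div (by fun_prop) fun a => ?_) h
  exact_mod_cast norm_ne_zero_iff.2 (h0 a)

lemma coe_circle_exp_sum_arg {ι : Type*} [Fintype ι] (f : ι → ℂ) (hf : ∏ j, f j ≠ 0) :
    (Circle.exp (∑ j, Complex.arg (f j)) : ℂ) = (∏ j, f j) / ‖∏ j, f j‖ := by
  rw [Circle.coe_exp, eq_div_iff (by exact_mod_cast norm_ne_zero_iff.2 hf), norm_prod]
  push_cast
  rw [Finset.sum_mul, Complex.exp_sum, ← Finset.prod_mul_distrib]
  refine Finset.prod_congr rfl fun j _ => ?_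
  rw [mul_comm]
  exact Complex.norm_mul_exp_arg_mul_I _

lemma one_add_mul_mem_slitPlane {w : ℂ} (hw : w.im ≠ 0) (r : ℝ) :
    1 + w * r ∈ Complex.slitPlane := by
  rw [Complex.mem_slitPlane_iff]
  by_cases hr : r = 0
  · left; simp [hr]
  · right
    simpa using ⟨hw, hr⟩

/-- A map to the line whose exponential is continuous is continuous, if it is continuous along
the paths of a contraction to a constant. -/
lemma continuous_of_circle_exp {A : Type*} [TopologicalSpace A] (c : C(unitInterval × A, Circle))
    (H : unitInterval × A → ℝ) (hH : ∀ a, Continuous fun τ => H (τ, a))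
    (hc : ∀ z, Circle.exp (H z) = c z) (h0 : ∀ a, H (0, a) = 0) : Continuous H := by
  have h1 : ∀ a : A, c (0, a) = Circle.exp ((ContinuousMap.const A (0 : ℝ)) a) := by
    intro a
    rw [← hc, h0]
    rfl
  -- The lifted homotopy is jointly continuous, and it is the only lift that is continuous along
  -- every path from the given start.
  have h2 : H = Circle.isCoveringMap_exp.liftHomotopy c (ContinuousMap.const A (0 : ℝ)) h1 := by
    rw [IsCoveringMap.eq_liftHomotopy_iff]
    exact ⟨hH, funext hc, h0⟩
  rw [h2]
  exact ContinuousMap.continuous _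

/-- The sum of the arguments of the factors of a continuous family of products of linear factors
with real coefficients is continuous. -/
lemma continuous_sum_arg {ι A : Type*} [Fintype ι] [TopologicalSpace A] {w : ℂ} (hw : w.im ≠ 0)
    {s : A → ι → ℝ} (hs : Continuous fun z : ℝ × A => ∏ j, (1 + (z.1 * w) * s z.2 j)) :
    Continuous fun a => ∑ j, Complex.arg (1 + w * s a j) := by
  have hne : ∀ (τ : ℝ) (a : A) j, 1 + (τ * w) * s a j ∈ Complex.slitPlane := by
    intro τ a j
    have := one_add_mul_mem_slitPlane hw (τ * s a j)
    push_cast at this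
    rwa [show (τ * w) * (s a j : ℂ) = w * (τ * s a j) by ring]
  have hne0 : ∀ (τ : ℝ) (a : A), ∏ j, (1 + (τ * w) * (s a j : ℂ)) ≠ 0 := fun τ a =>
    Finset.prod_ne_zero_iff.2 fun j _ => Complex.slitPlane_ne_zero (hne τ a j)
  -- Scaling `w` by `τ` in `[0, 1]` contracts every factor to `1` without meeting the negative axis.
  -- Only the products need be continuous in the parameter, not the individual coefficients.
  have hs' : Continuous fun z : unitInterval × A =>
      ∏ j, (1 + (((z.1 : ℝ) : ℂ) * w) * s z.2 j) := by
    have h1 : Continuous fun z : unitInterval × A => ((z.1 : ℝ), z.2) := by fun_prop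
    have h2 := hs.comp h1
    simp only [Function.comp_def] at h2
    exact h2
  obtain ⟨c, hc⟩ := continuous_circle_mk hs' fun z => hne0 z.1 z.2
  have hcont := continuous_of_circle_exp c
    (fun z => ∑ j, Complex.arg (1 + (((z.1 : ℝ) : ℂ) * w) * s z.2 j)) (fun a => by
      refine continuous_finsetSum _ fun j _ => continuous_iff_continuousAt.2 fun τ => ?_
      exact (Complex.continuousAt_arg (hne τ a j)).comp
        (f := fun τ : unitInterval => 1 + (((τ : ℝ) : ℂ) * w) * s a j)
        (Continuous.continuousAt (by fun_prop))) (fun z => by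
      refine Circle.ext ?_
      rw [hc]
      exact coe_circle_exp_sum_arg _ (hne0 _ _)) (fun a => by simp)
  have := hcont.comp (by fun_prop : Continuous fun a : A => ((1 : unitInterval), a))
  refine this.congr fun a => ?_
  simp

end Phase

section LocalIndex

open Matrix

variable {ι : Type*} [Fintype ι] [DecidableEq ι]

lemma complexPencil_det_eq {P Q : Matrix ι ι ℝ} {x : ℝ} {s : ι → ℝ}
    (h : pencil P Q = Polynomial.C (P + x • Q).det *
        ∏ j, (1 + (Polynomial.X - Polynomial.C x) * Polynomial.C (s j))) (z : ℂ) :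
    (complexPencil P Q z).det = (P + x • Q).det * ∏ j, (1 + (z - x) * s j) := by
  rw [← aeval_pencil, h, map_mul, map_prod]
  simp

lemma rank_eq_of_frame {P X G V : Matrix ι ι ℝ} {x : ℝ} {s : ι → ℝ}
    (hx : (P + x • (X * G)).det ≠ 0) (hV : V.det ≠ 0)
    (hB : V * frameForm P X G x * Vᵀ = diagonal s) :
    X.rank = (Finset.univ.filter fun j => s j ≠ 0).card := by
  have h1 : (frameForm P X G x).rank = X.rank := by
    rw [frameForm]
    exact rank_mul_eq_left_of_isUnit_det _ _ (by
      rw [det_transpose]; exact isUnit_iff_ne_zero.2 hx)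
  have h2 : (diagonal s).rank = (frameForm P X G x).rank := by
    rw [← hB, rank_mul_eq_left_of_isUnit_det _ _ (by
      rw [det_transpose]; exact isUnit_iff_ne_zero.2 hV),
      rank_mul_eq_right_of_isUnit_det _ _ (isUnit_iff_ne_zero.2 hV)]
  rw [← h1, ← h2, rank_diagonal, Fintype.card_subtype]

/-- The difference between half of a continuous squared phase and the arguments of the roots of
the pencil. -/
def indexFun (Θ : ℝ → ℝ) (P X G : ℝ → Matrix ι ι ℝ) (t : ℝ) : ℝ :=
  (Θ t - 2 * rootArg (pencil (P t) (X t * G t))) / (2 * Real.pi)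

/-- A Lagrangian path crosses the vertical positively: the jump of the index function. -/
theorem indexFun_jump {P X G : ℝ → Matrix ι ι ℝ} {P' X' G' : Matrix ι ι ℝ} {t₀ : ℝ} {Θ : ℝ → ℝ}
    (hP : ∀ᶠ t in 𝓝 t₀, ContinuousAt P t) (hX : ∀ᶠ t in 𝓝 t₀, ContinuousAt X t)
    (hG : ∀ᶠ t in 𝓝 t₀, ContinuousAt G t)
    (hP' : ∀ i j, HasDerivAt (fun t => P t i j) (P' i j) t₀)
    (hX' : ∀ i j, HasDerivAt (fun t => X t i j) (X' i j) t₀)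
    (hG' : ∀ i j, HasDerivAt (fun t => G t i j) (G' i j) t₀)
    (hpos : ∀ᶠ t in 𝓝 t₀, (G t).PosDef) (hsymm : ∀ᶠ t in 𝓝 t₀, (X t * (P t)ᵀ).IsSymm)
    (hnd : ∀ k, k ᵥ* P t₀ = 0 → k ᵥ* X t₀ = 0 → k = 0)
    (hvert : ∀ k, k ᵥ* X t₀ = 0 → (k ᵥ* X') ᵥ* G t₀ = k ᵥ* P t₀)
    (hΘ : ContinuousAt Θ t₀)
    (hΘ' : ∀ᶠ t in 𝓝 t₀, (complexPencil (P t) (X t * G t) Complex.I).det ^ 2 =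
      (‖(complexPencil (P t) (X t * G t) Complex.I).det‖ ^ 2 : ℝ) *
        Complex.exp (Θ t * Complex.I)) :
    (∀ᶠ t in 𝓝[>] t₀, indexFun Θ P X G t = indexFun Θ P X G t₀ ∧
      (X t).rank = Fintype.card ι) ∧
    (∀ᶠ t in 𝓝[<] t₀, indexFun Θ P X G t = indexFun Θ P X G t₀ -
      ((Fintype.card ι - (X t₀).rank : ℕ) : ℝ) ∧ (X t).rank = Fintype.card ι) := by
  -- The reference plane is chosen at `t₀` and kept fixed; it remains transverse for nearby times.
  obtain ⟨x, hx⟩ := exists_det_ne_zero hpos.self_of_nhds hsymm.self_of_nhds hnd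
  -- a neighbourhood where all is regular
  have hPc := hP.self_of_nhds
  have hXc := hX.self_of_nhds
  have hGc := hG.self_of_nhds
  have hdet : ∀ᶠ t in 𝓝 t₀, (P t + x • (X t * G t)).det ≠ 0 := by
    have : ContinuousAt (fun t => (P t + x • (X t * G t)).det) t₀ := by
      have h1 : Continuous fun z : Matrix ι ι ℝ × Matrix ι ι ℝ × Matrix ι ι ℝ =>
          (z.1 + x • (z.2.1 * z.2.2)).det := by
        refine Continuous.matrix_det ?_
        exact continuous_fst.add (((continuous_fst.comp continuous_snd).matrix_mul
          (continuous_snd.comp continuous_snd)).const_smul x)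
      exact h1.continuousAt.comp (f := fun t => (P t, X t, G t))
        (hPc.prodMk (hXc.prodMk hGc))
    exact this.eventually_ne hx
  obtain ⟨O, hO, hOopen, ht₀⟩ := mem_nhds_iff.1
    (hP.and (hX.and (hG.and (hpos.and (hsymm.and (hdet.and hΘ'))))))
  have hreg : ∀ t ∈ O, ∃ (V : Matrix ι ι ℝ) (s : ι → ℝ), V.det ≠ 0 ∧
      V * frameForm (P t) (X t) (G t) x * Vᵀ = diagonal s ∧
      pencil (P t) (X t * G t) = Polynomial.C (P t + x • (X t * G t)).det *
        ∏ j, (1 + (Polynomial.X - Polynomial.C x) * Polynomial.C (s j)) := fun t ht => by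
    obtain ⟨-, -, -, h4, h5, h6, -⟩ := hO ht
    exact exists_frame_diagonal h4 h5 h6
  -- The diagonalizations are chosen separately at each time, with no continuity; the pencil
  -- determines the products of their factors, which is all that is needed below.
  choose! V s hV hB hpen using hreg
  set w : ℂ := Complex.I - x with hw
  have hwim : w.im ≠ 0 := by simp [hw]
  set Γ : ℝ → ℝ := fun t => ∑ j, Complex.arg (1 + w * s t j) with hΓ
  have hdetO : ∀ t ∈ O, (P t + x • (X t * G t)).det ≠ 0 := fun t ht => (hO ht).2.2.2.2.2.1
  -- continuity of the sum of the arguments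
  have hΓc : ContinuousAt Γ t₀ := by
    have h1 : Continuous fun a : O => ∑ j, Complex.arg (1 + w * s a j) := by
      refine continuous_sum_arg hwim (s := fun (a : O) => s a) ?_
      have hPO : Continuous fun a : O => P a := continuous_iff_continuousAt.2 fun a =>
        (hO a.2).1.comp continuous_subtype_val.continuousAt
      have hXO : Continuous fun a : O => X a := continuous_iff_continuousAt.2 fun a =>
        (hO a.2).2.1.comp continuous_subtype_val.continuousAt
      have hGO : Continuous fun a : O => G a := continuous_iff_continuousAt.2 fun a =>
        (hO a.2).2.2.1.comp continuous_subtype_val.continuousAt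
      have hmap : Continuous fun A : Matrix ι ι ℝ => A.map (fun a : ℝ => (a : ℂ)) :=
        continuous_id.matrix_map Complex.continuous_ofReal
      have h2 : (fun z : ℝ × O => ∏ j, (1 + (z.1 * w) * (s z.2 j : ℂ))) = fun z =>
          (complexPencil (P z.2) (X z.2 * G z.2) (x + z.1 * w)).det /
            ((P z.2 + x • (X z.2 * G z.2)).det : ℝ) := by
        funext z
        rw [complexPencil_det_eq (hpen z.2 z.2.2), mul_div_cancel_left₀]
        · simp
        · exact_mod_cast hdetO z.2 z.2.2
      rw [h2]
      have hXG : Continuous fun a : O => X a * G a := hXO.matrix_mul hGO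
      refine Continuous.div ?_ ?_ fun z => by exact_mod_cast hdetO z.2 z.2.2
      · refine Continuous.matrix_det ?_
        refine ((hmap.comp hPO).comp continuous_snd).add
          (Continuous.smul
            (by fun_prop : Continuous fun z : ℝ × O => ((x : ℂ) + z.1 * w)) ((hmap.comp hXG).comp continuous_snd))
      · refine Complex.continuous_ofReal.comp (Continuous.matrix_det ?_)
        exact (hPO.comp continuous_snd).add ((hXG.comp continuous_snd).const_smul x)
    exact (continuousOn_iff_continuous_domRestrict.2 h1).continuousAt (hOopen.mem_nhds ht₀)
  -- the phase in terms of the sum of the arguments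
  have hint : ∀ t ∈ O, ∃ m : ℤ, Θ t - 2 * Γ t = m * (2 * Real.pi) := by
    intro t ht
    have h1 := (hO ht).2.2.2.2.2.2
    rw [complexPencil_det_eq (hpen t ht)] at h1
    set d : ℝ := (P t + x • (X t * G t)).det
    have hd : (d : ℂ) ≠ 0 := by exact_mod_cast hdetO t ht
    have h2 : ∏ j, (1 + w * (s t j : ℂ)) =
        (∏ j, (‖1 + w * (s t j : ℂ)‖ : ℂ)) * Complex.exp (Γ t * Complex.I) := by
      rw [hΓ]
      push_cast
      rw [Finset.sum_mul, Complex.exp_sum, ← Finset.prod_mul_distrib]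
      exact Finset.prod_congr rfl fun j _ => (Complex.norm_mul_exp_arg_mul_I _).symm
    have h3 : (∏ j, (‖1 + w * (s t j : ℂ)‖ : ℂ)) ≠ 0 := by
      refine Finset.prod_ne_zero_iff.2 fun j _ => ?_
      exact_mod_cast norm_ne_zero_iff.2
        (Complex.slitPlane_ne_zero (one_add_mul_mem_slitPlane hwim (s t j)))
    have h4 : Complex.exp (Θ t * Complex.I) = Complex.exp (Γ t * Complex.I) ^ 2 := by
      have h5 : (‖(d : ℂ) * ∏ j, (1 + w * (s t j : ℂ))‖ : ℂ) ^ 2 =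
          (d : ℂ) ^ 2 * (∏ j, (‖1 + w * (s t j : ℂ)‖ : ℂ)) ^ 2 := by
        rw [norm_mul, norm_prod, Complex.norm_real, Real.norm_eq_abs]
        push_cast
        rw [mul_pow, ← Complex.ofReal_pow, sq_abs, Complex.ofReal_pow]
      rw [Complex.ofReal_pow, h5] at h1
      rw [h2] at h1
      have h6 : (d : ℂ) ^ 2 * (∏ j, (‖1 + w * (s t j : ℂ)‖ : ℂ)) ^ 2 ≠ 0 :=
        mul_ne_zero (pow_ne_zero _ hd) (pow_ne_zero _ h3)
      refine (mul_left_cancel₀ h6 ?_).symm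
      rw [← h1]
      ring
    rw [← Complex.exp_nat_mul, Complex.exp_eq_exp_iff_exists_int] at h4
    obtain ⟨m, hm⟩ := h4
    refine ⟨m, ?_⟩
    have h5 : ((Θ t : ℂ) - 2 * Γ t - m * (2 * Real.pi)) * Complex.I = 0 := by
      push_cast at hm
      linear_combination hm
    have h6 := (mul_eq_zero.1 h5).resolve_right Complex.I_ne_zero
    have h7 : Θ t - 2 * Γ t - m * (2 * Real.pi) = 0 := by exact_mod_cast h6
    linarith
  -- A continuous function with values in the multiples of `2π` is locally constant.
  have hconst : ∀ᶠ t in 𝓝 t₀, Θ t - 2 * Γ t = Θ t₀ - 2 * Γ t₀ := by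
    have hc : ContinuousAt (fun t => Θ t - 2 * Γ t) t₀ := hΘ.sub (hΓc.const_mul 2)
    have h1 := Metric.continuousAt_iff'.1 hc (2 * Real.pi) Real.two_pi_pos
    filter_upwards [h1, hOopen.mem_nhds ht₀] with t h2 ht
    obtain ⟨m, hm⟩ := hint t ht
    obtain ⟨m₀, hm₀⟩ := hint t₀ ht₀
    rw [Real.dist_eq, hm, hm₀, ← sub_mul, abs_mul, abs_of_pos Real.two_pi_pos] at h2
    have h3 : |(m : ℝ) - m₀| < 1 := by
      have := Real.two_pi_pos
      nlinarith
    have h4 : |m - m₀| < 1 := by exact_mod_cast h3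
    rw [Int.abs_lt_one_iff, sub_eq_zero] at h4
    rw [hm, hm₀, h4]
  -- The index function is a locally constant term minus the negative index of the form, so its jump
  -- is the jump of the inertia.
  have hindex : ∀ t ∈ O, indexFun Θ P X G t = (Θ t - 2 * Γ t) / (2 * Real.pi) -
      (Finset.univ.filter fun j => s t j < 0).card := by
    intro t ht
    rw [indexFun, hpen t ht, rootArg_prod (hdetO t ht)]
    have := Real.pi_pos.ne'
    simp only [hΓ, hw]
    field_simp
    ring
  -- the jump of the inertia
  set B : ℝ → Matrix ι ι ℝ := fun t => frameForm (P t) (X t) (G t) x with hBdef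
  set R' : Matrix ι ι ℝ := P' + x • (X' * G t₀ + X t₀ * G')
  set B' : Matrix ι ι ℝ := X' * (P t₀ + x • (X t₀ * G t₀))ᵀ + X t₀ * R'ᵀ with hB'def
  have hBd : ∀ i j, HasDerivAt (fun t => B t i j) (B' i j) t₀ := by
    intro i j
    simp only [hBdef, frameForm, Matrix.mul_apply, transpose_apply, Matrix.add_apply,
      Matrix.smul_apply, smul_eq_mul]
    refine (HasDerivAt.fun_sum fun l _ => (hX' i l).mul ((hP' j l).add
      ((HasDerivAt.fun_sum fun m _ => (hX' j m).mul (hG' m l)).const_mul x))).congr_deriv ?_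
    simp only [hB'def, R', Matrix.mul_apply, transpose_apply, Matrix.add_apply,
      Matrix.smul_apply, smul_eq_mul, Finset.sum_add_distrib, Pi.add_apply, Pi.mul_apply]
  have hVev : ∀ᶠ t in 𝓝 t₀, (V t).det ≠ 0 ∧ V t * B t * (V t)ᵀ = diagonal (s t) := by
    filter_upwards [hOopen.mem_nhds ht₀] with t ht
    exact ⟨hV t ht, hB t ht⟩
  -- The kernel of the form is that of `X`, because the second factor is invertible. On it `hvert`
  -- turns the derivative into the squared `G`-length of `k X'`, which is positive by nondegeneracy
  -- of the frame.
  have hker : ∀ k, k ≠ 0 → B t₀ *ᵥ k = 0 → 0 < k ⬝ᵥ B' *ᵥ k := by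
    intro k hk hk0
    have hBs : (B t₀)ᵀ = B t₀ := frameForm_isSymm (isSymm_of_posDef hpos.self_of_nhds)
      hsymm.self_of_nhds x
    have h1 : k ᵥ* X t₀ = 0 := by
      rw [← hBs, mulVec_transpose, hBdef] at hk0
      simp only [frameForm] at hk0
      rw [← vecMul_vecMul, vecMul_transpose] at hk0
      exact eq_zero_of_mulVec_eq_zero hx hk0
    have h2 := hvert k h1
    have h3 : k ᵥ* (P t₀ + x • (X t₀ * G t₀)) = k ᵥ* P t₀ := by
      rw [vecMul_add, vecMul_smul, ← vecMul_vecMul, h1, zero_vecMul, smul_zero, add_zero]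
    have h4 : k ⬝ᵥ B' *ᵥ k = (k ᵥ* X') ⬝ᵥ (k ᵥ* P t₀) := by
      rw [hB'def, add_mulVec, dotProduct_add, ← mulVec_mulVec, ← mulVec_mulVec,
        dotProduct_mulVec k (X t₀), dotProduct_mulVec k X', h1, zero_dotProduct, add_zero, mulVec_transpose, h3]
    rw [h4, ← h2, dotProduct_comm, ← dotProduct_mulVec]
    have h5 := hpos.self_of_nhds.dotProduct_mulVec_pos (x := k ᵥ* X') (by
      intro h0
      rw [h0, zero_vecMul] at h2
      exact hk (hnd k h2.symm h1))
    simpa using h5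
  have hrank : ∀ t ∈ O, (∀ j, s t j ≠ 0) → (X t).rank = Fintype.card ι := by
    intro t ht h
    rw [rank_eq_of_frame (hdetO t ht) (hV t ht) (hB t ht), Finset.filter_true_of_mem
      fun j _ => h j, Finset.card_univ]
  refine ⟨?_, ?_⟩
  · filter_upwards [eventually_inertia_right hBd hVev hker, nhdsWithin_le_nhds hconst,
      nhdsWithin_le_nhds (hOopen.mem_nhds ht₀)] with t h1 h2 ht
    exact ⟨by rw [hindex t ht, hindex t₀ ht₀, h2, h1.1], hrank t ht h1.2⟩
  · filter_upwards [eventually_inertia_left hBd hVev hker, nhdsWithin_le_nhds hconst,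
      nhdsWithin_le_nhds (hOopen.mem_nhds ht₀)] with t h1 h2 ht
    refine ⟨?_, hrank t ht h1.2⟩
    have h3 : Fintype.card ι - (X t₀).rank = (Finset.univ.filter fun j => s t₀ j = 0).card := by
      rw [rank_eq_of_frame (hdetO t₀ ht₀) (hV t₀ ht₀) (hB t₀ ht₀)]
      have := Finset.card_filter_add_card_filter_not (s := (Finset.univ : Finset ι))
        (fun j => s t₀ j = 0)
      rw [Finset.card_univ] at this
      simp only [ne_eq]
      omega
    have h4 : (Finset.univ.filter fun j => s t₀ j ≤ 0).card =
        (Finset.univ.filter fun j => s t₀ j < 0).card +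
          (Finset.univ.filter fun j => s t₀ j = 0).card := by
      rw [← Finset.card_union_of_disjoint]
      · congr 1
        ext j
        simp [le_iff_lt_or_eq]
      · rw [Finset.disjoint_filter]
        exact fun j _ h h' => h.ne h'
    rw [hindex t ht, hindex t₀ ht₀, h2, h1.1, h3, h4]
    push_cast
    ring

end LocalIndex

end BlowDown

end

/-! ### Step functions with isolated jumps -/

noncomputable section

open Filter Topology

namespace BlowDown

set_option synthInstance.maxHeartbeats 200000
set_option maxSynthPendingDepth 3
set_option linter.unusedSectionVars false

section Jumps

/-- A set of reals with no accumulation point meets a compact interval in a finite set. -/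
lemma finite_inter_Icc {D : Set ℝ} (hD : ∀ t, ∀ᶠ s in 𝓝[≠] t, s ∉ D) (a b : ℝ) :
    (D ∩ Icc a b).Finite := by
  refine isCompact_Icc.induction_on (p := fun A => (D ∩ A).Finite) (by simp)
    (fun A B h hB => hB.subset (inter_subset_inter_right _ h))
    (fun A B hA hB => by rw [inter_union_distrib_left]; exact hA.union hB) fun t _ => ?_
  refine ⟨{s | s ≠ t → s ∉ D}, mem_nhdsWithin_of_mem_nhds
    (eventually_nhdsWithin_iff.1 (hD t)), (finite_singleton t).subset ?_⟩
  rintro s ⟨h1, h2⟩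
  by_contra h
  exact h2 h h1

/-- A step function is the sum of its jumps. -/
theorem finite_and_sum_jumps {N : ℝ → ℝ} {m : ℝ → ℕ}
    (hr : ∀ t, ∀ᶠ s in 𝓝[>] t, N s = N t ∧ m s = 0)
    (hl : ∀ t, ∀ᶠ s in 𝓝[<] t, N s = N t - m t ∧ m s = 0) {T : ℝ} (hT : 0 ≤ T) :
    {t ∈ Ioc 0 T | m t ≠ 0}.Finite ∧ ((∑ᶠ t ∈ Ioc 0 T, m t : ℕ) : ℝ) = N T - N 0 := by
  have hfin : {t ∈ Ioc 0 T | m t ≠ 0}.Finite := by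
    refine (finite_inter_Icc (D := {t | m t ≠ 0}) (fun t => ?_) 0 T).subset fun t ht =>
      ⟨ht.2, Ioc_subset_Icc_self ht.1⟩
    rw [← Iio_union_Ioi, nhdsWithin_union, eventually_sup]
    exact ⟨(hl t).mono fun s h => by simp [h.2], (hr t).mono fun s h => by simp [h.2]⟩
  refine ⟨hfin, ?_⟩
  set D := hfin.toFinset with hD
  have hDmem : ∀ u, u ∈ D ↔ (0 < u ∧ u ≤ T) ∧ m u ≠ 0 := fun u => by simp [hD]
  have h1 : ∑ᶠ t ∈ Ioc 0 T, m t = ∑ t ∈ D, m t := by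
    refine finsum_mem_eq_sum_of_inter_support_eq m ?_
    ext u
    simp [hDmem]
  rw [h1]
  -- The value `N t` already includes the jump at `t`. After the jumps at `u ≤ s` are subtracted,
  -- the function is locally constant from the right everywhere and from the left on `(0, T]`. A
  -- jump at `T` is thus counted and one at `0` is not, which is why the interval is half open.
  set Z : ℝ → ℝ := fun s => N s - ((∑ u ∈ D, if u ≤ s then m u else 0 : ℕ) : ℝ) with hZ
  have hright : ∀ t, ∀ᶠ s in 𝓝[>] t, Z s = Z t := by
    intro t
    have h2 : ∀ᶠ s in 𝓝[>] t, ∀ u ∈ D, (u ≤ s ↔ u ≤ t) := by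
      refine (Finset.eventually_all D).2 fun u _ => ?_
      rcases le_or_gt u t with h | h
      · filter_upwards [self_mem_nhdsWithin] with s hs
        exact ⟨fun _ => h, fun _ => h.trans (le_of_lt hs)⟩
      · filter_upwards [nhdsWithin_le_nhds (Iio_mem_nhds h)] with s hs
        exact ⟨fun h' => absurd h' (not_le.2 hs), fun h' => absurd h' (not_le.2 h)⟩
    filter_upwards [hr t, h2] with s hs h3
    simp only [hZ]
    rw [hs.1, Finset.sum_congr rfl fun u hu => if_congr (h3 u hu) rfl rfl]
  have hleft : ∀ t, 0 < t → t ≤ T → ∀ᶠ s in 𝓝[<] t, Z s = Z t := by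
    intro t ht0 htT
    have h2 : ∀ᶠ s in 𝓝[<] t, ∀ u ∈ D, (u ≤ s ↔ u < t) := by
      refine (Finset.eventually_all D).2 fun u _ => ?_
      rcases lt_or_ge u t with h | h
      · filter_upwards [nhdsWithin_le_nhds (Ioi_mem_nhds h)] with s hs
        exact ⟨fun _ => h, fun _ => le_of_lt hs⟩
      · filter_upwards [self_mem_nhdsWithin] with s hs
        exact ⟨fun h' => absurd (h'.trans_lt hs) (not_lt.2 h), fun h' => absurd h' (not_lt.2 h)⟩
    filter_upwards [hl t, h2] with s hs h3
    simp only [hZ]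
    have h4 : ∑ u ∈ D, (if u ≤ t then m u else 0) =
        ∑ u ∈ D, (if u ≤ s then m u else 0) + m t := by
      have h5 : m t = ∑ u ∈ D, if u = t then m u else 0 := by
        rw [Finset.sum_ite_eq' D t m]
        by_cases h : m t = 0
        · simp [h]
        · rw [if_pos ((hDmem t).2 ⟨⟨ht0, htT⟩, h⟩)]
      rw [h5, ← Finset.sum_add_distrib]
      refine Finset.sum_congr rfl fun u hu => ?_
      rw [if_congr (h3 u hu) rfl rfl]
      rcases lt_trichotomy u t with h | h | h
      · simp [h, h.le, h.ne]
      · simp [h]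
      · simp [h.not_ge, h.not_gt, h.ne']
    rw [hs.1, h4]
    push_cast
    ring
  -- One-sided local constancy gives continuity on `[0, T]` and a zero right derivative.
  have hconst := constant_of_has_deriv_right_zero (f := Z) (a := 0) (b := T) ?_ ?_ T
    (right_mem_Icc.2 hT)
  · simp only [hZ] at hconst
    have h2 : ∑ u ∈ D, (if u ≤ T then m u else 0) = ∑ u ∈ D, m u :=
      Finset.sum_congr rfl fun u hu => if_pos ((hDmem u).1 hu).1.2
    have h3 : ∑ u ∈ D, (if u ≤ 0 then m u else 0) = 0 :=
      Finset.sum_eq_zero fun u hu => if_neg (not_le.2 ((hDmem u).1 hu).1.1)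
    rw [h2, h3] at hconst
    push_cast at hconst ⊢
    linarith
  · intro t ht
    have h2 : ∀ᶠ s in 𝓝[Icc 0 T] t, Z s = Z t := by
      rw [eventually_nhdsWithin_iff]
      have h3 := eventually_nhdsWithin_iff.1 (hright t)
      have h4 : ∀ᶠ s in 𝓝 t, s < t → 0 ≤ s → Z s = Z t := by
        rcases ht.1.eq_or_lt with h | h
        · exact Eventually.of_forall fun s h5 h6 => absurd h6 (not_le.2 (h ▸ h5))
        · filter_upwards [eventually_nhdsWithin_iff.1 (hleft t h ht.2)] with s h5 h6 _
          exact h5 h6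
      filter_upwards [h3, h4] with s h5 h6 h7
      rcases lt_trichotomy s t with h | h | h
      · exact h6 h h7.1
      · rw [h]
      · exact h5 h
    exact tendsto_nhds_of_eventually_eq h2
  · intro t _
    refine (hasDerivWithinAt_const t (Ici t) (Z t)).congr_of_eventuallyEq ?_ rfl
    rw [← Ioi_insert, EventuallyEq, nhdsWithin_insert, eventually_sup, eventually_pure]
    exact ⟨rfl, hright t⟩

end Jumps

end BlowDown

end

/-! ### Matrices of frames parametrized by covectors -/

noncomputable section

namespace BlowDown

set_option synthInstance.maxHeartbeats 200000
set_option maxSynthPendingDepth 3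
set_option linter.unusedSectionVars false

variable {n : ℕ} {M : Type*} [TopologicalSpace M] [ChartedSpace (Model n) M]
  [IsManifold (𝓡 n) ∞ M]

section Coframe

/-- The standard basis vectors of the model space. -/
def stdVec (a : Fin n) : Model n := EuclideanSpace.single a (1 : ℝ)

lemma sum_smul_stdVec (w : Model n) : ∑ a, w a • stdVec a = w := by
  ext b
  simp [stdVec, Finset.sum_apply, Pi.single_apply]

lemma sum_stdVec {F : Type*} [AddCommGroup F] [Module ℝ F] (φ : Model n →ₗ[ℝ] F) (w : Model n) :
    ∑ a, w a • φ (stdVec a) = φ w := by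
  conv_rhs => rw [← sum_smul_stdVec w, map_sum]
  simp

/-- The covectors, by their components. -/
def covecEquiv : (Fin n → ℝ) ≃ₗ[ℝ] (Model n →L[ℝ] ℝ) where
  toFun k := ∑ a, k a • (EuclideanSpace.proj a : Model n →L[ℝ] ℝ)
  map_add' k l := by simp [add_smul, Finset.sum_add_distrib]
  map_smul' c k := by simp [mul_smul, Finset.smul_sum]
  invFun ξ a := ξ (stdVec a)
  left_inv k := by
    funext b
    simp [stdVec]
  right_inv ξ := by
    ext w
    conv_rhs => rw [← sum_smul_stdVec w]
    simp [mul_comm]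

lemma covecEquiv_apply (k : Fin n → ℝ) (w : Model n) : covecEquiv k w = ∑ a, k a * w a := by
  simp [covecEquiv]

/-- The dual of the standard basis. -/
def coframe : Module.Basis (Fin n) ℝ (Model n →L[ℝ] ℝ) :=
  Module.Basis.ofEquivFun covecEquiv.symm

lemma coframe_apply (a : Fin n) (w : Model n) : coframe a w = w a := by
  rw [coframe, Module.Basis.coe_ofEquivFun, LinearEquiv.symm_symm, covecEquiv_apply]
  simp [Pi.single_apply]

lemma sum_coframe {F : Type*} [AddCommGroup F] [Module ℝ F] (φ : (Model n →L[ℝ] ℝ) →ₗ[ℝ] F)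
    (k : Fin n → ℝ) : ∑ a, k a • φ (coframe a) = φ (covecEquiv k) := by
  have h := coframe.sum_equivFun (covecEquiv k)
  have h2 : (coframe (n := n)).equivFun (covecEquiv k) = k := by
    rw [coframe, Module.Basis.equivFun_ofEquivFun, LinearEquiv.symm_apply_apply]
  rw [h2] at h
  rw [← h, map_sum]
  simp

end Coframe

section Frame

lemma christoffelAt_add_left (g : Metric n M) (x : M) (y u u' v w : Model n) :
    christoffelAt g x y (u + u') v w = christoffelAt g x y u v w + christoffelAt g x y u' v w := by
  simp only [christoffelAt, map_add, _root_.add_apply]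
  ring

lemma christoffelAt_smul_left (g : Metric n M) (x : M) (y u v w : Model n) (c : ℝ) :
    christoffelAt g x y (c • u) v w = c * christoffelAt g x y u v w := by
  simp only [christoffelAt, map_smul, _root_.smul_apply, smul_eq_mul]
  ring

lemma christoffelAt_add_mid (g : Metric n M) (x : M) (y u v v' w : Model n) :
    christoffelAt g x y u (v + v') w = christoffelAt g x y u v w + christoffelAt g x y u v' w := by
  simp only [christoffelAt, map_add, _root_.add_apply]
  ring

lemma christoffelAt_smul_mid (g : Metric n M) (x : M) (y u v w : Model n) (c : ℝ) :
    christoffelAt g x y u (c • v) w = c * christoffelAt g x y u v w := by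
  simp only [christoffelAt, map_smul, _root_.smul_apply, smul_eq_mul]
  ring

/-- The identification of tangent vectors with complex covectors, as a bilinear map. -/
def complexBil (g : Metric n M) (x : M) (q : Phase n) : Phase n →ₗ[ℝ] Model n →ₗ[ℝ] ℂ :=
  LinearMap.mk₂ ℝ (complexLoc g x q)
    (fun v v' w => by
      simp only [complexLoc, Prod.fst_add, Prod.snd_add, christoffelAt_add_left, map_add,
        _root_.add_apply]
      push_cast
      ring)
    (fun c v w => by
      simp only [complexLoc, Prod.smul_fst, Prod.smul_snd, christoffelAt_smul_left, map_smul,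
        _root_.smul_apply, smul_eq_mul, Complex.real_smul]
      push_cast
      ring)
    (fun v w w' => by
      simp only [complexLoc, christoffelAt_add_mid, map_add]
      push_cast
      ring)
    (fun c v w => by
      simp only [complexLoc, christoffelAt_smul_mid, map_smul, smul_eq_mul, Complex.real_smul]
      push_cast
      ring)

lemma complexBil_apply (g : Metric n M) (x : M) (q v : Phase n) (w : Model n) :
    complexBil g x q v w = complexLoc g x q v w := rfl

lemma complexLoc_re (g : Metric n M) (x : M) (q v : Phase n) (w : Model n) :
    (complexLoc g x q v w).re = v.2 w - christoffelAt g x q.1 v.1 w (raise g x q.1 q.2) := by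
  simp [complexLoc]

lemma complexLoc_im (g : Metric n M) (x : M) (q v : Phase n) (w : Model n) :
    (complexLoc g x q v w).im = metricG g x q.1 v.1 w := by
  simp [complexLoc]

open Matrix

variable (g : Metric n M) (x : M) (q : Phase n) (E : (Model n →L[ℝ] ℝ) →L[ℝ] Phase n)

/-- The real parts of the complex covectors of a frame. -/
def frameRe : Matrix (Fin n) (Fin n) ℝ :=
  Matrix.of fun a b => (complexLoc g x q (E (coframe a)) (stdVec b)).re

/-- The base components of a frame. -/
def frameX : Matrix (Fin n) (Fin n) ℝ := Matrix.of fun a b => (E (coframe a)).1 b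

/-- The matrix of the metric. -/
def frameG (y : Model n) : Matrix (Fin n) (Fin n) ℝ :=
  Matrix.of fun a b => metricG g x y (stdVec a) (stdVec b)

/-- The pencil of a frame: its value at `i` is the determinant of the frame. -/
def framePencil : Polynomial ℝ := pencil (frameRe g x q E) (frameX E * frameG g x q.1)

variable {g x q E}

/-- A row vector multiplying the matrices of a frame is the frame evaluated at the covector with
those components; kernels of matrices become kernels of linear maps. -/
lemma vecMul_frameRe (k : Fin n → ℝ) (b : Fin n) :
    (k ᵥ* frameRe g x q E) b = (complexLoc g x q (E (covecEquiv k)) (stdVec b)).re :=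
  sum_coframe (Complex.reLm ∘ₗ ((complexBil g x q).flip (stdVec b)) ∘ₗ E.toLinearMap) k

lemma vecMul_frameX (k : Fin n → ℝ) (b : Fin n) :
    (k ᵥ* frameX E) b = (E (covecEquiv k)).1 b :=
  sum_coframe ((EuclideanSpace.proj b : Model n →L[ℝ] ℝ).toLinearMap ∘ₗ
    (LinearMap.fst ℝ (Model n) (Model n →L[ℝ] ℝ)) ∘ₗ E.toLinearMap) k

lemma vecMul_frameG (w y : Model n) (b : Fin n) :
    ((fun a => w a) ᵥ* frameG g x y) b = metricG g x y w (stdVec b) := by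
  have := sum_stdVec ((metricG g x y).flip (stdVec b) : Model n →ₗ[ℝ] ℝ) w
  exact this

lemma frameX_mul_frameG :
    frameX E * frameG g x q.1 = Matrix.of fun a b => (complexLoc g x q (E (coframe a)) (stdVec b)).im := by
  ext a b
  rw [Matrix.of_apply, complexLoc_im]
  exact vecMul_frameG _ _ b

lemma complexPencil_frame :
    complexPencil (frameRe g x q E) (frameX E * frameG g x q.1) Complex.I =
      Matrix.of fun a b => complexLoc g x q (E (coframe a)) (stdVec b) := by
  rw [frameX_mul_frameG]
  ext a b
  simp only [complexPencil, frameRe, Matrix.add_apply, Matrix.smul_apply, Matrix.map_apply,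
    Matrix.of_apply, smul_eq_mul]
  rw [mul_comm]
  exact Complex.re_add_im _

lemma eval_framePencil_I : Polynomial.aeval Complex.I (framePencil g x q E) =
    (Matrix.of fun a b => complexLoc g x q (E (coframe a)) (stdVec b)).det := by
  rw [framePencil, aeval_pencil, complexPencil_frame]

lemma pencil_mul_left (A P Q : Matrix (Fin n) (Fin n) ℝ) :
    pencil (A * P) (A * Q) = Polynomial.C A.det * pencil P Q := by
  refine Polynomial.funext fun r => ?_
  rw [Polynomial.eval_mul, Polynomial.eval_C, eval_pencil, eval_pencil, ← det_mul, mul_add,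
    mul_smul_comm]

lemma pencil_mul_right (A P Q : Matrix (Fin n) (Fin n) ℝ) :
    pencil (P * A) (Q * A) = Polynomial.C A.det * pencil P Q := by
  refine Polynomial.funext fun r => ?_
  rw [Polynomial.eval_mul, Polynomial.eval_C, eval_pencil, eval_pencil, mul_comm A.det, ← det_mul,
    add_mul, smul_mul_assoc]

lemma posDef_frameG {y : Model n} (hy : y ∈ (extChartAt (𝓡 n) x).target) :
    (frameG g x y).PosDef := by
  refine PosDef.of_dotProduct_mulVec_pos ?_ fun k hk => ?_
  · ext a b
    simp [frameG, metricG_symm g x y (stdVec b)]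
  · have h1 : (WithLp.toLp 2 k : Model n) ≠ 0 := by
      intro h
      apply hk
      funext b
      exact congrArg (fun w : Model n => w b) h
    have h2 := metricG_pos g hy h1
    have h3 := sum_stdVec (metricG g x y (WithLp.toLp 2 k) : Model n →ₗ[ℝ] ℝ) (WithLp.toLp 2 k)
    have h4 : star k ⬝ᵥ frameG g x y *ᵥ k =
        metricG g x y (WithLp.toLp 2 k) (WithLp.toLp 2 k) := by
      rw [dotProduct_mulVec, ← ContinuousLinearMap.coe_coe, ← h3, dotProduct]
      refine Finset.sum_congr rfl fun b _ => ?_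
      rw [star_trivial, mul_comm]
      exact congrArg _ (vecMul_frameG (WithLp.toLp 2 k) y b)
    rw [h4]
    exact h2

/-- The entries are real parts of one frame vector evaluated on the base component of another, and
`omega_eq_complexLoc` expresses their antisymmetric part by the symplectic form. -/
lemma isSymm_frame (hq : q.1 ∈ (extChartAt (𝓡 n) x).target)
    (hE : ∀ η₁ η₂, omega (E η₁) (E η₂) = 0) : (frameX E * (frameRe g x q E)ᵀ).IsSymm := by
  have h : ∀ a b, (frameX E * (frameRe g x q E)ᵀ) a b =
      (complexLoc g x q (E (coframe b)) (E (coframe a)).1).re := by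
    intro a b
    exact sum_stdVec (Complex.reLm ∘ₗ complexBil g x q (E (coframe b))) (E (coframe a)).1
  refine Matrix.IsSymm.ext fun a b => ?_
  rw [h, h]
  have := omega_eq_complexLoc g hq (E (coframe a)) (E (coframe b))
  rw [hE] at this
  linarith

lemma fst_eq_zero_of_vecMul {k : Fin n → ℝ} (hX : k ᵥ* frameX E = 0) :
    (E (covecEquiv k)).1 = 0 := by
  ext b
  rw [← vecMul_frameX, hX]
  rfl

lemma complexLoc_vertical (μ : Model n →L[ℝ] ℝ) (w : Model n) :
    complexLoc g x q (0, μ) w = μ w := by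
  have h : christoffelAt g x q.1 0 w (raise g x q.1 q.2) = 0 := by
    simpa using christoffelAt_smul_left g x q.1 0 w (raise g x q.1 q.2) 0
  simp [complexLoc, h]

lemma vecMul_frameRe_of_vertical {k : Fin n → ℝ} (hX : k ᵥ* frameX E = 0) (b : Fin n) :
    (k ᵥ* frameRe g x q E) b = (E (covecEquiv k)).2 (stdVec b) := by
  have h : E (covecEquiv k) = (0, (E (covecEquiv k)).2) :=
    Prod.ext (fst_eq_zero_of_vecMul hX) rfl
  rw [vecMul_frameRe, h, complexLoc_vertical, Complex.ofReal_re]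

lemma eq_zero_of_stdVec {μ : Model n →L[ℝ] ℝ} (h : ∀ b, μ (stdVec b) = 0) : μ = 0 :=
  covecEquiv.symm.injective (funext h)

/-- Without base component, the real part is the full vertical vector, so both rows vanish only for
a zero of the injective frame. -/
lemma nondegenerate_frame (hE : ∀ η, E η = 0 → η = 0) (k : Fin n → ℝ)
    (hP : k ᵥ* frameRe g x q E = 0) (hX : k ᵥ* frameX E = 0) : k = 0 := by
  have h1 : E (covecEquiv k) = 0 := by
    refine Prod.ext (fst_eq_zero_of_vecMul hX) (eq_zero_of_stdVec fun b => ?_)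
    rw [← vecMul_frameRe_of_vertical (g := g) (x := x) (q := q) hX, hP]
    rfl
  exact covecEquiv.map_eq_zero_iff.1 (hE _ h1)

/-- The pencils of two frames of the same space differ by a constant. -/
lemma framePencil_comp {A : (Model n →L[ℝ] ℝ) →L[ℝ] (Model n →L[ℝ] ℝ)}
    (hA : ∀ η, A η = 0 → η = 0) : ∃ c : ℝ, c ≠ 0 ∧
      framePencil g x q (E.comp A) = Polynomial.C c * framePencil g x q E := by
  set B : Matrix (Fin n) (Fin n) ℝ := Matrix.of fun a b => A (coframe a) (stdVec b) with hB
  have hrow : ∀ a, covecEquiv (B a) = A (coframe a) := fun a => covecEquiv.apply_symm_apply _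
  have h1 : frameRe g x q (E.comp A) = B * frameRe g x q E := by
    ext a b
    have := vecMul_frameRe (g := g) (x := x) (q := q) (E := E) (B a) b
    rw [hrow] at this
    exact this.symm
  have h2 : frameX (E.comp A) = B * frameX E := by
    ext a b
    have := vecMul_frameX (E := E) (B a) b
    rw [hrow] at this
    exact this.symm
  refine ⟨B.det, fun h0 => ?_, ?_⟩
  · obtain ⟨k, hk, hk0⟩ := exists_vecMul_eq_zero_iff.2 h0
    refine hk (covecEquiv.map_eq_zero_iff.1 (hA _ (eq_zero_of_stdVec fun b => ?_)))
    have := sum_coframe ((ContinuousLinearMap.apply ℝ ℝ (stdVec b)).toLinearMap ∘ₗ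
      (A : (Model n →L[ℝ] ℝ) →ₗ[ℝ] (Model n →L[ℝ] ℝ))) k
    exact this.symm.trans (congrFun hk0 b)
  · rw [framePencil, framePencil, h1, h2, Matrix.mul_assoc, pencil_mul_left]

/-- The matrix of a linear map of the model space. -/
def mapMatrix (D : Model n →L[ℝ] Model n) : Matrix (Fin n) (Fin n) ℝ :=
  Matrix.of fun c b => D (stdVec b) c

lemma det_mapMatrix_ne_zero {D : Model n →L[ℝ] Model n} (hD : Function.Surjective D) :
    (mapMatrix D).det ≠ 0 := by
  intro h0
  obtain ⟨k, hk, hk0⟩ := exists_vecMul_eq_zero_iff.2 h0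
  refine hk (covecEquiv.map_eq_zero_iff.1 ?_)
  ext w
  obtain ⟨u, rfl⟩ := hD w
  have h1 : (covecEquiv k).comp D = 0 := eq_zero_of_stdVec fun b => by
    rw [ContinuousLinearMap.comp_apply, covecEquiv_apply]
    exact congrFun hk0 b
  exact congrArg (fun L : Model n →L[ℝ] ℝ => L u) h1

/-- A change of chart multiplies real and imaginary parts on the right by the same invertible real
matrix. The pencil changes by a nonzero constant, so its roots do not depend on the chart. -/
lemma framePencil_cotTrans {y : M} (hq : q.1 ∈ overlap x y) : ∃ c : ℝ, c ≠ 0 ∧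
    framePencil g x q E = Polynomial.C c *
      framePencil g y (cotTrans x y q) ((fderiv ℝ (cotTrans x y) q).comp E) := by
  set D := fderiv ℝ (chartTrans x y) q.1
  set E' := (fderiv ℝ (cotTrans x y) q).comp E
  have h : ∀ a b, complexLoc g x q (E (coframe a)) (stdVec b) =
      ∑ c, (mapMatrix D c b) • complexLoc g y (cotTrans x y q) (E' (coframe a)) (stdVec c) := by
    intro a b
    rw [← complexLoc_cotTrans g hq]
    exact (sum_stdVec (complexBil g y (cotTrans x y q) (E' (coframe a))) (D (stdVec b))).symm
  refine ⟨(mapMatrix D).det,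
    det_mapMatrix_ne_zero fun w => fderiv_chartTrans_surjective hq w, ?_⟩
  rw [framePencil, framePencil, ← pencil_mul_right, frameX_mul_frameG, frameX_mul_frameG]
  congr 1
  · ext a b
    simp only [frameRe, Matrix.of_apply, Matrix.mul_apply, h, Complex.re_sum, Complex.smul_re,
      smul_eq_mul]
    exact Finset.sum_congr rfl fun c _ => mul_comm _ _
  · ext a b
    simp only [Matrix.of_apply, Matrix.mul_apply, h, Complex.im_sum, Complex.smul_im, smul_eq_mul]
    exact Finset.sum_congr rfl fun c _ => mul_comm _ _

/-- The kernel of the projection of a frame to the base. -/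
lemma finrank_ker_add_rank :
    Module.finrank ℝ (LinearMap.ker ((LinearMap.fst ℝ (Model n) (Model n →L[ℝ] ℝ)) ∘ₗ
      E.toLinearMap)) + (frameX E).rank = n := by
  set φ := (LinearMap.fst ℝ (Model n) (Model n →L[ℝ] ℝ)) ∘ₗ
      E.toLinearMap with hφ
  have h1 : (frameX E).rank = Module.finrank ℝ (LinearMap.range φ) := by
    rw [← rank_transpose, Matrix.rank]
    have h2 : (frameX E)ᵀ.mulVecLin = (WithLp.linearEquiv 2 ℝ (Fin n → ℝ)).toLinearMap ∘ₗ φ ∘ₗ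
        covecEquiv.toLinearMap := by
      refine LinearMap.ext fun k => funext fun b => ?_
      rw [Matrix.mulVecLin_apply, mulVec_transpose, vecMul_frameX]
      rfl
    rw [h2, LinearMap.range_comp, LinearEquiv.finrank_map_eq, LinearMap.range_comp_of_range_eq_top]
    exact covecEquiv.range
  rw [h1, add_comm, LinearMap.finrank_range_add_finrank_ker,
    ← LinearEquiv.finrank_eq (covecEquiv (n := n)), Module.finrank_fin_fun]

end Frame

end BlowDown

end

/-! ### Regularity and isotropy of the frame along an orbit -/

noncomputable section

open Filter Topology

namespace BlowDown

set_option synthInstance.maxHeartbeats 200000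
set_option maxSynthPendingDepth 3
set_option linter.unusedSectionVars false

variable {n : ℕ} {M : Type*} [TopologicalSpace M] [ChartedSpace (Model n) M]
  [IsManifold (𝓡 n) ∞ M]

section Regularity

lemma contDiffAt_metricG (g : Metric n M) {x : M} {y : Model n}
    (hy : y ∈ (extChartAt (𝓡 n) x).target) : ContDiffAt ℝ ∞ (metricG g x) y :=
  (contDiffOn_metricG g x).contDiffAt ((isOpen_extChartAt_target x).mem_nhds hy)

set_option maxSynthPendingDepth 3 in
lemma differentiableAt_christoffel {E F V : Type*} [NormedAddCommGroup E] [NormedSpace ℝ E]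
    [NormedAddCommGroup F] [NormedSpace ℝ F] [NormedAddCommGroup V] [NormedSpace ℝ V]
    {B : E → E →L[ℝ] E →L[ℝ] ℝ} {R : E → F →L[ℝ] E} {y u : V → E} {m : V → F} {p : V}
    (hB : ContDiffAt ℝ ∞ B (y p)) (hR : DifferentiableAt ℝ R (y p))
    (hy : DifferentiableAt ℝ y p) (hu : DifferentiableAt ℝ u p) (hm : DifferentiableAt ℝ m p)
    (w : E) :
    DifferentiableAt ℝ (fun p => (fderiv ℝ B (y p) (u p) w (R (y p) (m p)) +
      fderiv ℝ B (y p) w (u p) (R (y p) (m p)) -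
      fderiv ℝ B (y p) (R (y p) (m p)) (u p) w) / 2) p := by
  have hA : DifferentiableAt ℝ (fun p => fderiv ℝ B (y p)) p := by
    have h1 : DifferentiableAt ℝ (fderiv ℝ B) (y p) :=
      (hB.fderiv_right (m := ∞) (by simp)).differentiableAt (by simp)
    exact DifferentiableAt.comp p h1 hy
  have hR' : DifferentiableAt ℝ (fun p => R (y p) (m p)) p :=
    (DifferentiableAt.comp p hR hy).clm_apply hm
  have hw : DifferentiableAt ℝ (fun _ : V => w) p := differentiableAt_const w
  have h3 := (((hA.clm_apply hu).clm_apply hw).clm_apply hR').add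
    (((hA.clm_apply hw).clm_apply hu).clm_apply hR')
  have h4 := (h3.sub (((hA.clm_apply hR').clm_apply hu).clm_apply hw)).mul_const (2⁻¹ : ℝ)
  exact h4.congr_of_eventuallyEq (Eventually.of_forall fun p => div_eq_mul_inv _ _)

lemma differentiableAt_complexLoc_re (g : Metric n M) {x : M} {q : Phase n}
    (hq : q.1 ∈ (extChartAt (𝓡 n) x).target) (v : Phase n) (w : Model n) :
    DifferentiableAt ℝ (fun p : Phase n × Phase n => (complexLoc g x p.1 p.2 w).re) (q, v) := by
  have hR : DifferentiableAt ℝ (raise g x) q.1 :=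
    ((contDiffOn_raise g x).contDiffAt ((isOpen_extChartAt_target x).mem_nhds hq)).differentiableAt
      (by simp)
  have h1 := differentiableAt_christoffel (p := (q, v)) (y := fun p : Phase n × Phase n => p.1.1)
    (u := fun p : Phase n × Phase n => p.2.1) (m := fun p : Phase n × Phase n => p.1.2)
    (contDiffAt_metricG g hq) hR (by fun_prop) (by fun_prop) (by fun_prop) w
  have h2 : DifferentiableAt ℝ (fun p : Phase n × Phase n => p.2.2 w) (q, v) :=
    DifferentiableAt.clm_apply (c := fun p : Phase n × Phase n => p.2.2) (by fun_prop)
      (differentiableAt_const w)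
  refine (h2.sub h1).congr_of_eventuallyEq (Eventually.of_forall fun p => ?_)
  exact complexLoc_re g x p.1 p.2 w

/-- The base velocity is linear in the covector. This is the origin of the positive sign of every
crossing with the vertical. -/
lemma fderiv_geoField_vertical (g : Metric n M) {x : M} {q : Phase n}
    (hq : q.1 ∈ (extChartAt (𝓡 n) x).target) (μ : Model n →L[ℝ] ℝ) :
    (fderiv ℝ (geoField g x) q (0, μ)).1 = raise g x q.1 μ := by
  have h1 : HasFDerivAt (geoField g x) (fderiv ℝ (geoField g x) q) q :=
    (((contDiffOn_geoField g x).contDiffAt ((isOpen_cotTarget x).mem_nhds hq)).differentiableAt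
      (by simp)).hasFDerivAt
  have h2 : HasDerivAt (fun s : ℝ => q + s • ((0, μ) : Phase n)) (0, μ) 0 := by
    simpa using ((hasDerivAt_id (0 : ℝ)).smul_const ((0, μ) : Phase n)).const_add q
  have h3 : HasDerivAt (fun s : ℝ => (geoField g x (q + s • ((0, μ) : Phase n))).1)
      (fderiv ℝ (geoField g x) q (0, μ)).1 0 := by
    have h4 : HasFDerivAt (geoField g x) (fderiv ℝ (geoField g x) q)
        (q + (0 : ℝ) • ((0, μ) : Phase n)) := by
      rw [zero_smul, add_zero]
      exact h1
    have h5 := h4.comp_hasDerivAt (0 : ℝ) h2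
    exact hasDerivAt_fst' h5
  have h4 : HasDerivAt (fun s : ℝ => raise g x q.1 q.2 + s • raise g x q.1 μ)
      (raise g x q.1 μ) 0 := by
    simpa using ((hasDerivAt_id (0 : ℝ)).smul_const (raise g x q.1 μ)).const_add (raise g x q.1 q.2)
  refine h3.unique (h4.congr_of_eventuallyEq (Eventually.of_forall fun s => ?_))
  simp [geoField]

end Regularity

section Orbit

variable {g : Metric n M} {z : M} {T : ℝ} [T2Space M] (hb : IsBlowDownPoint g z T)
  {t : ℝ} {ξ : Model n →L[ℝ] ℝ} {x : M}
include hb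

lemma ell_change {y : M} (hx : (iota g z t ξ).1 ∈ (extChartAt (𝓡 n) x).source)
    (hy : (iota g z t ξ).1 ∈ (extChartAt (𝓡 n) y).source) :
    ell g z y t ξ = (fderiv ℝ (cotTrans x y) (cotChart n x (iota g z t ξ))).comp
      (ell g z x t ξ) := by
  ext1 η
  rw [ContinuousLinearMap.comp_apply, ell_apply, ell_apply,
    jac_change hb.isCompleteAt hx hy, speed_change hb.isCompleteAt hx hy, map_add, map_smul]
  rfl

/-- The two variations are orthogonal to each other, and each is orthogonal to the flow direction
because its initial covector is tangent to the sphere. -/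
lemma omega_ell (hξ : ξ ∈ unitCosphere g z)
    (hx : (iota g z t ξ).1 ∈ (extChartAt (𝓡 n) x).source) (η₁ η₂ : Model n →L[ℝ] ℝ) :
    omega (ell g z x t ξ η₁) (ell g z x t ξ η₂) = 0 := by
  rw [ell_apply, ell_apply]
  set ζ₁ := η₁ - η₁ (sharpAt g z ξ) • ξ with hζ₁
  set ζ₂ := η₂ - η₂ (sharpAt g z ξ) • ξ with hζ₂
  have h1 := omega_jac_jac hb.isCompleteAt hx ζ₁ ζ₂
  have h2 := omega_jac_speed hb.isCompleteAt hx ζ₁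
  have h3 := omega_jac_speed hb.isCompleteAt hx ζ₂
  rw [apply_sharpAt_sub hξ] at h2 h3
  simp only [omega, Prod.fst_add, Prod.snd_add, Prod.smul_fst, Prod.smul_snd, map_add, map_smul,
    _root_.add_apply, _root_.smul_apply, smul_eq_mul] at h1 h2 h3 ⊢
  linear_combination h1 + (η₂ (sharpAt g z ξ)) * h2 - (η₁ (sharpAt g z ξ)) * h3

lemma action_ell (hξ : ξ ∈ unitCosphere g z)
    (hx : (iota g z t ξ).1 ∈ (extChartAt (𝓡 n) x).source) (η : Model n →L[ℝ] ℝ) :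
    (cotChart n x (iota g z t ξ)).2 (ell g z x t ξ η).1 = η (sharpAt g z ξ) := by
  rw [ell_apply, Prod.fst_add, Prod.smul_fst, map_add, map_smul,
    action_jac hb.isCompleteAt hx, action_speed hb.isCompleteAt hx, apply_sharpAt_sub hξ,
    mem_unitCosphere.1 hξ]
  simp

/-- The action form kills vertical vectors and takes the value `η(ξ^♯)` on the frame, so the flow
direction is absent from vertical vectors. -/
lemma ell_of_fst_eq_zero (hξ : ξ ∈ unitCosphere g z)
    (hx : (iota g z t ξ).1 ∈ (extChartAt (𝓡 n) x).source) {η : Model n →L[ℝ] ℝ}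
    (h : (ell g z x t ξ η).1 = 0) : η (sharpAt g z ξ) = 0 ∧ ell g z x t ξ η = jac g z x t ξ η := by
  have h1 := action_ell hb hξ hx η
  rw [h, map_zero] at h1
  refine ⟨h1.symm, ?_⟩
  rw [ell_apply, ← h1]
  simp

lemma ell_eq_zero (hξ : ξ ∈ unitCosphere g z)
    (hx : (iota g z t ξ).1 ∈ (extChartAt (𝓡 n) x).source) (η : Model n →L[ℝ] ℝ)
    (h : ell g z x t ξ η = 0) : η = 0 := by
  have h1 := ell_of_fst_eq_zero hb hξ hx (congrArg Prod.fst h)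
  rw [h1.2] at h
  exact (jac_eq_zero_iff hb.isCompleteAt hx).1 h

/-- Both the flow direction and the variations solve the variational equation, and the coefficients
do not depend on time. -/
lemma hasDerivAt_ell (hx : (iota g z t ξ).1 ∈ (extChartAt (𝓡 n) x).source)
    (η : Model n →L[ℝ] ℝ) :
    HasDerivAt (fun s => ell g z x s ξ η)
      (fderiv ℝ (geoField g x) (cotChart n x (iota g z t ξ)) (ell g z x t ξ η)) t := by
  have h1 := (hasDerivAt_speed hb.isCompleteAt hx).const_smul (η (sharpAt g z ξ))
  have h2 := (hasDerivAt_jac hb.isCompleteAt hx).clm_apply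
    (hasDerivAt_const t (η - η (sharpAt g z ξ) • ξ))
  refine (h1.add h2).congr_deriv ?_
  rw [ell_apply, map_add, map_smul, map_zero, add_zero]
  rfl

lemma continuousAt_ell (hx : (iota g z t ξ).1 ∈ (extChartAt (𝓡 n) x).source)
    (η : Model n →L[ℝ] ℝ) :
    ContinuousAt (fun p : ℝ × (Model n →L[ℝ] ℝ) => ell g z x p.1 p.2 η) (t, ξ) := by
  have h1 : ContinuousAt (fun p : ℝ × (Model n →L[ℝ] ℝ) => η (sharpAt g z p.2)) (t, ξ) := by
    fun_prop
  have h2 := continuousAt_jac hb.isCompleteAt hx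
  have h3 := continuousAt_speed hb.isCompleteAt hx
  exact (h1.smul h3).add (h2.clm_apply (continuousAt_const.sub (h1.smul continuousAt_snd)))

lemma continuousAt_complexLoc_ell (hx : (iota g z t ξ).1 ∈ (extChartAt (𝓡 n) x).source)
    (η : Model n →L[ℝ] ℝ) (w : Model n) :
    ContinuousAt (fun p : ℝ × (Model n →L[ℝ] ℝ) =>
      complexLoc g x (cotChart n x (iota g z p.1 p.2)) (ell g z x p.1 p.2 η) w) (t, ξ) := by
  have hq := cotChart_mem_target hx
  have h1 := (continuousAt_cotChart_iota hb.isCompleteAt hx)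
  have h2 := continuousAt_ell hb hx η
  have h3 : ContinuousAt (fun p : ℝ × (Model n →L[ℝ] ℝ) =>
      (complexLoc g x (cotChart n x (iota g z p.1 p.2)) (ell g z x p.1 p.2 η) w).re) (t, ξ) :=
    ContinuousAt.comp (x := (t, ξ))
      (f := fun p : ℝ × (Model n →L[ℝ] ℝ) => (cotChart n x (iota g z p.1 p.2), ell g z x p.1 p.2 η))
      (differentiableAt_complexLoc_re g hq (ell g z x t ξ η) w).continuousAt (h1.prodMk h2)
  have h4 : ContinuousAt (fun p : ℝ × (Model n →L[ℝ] ℝ) =>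
      (complexLoc g x (cotChart n x (iota g z p.1 p.2)) (ell g z x p.1 p.2 η) w).im) (t, ξ) := by
    simp only [complexLoc_im]
    have h5 : ContinuousAt (fun p : ℝ × (Model n →L[ℝ] ℝ) =>
        metricG g x (cotChart n x (iota g z p.1 p.2)).1) (t, ξ) :=
      ContinuousAt.comp (x := (t, ξ))
        (f := fun p : ℝ × (Model n →L[ℝ] ℝ) => (cotChart n x (iota g z p.1 p.2)).1)
        (contDiffAt_metricG g hq).continuousAt h1.fst
    exact (h5.clm_apply h2.fst).clm_apply continuousAt_const
  have h6 := ((Complex.continuous_ofReal.continuousAt.comp h3).add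
    ((Complex.continuous_ofReal.continuousAt.comp h4).mul (continuousAt_const (y := Complex.I))))
  refine h6.congr (Eventually.of_forall fun p => ?_)
  exact Complex.re_add_im _

end Orbit

end BlowDown

end

/-! ### Conjugate times and the jump of the phase along an orbit -/

noncomputable section

open Filter Topology

namespace BlowDown

set_option synthInstance.maxHeartbeats 200000
set_option maxSynthPendingDepth 3
set_option linter.unusedSectionVars false

variable {n : ℕ} {M : Type*} [TopologicalSpace M] [ChartedSpace (Model n) M]
  [IsManifold (𝓡 n) ∞ M]

section Multiplicity

/-- The projection to the base of a frame of tangent vectors. -/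
def baseMap (g : Metric n M) (z x : M) (t : ℝ) (ξ : Model n →L[ℝ] ℝ) :
    (Model n →L[ℝ] ℝ) →ₗ[ℝ] Model n :=
  (LinearMap.fst ℝ (Model n) (Model n →L[ℝ] ℝ)) ∘ₗ (ell g z x t ξ).toLinearMap

/-- The dimension of the vertical part of the tangent space of the blow-down Lagrangian. -/
def orbitMult (g : Metric n M) (z : M) (t : ℝ) (ξ : Model n →L[ℝ] ℝ) : ℕ :=
  Module.finrank ℝ (LinearMap.ker (baseMap g z (iota g z t ξ).1 t ξ))

/-- The pencil of the tangent space of the blow-down Lagrangian along an orbit. -/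
def orbitPencil (g : Metric n M) (z x : M) (t : ℝ) (ξ : Model n →L[ℝ] ℝ) : Polynomial ℝ :=
  framePencil g x (cotChart n x (iota g z t ξ)) (ell g z x t ξ)

variable {g : Metric n M} {z : M} {T : ℝ} [T2Space M] (hb : IsBlowDownPoint g z T)
  {t : ℝ} {ξ : Model n →L[ℝ] ℝ} {x : M}
include hb

lemma ker_baseMap_change {y : M} (hx : (iota g z t ξ).1 ∈ (extChartAt (𝓡 n) x).source)
    (hy : (iota g z t ξ).1 ∈ (extChartAt (𝓡 n) y).source) :
    LinearMap.ker (baseMap g z y t ξ) = LinearMap.ker (baseMap g z x t ξ) := by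
  have hq := cotChart_mem_overlap hx hy
  have h1 : Function.Injective
      (fderiv ℝ (chartTrans x y) (cotChart n x (iota g z t ξ)).1).toLinearMap :=
    LinearMap.injective_iff_surjective.2 fun w => fderiv_chartTrans_surjective hq w
  have h2 : ∀ η, baseMap g z y t ξ η =
      (fderiv ℝ (chartTrans x y) (cotChart n x (iota g z t ξ)).1).toLinearMap
        (baseMap g z x t ξ η) := by
    intro η
    change (ell g z y t ξ η).1 = _
    rw [ell_change hb hx hy, ContinuousLinearMap.comp_apply, (fderiv_cotTrans hq _).1]
    rfl
  ext η
  rw [LinearMap.mem_ker, LinearMap.mem_ker, h2, map_eq_zero_iff _ h1]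

lemma orbitMult_add_rank (hx : (iota g z t ξ).1 ∈ (extChartAt (𝓡 n) x).source) :
    orbitMult g z t ξ + (frameX (ell g z x t ξ)).rank = n := by
  rw [orbitMult, ker_baseMap_change hb hx (mem_extChartAt_source _)]
  exact finrank_ker_add_rank

lemma orbitPencil_change {y : M} (hx : (iota g z t ξ).1 ∈ (extChartAt (𝓡 n) x).source)
    (hy : (iota g z t ξ).1 ∈ (extChartAt (𝓡 n) y).source) :
    ∃ c : ℝ, c ≠ 0 ∧ orbitPencil g z x t ξ = Polynomial.C c * orbitPencil g z y t ξ := by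
  obtain ⟨c, hc, h⟩ := framePencil_cotTrans (g := g) (E := ell g z x t ξ)
    (cotChart_mem_overlap hx hy)
  refine ⟨c, hc, ?_⟩
  rw [orbitPencil, h, orbitPencil, ell_change hb hx hy, cotTrans_cotChart hx]

/-- By homogeneity `exp_z ζ` is the projection of `ι(t, t⁻¹ ζ)`, so the kernel of its differential
is that of the projected variation. The Gauss lemma puts this kernel in the orthogonal complement of
`ξ`, where `ell` and `jac` agree. Both uses of `t ≠ 0` are essential. -/
lemma conjMultiplicity_eq (hξ : ξ ∈ unitCosphere g z) (ht : t ≠ 0) :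
    conjMultiplicity g z ξ t = orbitMult g z t ξ := by
  have hz := hb.isCompleteAt
  have hx := mem_extChartAt_source (I := 𝓡 n) (iota g z t ξ).1
  set x := (iota g z t ξ).1 with hxdef
  have hexp : expMap g z = fun ζ => (iota g z t (t⁻¹ • ζ)).1 := by
    funext ζ
    rw [← expMap_smul hz, smul_inv_smul₀ ht]
  have hbase : t⁻¹ • (t • ξ) = ξ := inv_smul_smul₀ ht ξ
  have hexp0 : expMap g z (t • ξ) = x := expMap_smul hz t ξ
  set L : (Model n →L[ℝ] ℝ) →L[ℝ] Model n :=
    (ContinuousLinearMap.fst ℝ (Model n) (Model n →L[ℝ] ℝ)).comp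
      ((jac g z x t ξ).comp (t⁻¹ • ContinuousLinearMap.id ℝ _)) with hL
  have hcont : Continuous (expMap g z) := by
    rw [hexp]
    exact continuous_proj'.comp ((continuous_iota hz).comp
      (continuous_const.prodMk (continuous_const_smul _)))
  have hd : HasMFDerivAt 𝓘(ℝ, Model n →L[ℝ] ℝ) (𝓡 n) (expMap g z) (t • ξ) L := by
    rw [hasMFDerivAt_iff_written]
    refine ⟨hcont.continuousAt, ?_⟩
    have h1 : HasFDerivAt (fun ζ : Model n →L[ℝ] ℝ => cotChart n x (iota g z t (t⁻¹ • ζ)))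
        ((jac g z x t ξ).comp (t⁻¹ • ContinuousLinearMap.id ℝ _)) (t • ξ) := by
      have h2 : HasFDerivAt (fun ζ : Model n →L[ℝ] ℝ => t⁻¹ • ζ)
          (t⁻¹ • ContinuousLinearMap.id ℝ (Model n →L[ℝ] ℝ)) (t • ξ) :=
        (hasFDerivAt_id (t • ξ)).const_smul t⁻¹
      have h3 := hasFDerivAt_jac hz hx
      rw [← hbase] at h3
      have h4 := h3.comp (t • ξ) h2
      rw [hbase] at h4
      exact h4
    have h5 := (ContinuousLinearMap.fst ℝ (Model n) (Model n →L[ℝ] ℝ)).hasFDerivAt.comp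
      (t • ξ) h1
    refine h5.congr_of_eventuallyEq ?_
    have h6 : ∀ᶠ ζ in 𝓝 (t • ξ), expMap g z ζ ∈ (extChartAt (𝓡 n) x).source :=
      hcont.continuousAt.eventually_mem ((isOpen_extChartAt_source x).mem_nhds (by
        rw [hexp0]; exact hx))
    filter_upwards [h6] with ζ hζ
    have h7 : writtenInExtChartAt 𝓘(ℝ, Model n →L[ℝ] ℝ) (𝓡 n) (t • ξ) (expMap g z) ζ =
        extChartAt (𝓡 n) (expMap g z (t • ξ)) (expMap g z ζ) := rfl
    rw [h7, hexp0]
    rw [hexp] at hζ ⊢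
    exact (cotChart_fst hζ).symm
  have hker : LinearMap.ker L.toLinearMap = LinearMap.ker (baseMap g z x t ξ) := by
    ext η
    have h1 : L η = t⁻¹ • (jac g z x t ξ η).1 := by
      simp [hL]
    have h2 : baseMap g z x t ξ η = (ell g z x t ξ η).1 := rfl
    rw [LinearMap.mem_ker, LinearMap.mem_ker, ContinuousLinearMap.coe_coe, h1, h2,
      smul_eq_zero_iff_right (inv_ne_zero ht)]
    constructor
    · intro h
      have h3 := action_jac hz hx η
      rw [h, map_zero, eq_comm, mul_eq_zero, or_iff_right ht] at h3
      rw [ell_apply, h3]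
      simpa using h
    · intro h
      rw [← (ell_of_fst_eq_zero hb hξ hx h).2, h]
  rw [conjMultiplicity, hd.mfderiv, orbitMult, ← hker]
  rfl

/-- The jump of the squared phase along an orbit, compared with the multiplicity of the conjugate
times. -/
theorem orbit_jump (hξ : ξ ∈ unitCosphere g z) {Θ : ℝ → ℝ} (hΘ : Continuous Θ)
    (hΘ' : ∀ t, Polynomial.aeval Complex.I (orbitPencil g z (iota g z t ξ).1 t ξ) ^ 2 =
      (‖Polynomial.aeval Complex.I (orbitPencil g z (iota g z t ξ).1 t ξ)‖ ^ 2 : ℝ) *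
        Complex.exp (Θ t * Complex.I)) (t₀ : ℝ) :
    (∀ᶠ s in 𝓝[>] t₀,
      (Θ s - 2 * rootArg (orbitPencil g z (iota g z s ξ).1 s ξ)) / (2 * Real.pi) =
        (Θ t₀ - 2 * rootArg (orbitPencil g z (iota g z t₀ ξ).1 t₀ ξ)) / (2 * Real.pi) ∧
      orbitMult g z s ξ = 0) ∧
    (∀ᶠ s in 𝓝[<] t₀,
      (Θ s - 2 * rootArg (orbitPencil g z (iota g z s ξ).1 s ξ)) / (2 * Real.pi) =
        (Θ t₀ - 2 * rootArg (orbitPencil g z (iota g z t₀ ξ).1 t₀ ξ)) / (2 * Real.pi) -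
          orbitMult g z t₀ ξ ∧
      orbitMult g z s ξ = 0) := by
  have hz := hb.isCompleteAt
  have hx := mem_extChartAt_source (I := 𝓡 n) (iota g z t₀ ξ).1
  set x := (iota g z t₀ ξ).1 with hxdef
  set q : ℝ → Phase n := fun t => cotChart n x (iota g z t ξ) with hqdef
  set E : ℝ → (Model n →L[ℝ] ℝ) →L[ℝ] Phase n := fun t => ell g z x t ξ with hEdef
  have hev := eventually_iota_mem_time hz hx
  have hqd : ∀ t, (iota g z t ξ).1 ∈ (extChartAt (𝓡 n) x).source →
      HasDerivAt q (speed g z x t ξ) t := fun t ht => hasDerivAt_iota hz ht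
  have hXd : ∀ t, (iota g z t ξ).1 ∈ (extChartAt (𝓡 n) x).source → ∀ i j,
      HasDerivAt (fun t => frameX (E t) i j)
        ((fderiv ℝ (geoField g x) (q t) (E t (coframe i))).1 j) t := fun t ht i j =>
    (EuclideanSpace.proj j : Model n →L[ℝ] ℝ).hasFDerivAt.comp_hasDerivAt t
      (hasDerivAt_fst' (hasDerivAt_ell hb ht (coframe i)))
  have hPd : ∀ t, (iota g z t ξ).1 ∈ (extChartAt (𝓡 n) x).source → ∀ i j,
      DifferentiableAt ℝ (fun t => frameRe g x (q t) (E t) i j) t := fun t ht i j =>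
    DifferentiableAt.comp (f := fun t => (q t, E t (coframe i))) t
      (differentiableAt_complexLoc_re g (cotChart_mem_target ht) (E t (coframe i)) (stdVec j))
      ((hqd t ht).differentiableAt.prodMk (hasDerivAt_ell hb ht (coframe i)).differentiableAt)
  have hGd : ∀ t, (iota g z t ξ).1 ∈ (extChartAt (𝓡 n) x).source → ∀ i j,
      DifferentiableAt ℝ (fun t => frameG g x (q t).1 i j) t := by
    intro t ht i j
    have h1 := ((contDiffAt_metricG g (cotChart_mem_target ht)).differentiableAt (by simp))
    have h2 : DifferentiableAt ℝ (fun t => metricG g x (q t).1) t :=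
      DifferentiableAt.comp (f := fun t => (q t).1) t h1 (hqd t ht).differentiableAt.fst
    exact (h2.clm_apply (differentiableAt_const (stdVec i))).clm_apply
      (differentiableAt_const (stdVec j))
  have hcont : ∀ {A : ℝ → Matrix (Fin n) (Fin n) ℝ} {t : ℝ},
      (∀ i j, ContinuousAt (fun t => A t i j) t) → ContinuousAt A t := fun h =>
    continuousAt_pi.2 fun i => continuousAt_pi.2 fun j => h i j
  have hjump := indexFun_jump (P := fun t => frameRe g x (q t) (E t)) (X := fun t => frameX (E t))
    (G := fun t => frameG g x (q t).1) (t₀ := t₀) (Θ := Θ)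
    (P' := Matrix.of fun i j => deriv (fun t => frameRe g x (q t) (E t) i j) t₀)
    (X' := Matrix.of fun i j => (fderiv ℝ (geoField g x) (q t₀) (E t₀ (coframe i))).1 j)
    (G' := Matrix.of fun i j => deriv (fun t => frameG g x (q t).1 i j) t₀)
    (hev.mono fun t ht => hcont fun i j => (hPd t ht i j).continuousAt)
    (hev.mono fun t ht => hcont fun i j => (hXd t ht i j).continuousAt)
    (hev.mono fun t ht => hcont fun i j => (hGd t ht i j).continuousAt)
    (fun i j => (hPd t₀ hx i j).hasDerivAt)
    (fun i j => hXd t₀ hx i j)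
    (fun i j => (hGd t₀ hx i j).hasDerivAt)
    (hev.mono fun t ht => posDef_frameG (cotChart_mem_target ht))
    (hev.mono fun t ht => isSymm_frame (cotChart_mem_target ht) (omega_ell hb hξ ht))
    (nondegenerate_frame (ell_eq_zero hb hξ hx)) ?_ hΘ.continuousAt ?_
  · rw [Fintype.card_fin] at hjump
    -- The jump is computed in the fixed chart at time `t₀`; replacing it by the chart at each point
    -- rescales the pencil and leaves the branch unchanged.
    have hindex : ∀ t, (iota g z t ξ).1 ∈ (extChartAt (𝓡 n) x).source →
        indexFun Θ (fun t => frameRe g x (q t) (E t)) (fun t => frameX (E t))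
          (fun t => frameG g x (q t).1) t =
        (Θ t - 2 * rootArg (orbitPencil g z (iota g z t ξ).1 t ξ)) / (2 * Real.pi) := by
      intro t ht
      obtain ⟨c, hc, h⟩ := orbitPencil_change hb ht (mem_extChartAt_source (I := 𝓡 n) (iota g z t ξ).1)
      have h1 : rootArg (orbitPencil g z x t ξ) =
          rootArg (orbitPencil g z (iota g z t ξ).1 t ξ) := by rw [h, rootArg_C_mul hc]
      rw [← h1]
      rfl
    have hmult : ∀ t, (iota g z t ξ).1 ∈ (extChartAt (𝓡 n) x).source →
        orbitMult g z t ξ = n - (frameX (E t)).rank := by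
      intro t ht
      have := orbitMult_add_rank hb ht
      change _ + (frameX (E t)).rank = n at this
      omega
    refine ⟨?_, ?_⟩
    · filter_upwards [hjump.1, nhdsWithin_le_nhds hev] with s h1 h2
      rw [← hindex s h2, ← hindex t₀ hx, hmult s h2]
      exact ⟨h1.1, by rw [h1.2, Nat.sub_self]⟩
    · filter_upwards [hjump.2, nhdsWithin_le_nhds hev] with s h1 h2
      rw [← hindex s h2, ← hindex t₀ hx, hmult s h2, hmult t₀ hx]
      exact ⟨h1.1, by rw [h1.2, Nat.sub_self]⟩
  -- The crossing condition: a frame vector without base component is vertical, its base velocity is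
  -- the raised covector, and lowering the index recovers the real part.
  · intro k hk
    have hq := cotChart_mem_target hx
    have h1 : E t₀ (covecEquiv k) = (0, (E t₀ (covecEquiv k)).2) :=
      Prod.ext (fst_eq_zero_of_vecMul hk) rfl
    have h2 : ∀ b, Matrix.vecMul k (Matrix.of fun i j =>
        (fderiv ℝ (geoField g x) (q t₀) (E t₀ (coframe i))).1 j) b =
        raise g x (q t₀).1 (E t₀ (covecEquiv k)).2 b := by
      intro b
      rw [← fderiv_geoField_vertical g hq, ← h1]
      exact vecMul_frameX (E := (fderiv ℝ (geoField g x) (q t₀)).comp (E t₀)) k b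
    funext b
    rw [vecMul_frameRe_of_vertical hk, funext h2, vecMul_frameG, metricG_raise g hq]
  · filter_upwards [hev] with t ht
    obtain ⟨c, hc, h⟩ := orbitPencil_change hb ht (mem_extChartAt_source (I := 𝓡 n) (iota g z t ξ).1)
    have h1 : (complexPencil (frameRe g x (q t) (E t)) (frameX (E t) * frameG g x (q t).1)
        Complex.I).det = Polynomial.aeval Complex.I (orbitPencil g z x t ξ) :=
      (aeval_pencil _ _ _).symm
    rw [h1, h, map_mul, Polynomial.aeval_C, norm_mul, mul_pow, mul_pow, hΘ' t]
    simp only [Complex.coe_algebraMap, Complex.norm_real, Real.norm_eq_abs, sq_abs]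
    push_cast
    ring

end Multiplicity

end BlowDown

end

/-! ### The squared phase as a function on the blow-down Lagrangian -/

noncomputable section

open Filter Topology

namespace BlowDown

set_option synthInstance.maxHeartbeats 200000
set_option maxSynthPendingDepth 3
set_option linter.unusedSectionVars false

variable {n : ℕ} {M : Type*} [TopologicalSpace M] [ChartedSpace (Model n) M]
  [IsManifold (𝓡 n) ∞ M]

section Lifting

lemma exp_injOn_paths {f h : ℝ → ℝ} (hf : Continuous f) (hh : Continuous h)
    (heq : ∀ t, Circle.exp (f t) = Circle.exp (h t)) {t₀ : ℝ} (h0 : f t₀ = h t₀) : f = h :=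
  Circle.isCoveringMap_exp.eq_of_comp_eq hf hh (funext heq) t₀ h0

/-- The phase of a family of paths on the circle with the same initial value. -/
lemma exists_phase {B : Type*} [TopologicalSpace B] (c : C(ℝ × B, Circle)) (θ₀ : ℝ)
    (h0 : ∀ b, c (0, b) = Circle.exp θ₀) :
    ∃ Θ : ℝ × B → ℝ, Continuous Θ ∧ (∀ p, Circle.exp (Θ p) = c p) ∧ ∀ b, Θ (0, b) = θ₀ := by
  -- Contracting time to `0` makes the family a homotopy starting at a constant, which lifts jointly
  -- continuously in the parameter.
  let C' : C(unitInterval × (ℝ × B), Circle) :=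
    c.comp ⟨fun p => ((p.1 : ℝ) * p.2.1, p.2.2), by fun_prop⟩
  have h1 : ∀ a : ℝ × B, C' (0, a) = Circle.exp (ContinuousMap.const (ℝ × B) θ₀ a) := by
    intro a
    have h2 : C' (0, a) = c (((0 : unitInterval) : ℝ) * a.1, a.2) := rfl
    rw [h2, Set.Icc.coe_zero, zero_mul, h0]
    rfl
  let H := Circle.isCoveringMap_exp.liftHomotopy C' (ContinuousMap.const (ℝ × B) θ₀) h1
  have hlift : ∀ p, Circle.exp (H p) = C' p := fun p =>
    congrFun (Circle.isCoveringMap_exp.liftHomotopy_lifts C' _ h1) p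
  have hzero : ∀ a, H (0, a) = θ₀ := fun a =>
    Circle.isCoveringMap_exp.liftHomotopy_zero C' _ h1 a
  refine ⟨fun p => H (1, p), by fun_prop, fun p => ?_, fun b => ?_⟩
  · rw [hlift]
    have h2 : C' (1, p) = c (((1 : unitInterval) : ℝ) * p.1, p.2) := rfl
    rw [h2, Set.Icc.coe_one, one_mul]
  · have h2 : ∀ τ, Circle.exp (H (τ, ((0 : ℝ), b))) = Circle.exp θ₀ := by
      intro τ
      have h3 : C' (τ, ((0 : ℝ), b)) = c ((τ : ℝ) * 0, b) := rfl
      rw [hlift, h3, mul_zero, h0]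
    have h3 : (fun τ : unitInterval => H (τ, ((0 : ℝ), b))) = fun _ => θ₀ :=
      Circle.isCoveringMap_exp.eq_of_comp_eq (by fun_prop) continuous_const (funext h2) 0
        (hzero _)
    exact congrFun h3 1

end Lifting

section OrbitPhase

/-- The determinant of the tangent space of the blow-down Lagrangian. -/
def orbitDet (g : Metric n M) (z x : M) (t : ℝ) (ξ : Model n →L[ℝ] ℝ) : ℂ :=
  Polynomial.aeval Complex.I (orbitPencil g z x t ξ)

/-- The squared phase of the tangent space of the blow-down Lagrangian. -/
def orbitPhase (g : Metric n M) (z : M) (t : ℝ) (ξ : Model n →L[ℝ] ℝ) : ℂ :=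
  orbitDet g z (iota g z t ξ).1 t ξ ^ 2 / (‖orbitDet g z (iota g z t ξ).1 t ξ‖ ^ 2 : ℝ)

/-- A real factor, of either sign, disappears from the normalized square; changes of frame and chart
multiply the determinant by such factors. -/
lemma sq_div_norm_sq_of_eq_mul {a b : ℂ} {c : ℝ} (hc : c ≠ 0) (h : a = c * b) :
    a ^ 2 / (‖a‖ ^ 2 : ℝ) = b ^ 2 / (‖b‖ ^ 2 : ℝ) := by
  have hc' : (c : ℂ) ^ 2 ≠ 0 := pow_ne_zero _ (by exact_mod_cast hc)
  rw [h, norm_mul, mul_pow, mul_pow, Complex.norm_real, Real.norm_eq_abs, sq_abs,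
    Complex.ofReal_mul, Complex.ofReal_pow, mul_div_mul_left _ _ hc']

variable {g : Metric n M} {z : M} {T : ℝ} [T2Space M] (hb : IsBlowDownPoint g z T)
  {t : ℝ} {ξ : Model n →L[ℝ] ℝ} {x : M}
include hb

lemma orbitDet_ne_zero (hξ : ξ ∈ unitCosphere g z)
    (hx : (iota g z t ξ).1 ∈ (extChartAt (𝓡 n) x).source) : orbitDet g z x t ξ ≠ 0 := by
  rw [orbitDet, orbitPencil, framePencil, aeval_pencil]
  exact det_complexPencil_ne_zero (posDef_frameG (cotChart_mem_target hx))
    (isSymm_frame (cotChart_mem_target hx) (omega_ell hb hξ hx))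
    (nondegenerate_frame (ell_eq_zero hb hξ hx))

lemma orbitPhase_eq (hx : (iota g z t ξ).1 ∈ (extChartAt (𝓡 n) x).source) :
    orbitPhase g z t ξ = orbitDet g z x t ξ ^ 2 / (‖orbitDet g z x t ξ‖ ^ 2 : ℝ) := by
  obtain ⟨c, hc, h⟩ := orbitPencil_change hb (mem_extChartAt_source (I := 𝓡 n) (iota g z t ξ).1) hx
  refine sq_div_norm_sq_of_eq_mul hc ?_
  rw [orbitDet, h, map_mul, Polynomial.aeval_C]
  rfl

lemma continuousAt_orbitPhase (hξ : ξ ∈ unitCosphere g z) :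
    ContinuousAt (fun p : ℝ × (Model n →L[ℝ] ℝ) => orbitPhase g z p.1 p.2) (t, ξ) := by
  have hx := mem_extChartAt_source (I := 𝓡 n) (iota g z t ξ).1
  set x := (iota g z t ξ).1
  have h1 : ContinuousAt (fun p : ℝ × (Model n →L[ℝ] ℝ) => orbitDet g z x p.1 p.2) (t, ξ) := by
    have h2 : ContinuousAt (fun p : ℝ × (Model n →L[ℝ] ℝ) =>
        (Matrix.of fun a b => complexLoc g x (cotChart n x (iota g z p.1 p.2))
          (ell g z x p.1 p.2 (coframe a)) (stdVec b) : Matrix (Fin n) (Fin n) ℂ)) (t, ξ) :=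
      continuousAt_pi.2 fun a => continuousAt_pi.2 fun b =>
        continuousAt_complexLoc_ell hb hx (coframe a) (stdVec b)
    have h3 : Continuous fun A : Matrix (Fin n) (Fin n) ℂ => A.det :=
      continuous_id.matrix_det
    refine (h3.continuousAt.comp h2).congr (Eventually.of_forall fun p => ?_)
    exact eval_framePencil_I.symm
  have h2 : ContinuousAt (fun p : ℝ × (Model n →L[ℝ] ℝ) => orbitDet g z x p.1 p.2 ^ 2 /
      (‖orbitDet g z x p.1 p.2‖ ^ 2 : ℝ)) (t, ξ) := by
    refine (h1.pow 2).div (Complex.continuous_ofReal.continuousAt.comp (h1.norm.pow 2)) ?_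
    exact_mod_cast pow_ne_zero 2 (norm_ne_zero_iff.2 (orbitDet_ne_zero hb hξ hx))
  refine h2.congr ?_
  filter_upwards [eventually_iota_mem hb.isCompleteAt hx] with p hp
  exact (orbitPhase_eq hb hp).symm

lemma norm_orbitPhase (hξ : ξ ∈ unitCosphere g z) : ‖orbitPhase g z t ξ‖ = 1 := by
  have h := orbitDet_ne_zero hb hξ (mem_extChartAt_source (I := 𝓡 n) (iota g z t ξ).1)
  rw [orbitPhase, norm_div, norm_pow, Complex.norm_real, norm_pow, norm_norm,
    div_self (pow_ne_zero _ (norm_ne_zero_iff.2 h))]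

lemma mem_tangentSpan_of_eq {p : Cotangent n M} (hξ : ξ ∈ unitCosphere g z)
    (hp : iota g z t ξ = p) {v : TangentSpace (cotModel n) p} :
    v ∈ tangentSpan (blowDownLagrangian g z T) p ↔ ∃ η, ell g z p.1 t ξ η = comps p v := by
  subst hp
  exact mem_tangentSpan_iff hb hξ

/-- The pencils at a point, for two ways to reach it. -/
lemma orbitPencil_of_eq {t' : ℝ} {ξ' : Model n →L[ℝ] ℝ} (hξ : ξ ∈ unitCosphere g z)
    (hξ' : ξ' ∈ unitCosphere g z) (h : iota g z t ξ = iota g z t' ξ') :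
    ∃ c : ℝ, c ≠ 0 ∧ orbitPencil g z (iota g z t ξ).1 t ξ =
      Polynomial.C c * orbitPencil g z (iota g z t' ξ').1 t' ξ' := by
  have hx := mem_extChartAt_source (I := 𝓡 n) (iota g z t ξ).1
  have hx' := mem_extChartAt_source (I := 𝓡 n) (iota g z t' ξ').1
  set E := ell g z (iota g z t ξ).1 t ξ
  set E' := ell g z (iota g z t' ξ').1 t' ξ'
  have hinj : LinearMap.ker E'.toLinearMap = ⊥ :=
    LinearMap.ker_eq_bot'.2 (ell_eq_zero hb hξ' hx')
  obtain ⟨L, hL⟩ := LinearMap.exists_leftInverse_of_injective _ hinj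
  -- Both frames span the tangent space of the set `Λ` at the common point, which does not refer to
  -- the parametrization; the left inverse of one frame then gives the change of frame.
  have hrange : ∀ η, ∃ η', E' η' = E η := by
    intro η
    have h1 : (show TangentSpace (cotModel n) (iota g z t ξ) from E η) ∈
        tangentSpan (blowDownLagrangian g z T) (iota g z t ξ) :=
      (mem_tangentSpan_iff hb hξ).2 ⟨η, rfl⟩
    obtain ⟨η', hη'⟩ := (mem_tangentSpan_of_eq hb hξ' h.symm).1 h1
    refine ⟨η', ?_⟩
    simp only [E', ← h]
    exact hη'
  have hE : ∀ η, E' (L (E η)) = E η := by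
    intro η
    obtain ⟨η', hη'⟩ := hrange η
    rw [← hη']
    exact congrArg E' (LinearMap.congr_fun hL η')
  let A : (Model n →L[ℝ] ℝ) →L[ℝ] (Model n →L[ℝ] ℝ) :=
    LinearMap.toContinuousLinearMap (L ∘ₗ E.toLinearMap)
  have hA : E = E'.comp A := by
    ext1 η
    exact (hE η).symm
  have hA0 : ∀ η, A η = 0 → η = 0 := by
    intro η hη
    refine ell_eq_zero hb hξ hx η ?_
    change E η = 0
    rw [← hE η]
    have : L (E η) = 0 := hη
    rw [this, map_zero]
  obtain ⟨c, hc, h1⟩ := framePencil_comp (g := g) (x := (iota g z t' ξ').1)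
    (q := cotChart n (iota g z t' ξ').1 (iota g z t' ξ')) (E := E') hA0
  refine ⟨c, hc, ?_⟩
  change framePencil g _ _ E = _
  rw [hA, h]
  exact h1

lemma orbitPhase_of_eq {t' : ℝ} {ξ' : Model n →L[ℝ] ℝ} (hξ : ξ ∈ unitCosphere g z)
    (hξ' : ξ' ∈ unitCosphere g z) (h : iota g z t ξ = iota g z t' ξ') :
    orbitPhase g z t ξ = orbitPhase g z t' ξ' := by
  obtain ⟨c, hc, h1⟩ := orbitPencil_of_eq hb hξ hξ' h
  refine sq_div_norm_sq_of_eq_mul hc ?_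
  rw [orbitDet, h1, map_mul, Polynomial.aeval_C]
  rfl

/-- At time `0` the plane consists of the vertical covectors orthogonal to `ξ` and the flow
direction, whose complex covector is `i ξ`. The pencil at `r` is the determinant of the identity
plus `(r - 1)` times the rank one matrix of `ξ^♯` and `ξ`, which is `1 + (r - 1)|ξ|² = r`. Hence the
squared phase starts at `i² = -1`, with angle `π`. -/
lemma orbitPencil_zero (hξ : ξ ∈ unitCosphere g z) :
    orbitPencil g z z 0 ξ = Polynomial.X := by
  have hz := hb.isCompleteAt
  have hq : cotChart n z (iota g z 0 ξ) = (extChartAt (𝓡 n) z z, ξ) := by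
    rw [iota_zero hz, cotChart_covector]
  have hx : (iota g z 0 ξ).1 ∈ (extChartAt (𝓡 n) z).source := by
    rw [iota_zero hz]
    exact mem_extChartAt_source z
  have hloc : ∀ (η : Model n →L[ℝ] ℝ) (w : Model n),
      complexLoc g z (cotChart n z (iota g z 0 ξ)) (ell g z z 0 ξ η) w =
        ((η - η (sharpAt g z ξ) • ξ) w : ℝ) + (η (sharpAt g z ξ) * ξ w : ℝ) * Complex.I := by
    intro η w
    rw [ell_apply, jac_zero hz, ← complexBil_apply, map_add, map_smul, LinearMap.add_apply,
      LinearMap.smul_apply, complexBil_apply, complexBil_apply, complexLoc_vertical, speed,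
      complexLoc_geoField g (cotChart_mem_target hx), hq, Complex.real_smul]
    push_cast
    ring
  refine Polynomial.funext fun r => ?_
  rw [orbitPencil, framePencil, eval_pencil, Polynomial.eval_X, frameX_mul_frameG]
  have h1 : frameRe g z (cotChart n z (iota g z 0 ξ)) (ell g z z 0 ξ) +
      r • (Matrix.of fun a b => (complexLoc g z (cotChart n z (iota g z 0 ξ))
        (ell g z z 0 ξ (coframe a)) (stdVec b)).im) =
      1 + Matrix.replicateCol Unit (fun a => (r - 1) * sharpAt g z ξ a) *
        Matrix.replicateRow Unit (fun b => ξ (stdVec b)) := by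
    ext a b
    simp only [frameRe, Matrix.add_apply, Matrix.smul_apply, Matrix.of_apply, hloc, smul_eq_mul,
      Matrix.mul_apply, Matrix.replicateCol_apply, Matrix.replicateRow_apply, Matrix.one_apply]
    simp [coframe_apply, stdVec, eq_comm]
    ring
  rw [h1, Matrix.det_one_add_replicateCol_mul_replicateRow]
  have h2 : dotProduct (fun b => ξ (stdVec b)) (fun a => (r - 1) * sharpAt g z ξ a) =
      (r - 1) * ξ (sharpAt g z ξ) := by
    have h3 : ξ (sharpAt g z ξ) = ∑ b, sharpAt g z ξ b • ξ (stdVec b) :=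
      (sum_stdVec ξ.toLinearMap (sharpAt g z ξ)).symm
    rw [h3, dotProduct, Finset.mul_sum]
    refine Finset.sum_congr rfl fun b _ => ?_
    rw [smul_eq_mul]
    ring
  rw [h2, mem_unitCosphere.1 hξ]
  ring

lemma orbitPencil_zero' (hξ : ξ ∈ unitCosphere g z) :
    orbitPencil g z (iota g z 0 ξ).1 0 ξ = Polynomial.X := by
  rw [iota_zero hb.isCompleteAt]
  exact orbitPencil_zero hb hξ

lemma orbitPhase_zero (hξ : ξ ∈ unitCosphere g z) : orbitPhase g z 0 ξ = -1 := by
  rw [orbitPhase, orbitDet, orbitPencil_zero' hb hξ]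
  simp

end OrbitPhase

end BlowDown

end

/-! ### The common Morse index and the Maslov number -/

noncomputable section

open Filter Topology

namespace BlowDown

set_option synthInstance.maxHeartbeats 200000
set_option maxSynthPendingDepth 3
set_option linter.unusedSectionVars false

variable {n : ℕ} {M : Type*} [TopologicalSpace M] [ChartedSpace (Model n) M]
  [IsManifold (𝓡 n) ∞ M]

section Index

lemma finrank_covector : Module.finrank ℝ (Model n →L[ℝ] ℝ) = n := by
  rw [← LinearEquiv.finrank_eq (covecEquiv (n := n)), Module.finrank_fin_fun]

/-- The sphere is the image of the punctured covector space under normalization, and the puncture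
does not disconnect in dimension at least two. -/
lemma isPreconnected_unitCosphere (g : Metric n M) (z : M) (hn : 2 ≤ n) :
    IsPreconnected (unitCosphere g z) := by
  have h1 : IsPreconnected ({0}ᶜ : Set (Model n →L[ℝ] ℝ)) := by
    refine (isConnected_compl_singleton_of_one_lt_rank ?_ 0).isPreconnected
    rw [← Module.finrank_eq_rank, finrank_covector]
    exact_mod_cast hn
  have h2 : unitCosphere g z =
      (fun ξ : Model n →L[ℝ] ℝ => (Real.sqrt (ξ (sharpAt g z ξ)))⁻¹ • ξ) '' {0}ᶜ := by
    ext ξ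
    constructor
    · intro h
      have h3 := mem_unitCosphere.1 h
      refine ⟨ξ, ?_, ?_⟩
      · rintro rfl
        simp at h3
      · simp [h3]
    · rintro ⟨ζ, hζ, rfl⟩
      exact smul_mem_unitCosphere g z hζ
  have h3 : Continuous fun ξ : Model n →L[ℝ] ℝ => Real.sqrt (ξ (sharpAt g z ξ)) :=
    Real.continuous_sqrt.comp (continuous_sharpAt_self g z)
  rw [h2]
  refine h1.image _ (ContinuousOn.smul (h3.continuousOn.inv₀ ?_) continuousOn_id)
  exact fun ξ hξ => (Real.sqrt_pos.2 (sharpAt_pos g z hξ)).ne'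

/-- A continuous logarithm of the squared phase along the orbits, that starts at the vertical. -/
structure IsOrbitAngle (g : Metric n M) (z : M) (Θ : ℝ × unitCosphere g z → ℝ) : Prop where
  continuous : Continuous Θ
  exp_eq : ∀ p, (Circle.exp (Θ p) : ℂ) = orbitPhase g z p.1 p.2
  zero : ∀ ξ, Θ (0, ξ) = Real.pi

variable {g : Metric n M} {z : M} {T : ℝ} [T2Space M] (hb : IsBlowDownPoint g z T)
include hb

lemma exists_isOrbitAngle : ∃ Θ, IsOrbitAngle g z Θ := by
  have hcont : Continuous fun p : ℝ × unitCosphere g z => orbitPhase g z p.1 p.2 := by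
    refine continuous_iff_continuousAt.2 fun p => ?_
    exact (continuousAt_orbitPhase hb (t := p.1) p.2.2).comp
      (f := fun p : ℝ × unitCosphere g z => (p.1, (p.2 : Model n →L[ℝ] ℝ)))
      (Continuous.continuousAt (by fun_prop))
  have hnorm : ∀ p : ℝ × unitCosphere g z, ‖orbitPhase g z p.1 p.2‖ = 1 := fun p =>
    norm_orbitPhase hb p.2.2
  obtain ⟨c, hc⟩ := continuous_circle_mk hcont fun p h => by simpa [h] using hnorm p
  have hc' : ∀ p, (c p : ℂ) = orbitPhase g z p.1 p.2 := fun p => by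
    rw [hc, hnorm, Complex.ofReal_one, div_one]
  obtain ⟨Θ, h1, h2, h3⟩ := exists_phase c Real.pi fun ξ => by
    refine Circle.ext ?_
    rw [hc', Circle.coe_exp, Complex.exp_pi_mul_I]
    exact orbitPhase_zero hb ξ.2
  exact ⟨Θ, h1, fun p => by rw [h2, hc'], h3⟩

variable {Θ : ℝ × unitCosphere g z → ℝ} (hΘ : IsOrbitAngle g z Θ)
include hΘ

lemma sq_orbitDet_eq (t : ℝ) (ξ : unitCosphere g z) :
    orbitDet g z (iota g z t ξ).1 t ξ ^ 2 = (‖orbitDet g z (iota g z t ξ).1 t ξ‖ ^ 2 : ℝ) *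
      Complex.exp (Θ (t, ξ) * Complex.I) := by
  have h1 := hΘ.exp_eq (t, ξ)
  have h2 := orbitDet_ne_zero hb ξ.2 (mem_extChartAt_source (I := 𝓡 n) (iota g z t ξ).1)
  have h3 : ((‖orbitDet g z (iota g z t ξ).1 t ξ‖ ^ 2 : ℝ) : ℂ) ≠ 0 := by
    exact_mod_cast pow_ne_zero 2 (norm_ne_zero_iff.2 h2)
  rw [Circle.coe_exp] at h1
  rw [h1]
  exact (mul_div_cancel₀ _ h3).symm

/-- The number of conjugate times is the total variation of the squared phase. -/
lemma finite_conj_and_sum (ξ : unitCosphere g z) :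
    {t ∈ Ioc 0 T | conjMultiplicity g z ξ t ≠ 0}.Finite ∧
      Θ (T, ξ) = Real.pi +
        2 * Real.pi * ((∑ᶠ t ∈ Ioc 0 T, conjMultiplicity g z ξ t : ℕ) : ℝ) := by
  have hconj : ∀ t ∈ Ioc 0 T, conjMultiplicity g z ξ t = orbitMult g z t ξ := fun t ht =>
    conjMultiplicity_eq hb ξ.2 ht.1.ne'
  have hjump := fun t₀ => orbit_jump hb ξ.2 (Θ := fun t => Θ (t, ξ))
    (hΘ.continuous.comp (by fun_prop)) (fun t => sq_orbitDet_eq hb hΘ t ξ) t₀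
  obtain ⟨h1, h2⟩ := finite_and_sum_jumps (fun t => (hjump t).1) (fun t => (hjump t).2)
    hb.time_pos.le
  refine ⟨?_, ?_⟩
  · convert h1 using 1
    ext t
    exact and_congr_right fun ht => by rw [hconj t ht]
  · rw [finsum_mem_congr rfl hconj, h2, hΘ.zero]
    -- At time `T` the orbit is at a unit covector over `z`. Its pencil there has the same root as
    -- at the start, so the branches cancel and only the change of the phase is left.
    obtain ⟨η, hη, hshift⟩ := exists_shift hb 1 ξ.2
    have h3 : iota g z T ξ = iota g z 0 η := by
      rw [← hshift 0]
      simp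
    obtain ⟨c, hc, h4⟩ := orbitPencil_of_eq hb ξ.2 hη h3
    rw [h4, orbitPencil_zero' hb hη, orbitPencil_zero' hb ξ.2, rootArg_C_mul hc, rootArg_X]
    have := Real.pi_pos.ne'
    field_simp
    ring

/-- The count is an affine function of the angle at time `T`, hence continuous in `ξ`; an integer
function on a connected sphere is constant. In dimension one the sphere need not be connected, but
all counts are zero. -/
lemma exists_index : ∃ β : ℕ, ∀ ξ : unitCosphere g z,
    HasMorseIndex g z T ξ β ∧ Θ (T, ξ) = Real.pi + 2 * Real.pi * β := by
  set N : unitCosphere g z → ℕ := fun ξ => ∑ᶠ t ∈ Ioc 0 T, conjMultiplicity g z ξ t with hN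
  have hsum := fun ξ => finite_conj_and_sum hb hΘ ξ
  suffices h : ∀ ξ ξ', N ξ = N ξ' by
    -- For an empty sphere, as in dimension zero, any index would do.
    rcases isEmpty_or_nonempty (unitCosphere g z) with he | ⟨⟨ξ₀⟩⟩
    · exact ⟨0, fun ξ => (he.false ξ).elim⟩
    · refine ⟨N ξ₀, fun ξ => ⟨⟨(hsum ξ).1, h ξ ξ₀⟩, ?_⟩⟩
      rw [(hsum ξ).2, ← h ξ ξ₀]
  intro ξ ξ'
  rcases le_or_gt 2 n with hn | hn
  · have : PreconnectedSpace (unitCosphere g z) :=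
      Subtype.preconnectedSpace (isPreconnected_unitCosphere g z hn)
    have hcont : Continuous N := by
      rw [Nat.isClosedEmbedding_coe_real.isEmbedding.continuous_iff]
      have h1 : Continuous fun ξ => (Θ (T, ξ) - Real.pi) / (2 * Real.pi) :=
        ((hΘ.continuous.comp (by fun_prop)).sub continuous_const).div_const _
      refine h1.congr fun ξ => ?_
      rw [(hsum ξ).2]
      have := Real.pi_pos.ne'
      simp only [Function.comp_apply, hN]
      field_simp
      ring
    exact PreconnectedSpace.constant this hcont
  -- A vertical tangent vector comes from a covector orthogonal to `ξ`, and on a line there is none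
  -- but zero.
  · have hzero : ∀ ξ : unitCosphere g z, N ξ = 0 := by
      intro ξ
      refine finsum_mem_eq_zero_of_forall_eq_zero fun t ht => ?_
      rw [conjMultiplicity_eq hb ξ.2 ht.1.ne', orbitMult]
      have h1 : LinearMap.ker (baseMap g z (iota g z t ξ).1 t ξ) = ⊥ := by
        refine LinearMap.ker_eq_bot'.2 fun η hη => ?_
        have h2 := (ell_of_fst_eq_zero hb ξ.2 (mem_extChartAt_source _) hη).1
        have h3 := ne_zero_of_mem_unitCosphere hb ξ.2
        have h4 : Module.finrank ℝ (Model n →L[ℝ] ℝ) = 1 := by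
          have h5 : 0 < Module.finrank ℝ (Model n →L[ℝ] ℝ) :=
            Module.finrank_pos_iff_exists_ne_zero.2 ⟨_, h3⟩
          rw [finrank_covector] at h5 ⊢
          omega
        obtain ⟨c, rfl⟩ := exists_smul_eq_of_finrank_eq_one h4 h3 η
        rw [_root_.smul_apply, mem_unitCosphere.1 ξ.2, smul_eq_mul, mul_one] at h2
        rw [h2, zero_smul]
      rw [h1, finrank_bot]
    rw [hzero, hzero]

/-- Both sides lift the same path on the circle, because the squared phase depends only on the point
of the Lagrangian, and they agree at `t = 0`. -/
lemma angle_shift_time {β : ℕ} (hβ : ∀ ξ, Θ (T, ξ) = Real.pi + 2 * Real.pi * β)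
    {ξ η : unitCosphere g z} (h : ∀ t, iota g z (t + T) ξ = iota g z t η) (t : ℝ) :
    Θ (t + T, ξ) = Θ (t, η) + 2 * Real.pi * β := by
  have h1 : Continuous fun t => Θ (t + T, ξ) := hΘ.continuous.comp (by fun_prop)
  have h2 : Continuous fun t => Θ (t, η) + 2 * Real.pi * β :=
    (hΘ.continuous.comp (by fun_prop)).add continuous_const
  refine congrFun (exp_injOn_paths h1 h2 (fun t => ?_) (t₀ := 0) ?_) t
  · refine Circle.ext ?_
    have h3 : Circle.exp (Θ (t, η) + 2 * Real.pi * β) = Circle.exp (Θ (t, η)) := by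
      rw [Circle.exp_eq_exp]
      exact ⟨β, by push_cast; ring⟩
    rw [h3, hΘ.exp_eq, hΘ.exp_eq]
    exact orbitPhase_of_eq hb ξ.2 η.2 (h t)
  · simp only [zero_add]
    rw [hβ, hΘ.zero]

/-- Successive returns generally have different initial covectors, but the gain is the same at each
return because the index is common to the whole sphere. -/
lemma angle_period {β : ℕ} (hβ : ∀ ξ, Θ (T, ξ) = Real.pi + 2 * Real.pi * β) (k : ℤ) :
    ∀ ξ η : unitCosphere g z, (∀ t, iota g z (t + k * T) ξ = iota g z t η) → ∀ t,
      Θ (t + k * T, ξ) = Θ (t, η) + 2 * Real.pi * (β * k) := by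
  have hz := hb.isCompleteAt
  induction k using Int.induction_on with
  | zero =>
    intro ξ η h t
    have h1 := h 0
    simp only [Int.cast_zero, zero_mul, add_zero] at h1
    rw [Subtype.ext (iota_inj hz h1)]
    simp
  | succ k ih =>
    intro ξ η h t
    obtain ⟨ζ, hζ, hs⟩ := exists_shift hb k ξ.2
    have h1 := ih ξ ⟨ζ, hζ⟩ hs (t + T)
    have h2 := angle_shift_time hb hΘ hβ (ξ := ⟨ζ, hζ⟩) (η := η) (fun t => by
      rw [← h, ← hs]
      congr 1
      push_cast
      ring) t
    rw [h2] at h1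
    have h3 : t + ((k : ℤ) + 1 : ℤ) * T = t + T + (k : ℤ) * T := by
      push_cast
      ring
    rw [h3, h1]
    push_cast
    ring
  | pred k ih =>
    intro ξ η h t
    obtain ⟨ζ, hζ, hs⟩ := exists_shift hb (-k) ξ.2
    have h1 := ih ξ ⟨ζ, hζ⟩ hs (t - T)
    have h2 := angle_shift_time hb hΘ hβ (ξ := η) (η := ⟨ζ, hζ⟩) (fun t => by
      rw [← h, ← hs]
      congr 1
      push_cast
      ring) (t - T)
    rw [sub_add_cancel] at h2
    have h3 : t + (-(k : ℤ) - 1 : ℤ) * T = t - T + (-(k : ℤ) : ℤ) * T := by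
      push_cast
      ring
    rw [h3, h1, h2]
    push_cast
    ring

/-- The squared phase of the blow-down Lagrangian, in terms of the angle. -/
lemma isSquaredPhase_orbit (t : ℝ) (ξ : unitCosphere g z) :
    IsSquaredPhase g (blowDownLagrangian g z T) (iota g z t ξ) (Θ (t, ξ)) := by
  have hx := mem_extChartAt_source (I := 𝓡 n) (iota g z t ξ).1
  let L : (Model n →L[ℝ] ℝ) →ₗ[ℝ] TangentSpace (cotModel n) (iota g z t ξ) :=
    (ell g z (iota g z t ξ).1 t ξ).toLinearMap
  have hL : Function.Injective L :=
    LinearMap.ker_eq_bot.1 (LinearMap.ker_eq_bot'.2 (ell_eq_zero hb ξ.2 hx))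
  have hrange : LinearMap.range L = tangentSpan (blowDownLagrangian g z T) (iota g z t ξ) := by
    ext v
    exact (mem_tangentSpan_iff hb ξ.2).symm
  let e : (Model n →L[ℝ] ℝ) ≃ₗ[ℝ] tangentSpan (blowDownLagrangian g z T) (iota g z t ξ) :=
    (LinearEquiv.ofInjective L hL).trans (LinearEquiv.ofEq _ _ hrange)
  have he : ∀ a, ((coframe.map e a : tangentSpan (blowDownLagrangian g z T) (iota g z t ξ)) :
      TangentSpace (cotModel n) (iota g z t ξ)) = L (coframe a) := fun a => rfl
  have hdet : (frameMatrix g (iota g z t ξ) fun a => (coframe.map e a :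
      tangentSpan (blowDownLagrangian g z T) (iota g z t ξ))).det =
      orbitDet g z (iota g z t ξ).1 t ξ := by
    rw [orbitDet, orbitPencil, eval_framePencil_I]
    congr 1
    ext a b
    rw [frameMatrix, Matrix.of_apply, Matrix.of_apply, complexPart_eq]
    rfl
  refine ⟨coframe.map e, fun a b => ?_, ?_⟩
  · rw [symplecticForm_eq, he, he]
    exact omega_ell hb ξ.2 hx _ _
  · rw [hdet]
    exact sq_orbitDet_eq hb hΘ t ξ

/-- The Maslov number of the closed curves in the blow-down Lagrangian. -/
lemma hasMaslovNumber_curve {β : ℕ} (hβ : ∀ ξ, Θ (T, ξ) = Real.pi + 2 * Real.pi * β)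
    {t : ℝ → ℝ} {ξ : ℝ → Model n →L[ℝ] ℝ} (ht : Continuous t) (hξ : Continuous ξ)
    (hS : ∀ s, ξ s ∈ unitCosphere g z) (h : iota g z (t 1) (ξ 1) = iota g z (t 0) (ξ 0)) :
    ∃ k : ℤ, t 1 - t 0 = k * T ∧ HasMaslovNumber g (blowDownLagrangian g z T)
      (fun s => iota g z (t s) (ξ s)) (β * k) := by
  obtain ⟨k, hk⟩ := exists_int_of_iota_eq hb (hS 1) h
  refine ⟨k, by rw [hk]; ring, fun s => Θ (t s, ⟨ξ s, hS s⟩),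
    hΘ.continuous.comp (ht.prodMk (hξ.subtype_mk hS)),
    fun s => isSquaredPhase_orbit hb hΘ (t s) ⟨ξ s, hS s⟩, ?_⟩
  -- The shift of the final covector is identified with the initial one: the endpoints of the lift
  -- differ by `k` turns of the mapping torus, so `angle_period` gives the winding.
  obtain ⟨η, hη, hs⟩ := exists_shift hb k (hS 1)
  have h1 := hs (t 0)
  rw [← hk, h] at h1
  have h2 : η = ξ 0 := (iota_inj hb.isCompleteAt h1).symm
  subst h2
  have h3 := angle_period hb hΘ hβ k ⟨ξ 1, hS 1⟩ ⟨ξ 0, hη⟩ hs (t 0)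
  rw [← hk] at h3
  beta_reduce
  rw [h3]
  push_cast
  ring

end Index

end BlowDown

end

/-! ### Assembly of the theorem -/

open BlowDown in
theorem mainTheorem6 {n : ℕ} {M : Type*} [TopologicalSpace M] [T2Space M]
    [ChartedSpace (EuclideanSpace ℝ (Fin n)) M] [IsManifold (𝓡 n) ∞ M]
    (g : Metric n M) (z : M) (T : ℝ) (hz : IsBlowDownPoint g z T) :
    ∃ β : ℕ,
      (∀ ξ ∈ unitCosphere g z, HasMorseIndex g z T ξ β) ∧
      (∀ (t : ℝ → ℝ) (ξ : ℝ → Model n →L[ℝ] ℝ), ContDiff ℝ 1 t → ContDiff ℝ 1 ξ →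
        (∀ s, ξ s ∈ unitCosphere g z) →
        (∀ s, actionForm (iota g z (t s) (ξ s)) (velocity (fun s => iota g z (t s) (ξ s)) s) =
          deriv t s) ∧
        (Function.Periodic (fun s => iota g z (t s) (ξ s)) 1 →
          ∃ m : ℤ, HasMaslovNumber g (blowDownLagrangian g z T)
              (fun s => iota g z (t s) (ξ s)) m ∧
            (m : ℝ) = β / T * ∫ s in (0 : ℝ)..1, deriv t s)) ∧
      ∀ k : ℤ, SatisfiesBohrSommerfeld g (blowDownLagrangian g z T)
        (2 * Real.pi / T * (k + β / 4)) := by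
  have hc := hz.isCompleteAt
  have hT := hz.time_pos.ne'
  obtain ⟨Θ, hΘ⟩ := exists_isOrbitAngle hz
  obtain ⟨β, hβ⟩ := exists_index hz hΘ
  have hβ' := fun ξ => (hβ ξ).2
  have hint : ∀ t : ℝ → ℝ, ContDiff ℝ 1 t → ∫ s in (0 : ℝ)..1, deriv t s = t 1 - t 0 :=
    fun t ht => intervalIntegral.integral_deriv_eq_sub
      (fun s _ => ht.differentiable (by simp) s) ((ht.continuous_deriv le_rfl).intervalIntegrable _ _)
  refine ⟨β, fun ξ hξ => (hβ ⟨ξ, hξ⟩).1, fun t ξ ht hξ hS =>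
    ⟨actionForm_iota_curve hc ht hξ hS, fun hper => ?_⟩, fun k γ hγ => ?_⟩
  · have h1 : iota g z (t 1) (ξ 1) = iota g z (t 0) (ξ 0) := by simpa using hper 0
    obtain ⟨j, hj, hm⟩ := hasMaslovNumber_curve hz hΘ hβ' ht.continuous hξ.continuous hS h1
    refine ⟨β * j, hm, ?_⟩
    rw [hint t ht, hj]
    push_cast
    field_simp
  · obtain ⟨t₀, ξ₀, hξ₀, h₀⟩ := (mem_blowDownLagrangian hz).1 (hγ.mem 0)
    obtain ⟨t, ξ, ht, hξ, hS, hι, -, -⟩ := exists_contDiff_lift hz hγ.smooth hγ.mem hξ₀ h₀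
    have h1 : iota g z (t 1) (ξ 1) = iota g z (t 0) (ξ 0) := by
      rw [hι, hι]
      simpa using hγ.periodic 0
    obtain ⟨j, hj, hm⟩ := hasMaslovNumber_curve hz hΘ hβ' ht.continuous hξ.continuous hS h1
    have h2 : (fun s => iota g z (t s) (ξ s)) = γ := funext hι
    have h3 : actionIntegral γ = j * T := by
      rw [← hj, ← hint t ht, ← h2]
      exact intervalIntegral.integral_congr fun s _ => actionForm_iota_curve hc ht hξ hS s
    rw [h2] at hm
    -- With action `jT` and Maslov number `βj`, the defect is `(k + β/4) j - βj/4`, and the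
    -- fractional parts cancel.
    refine ⟨β * j, hm, k * j, ?_⟩
    rw [h3]
    have := Real.pi_pos.ne'
    push_cast
    field_simp
    ring
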